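/- Let $p\ge 2$, $\sigma_s,\sigma>0$, and let $\mathbf a\in\mathbb C^p$ with $\|\mathbf a\|^2=p$. Let $\mathbf x(0),\mathbf x(1),\dots$ be independent zero-mean circularly symmetric complex Gaussian vectors in $\mathbb C^p$ with covariance $\mathbf R=\sigma_s^2\,\mathbf a\mathbf a^H+\sigma^2\mathbf I$ (one interferer of power $\sigma_s^2$ with spatial signature $\mathbf a$, in white noise of power $\sigma^2$), and put $\mathrm{INR}=\sigma_s^2/\sigma^2$. For $N\ge 1$ let $\hat{\mathbf R}=\frac1N\sum_{n=0}^{N-1}\mathbf x(n)\mathbf x(n)^H$ and let $\hat{\mathbf u}_1,\dots,\hat{\mathbf u}_p$ (random vectors depending on $N$) be an orthonormal basis of eigenvectors of $\hat{\mathbf R}$, ordered by decreasing eigenvalue. Let $\hat{\mathbf a}$ be the estimated signature, that is, any nonzero (possibly random) scalar multiple of $\hat{\mathbf u}_1$. Write $\mathbf P_{\mathbf v}=\mathbf v(\mathbf v^H\mathbf v)^{-1}\mathbf v^H$ and $\mathbf P_{\mathbf v}^\perp=\mathbf I-\mathbf P_{\mathbf v}$. Then, as $N\to\infty$ with $p,\sigma_s,\sigma,\mathbf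 a$ fixed: 1. For every $m>1$, $$\mathrm E\|\mathbf P_{\hat{\mathbf u}_m}\mathbf a\|^2=p\,\frac{\sigma^2}{N}\,\frac{p\sigma_s^2+\sigma^2}{(p\sigma_s^2)^2}+o(N^{-1})=\frac pN\,\frac{p\,\mathrm{INR}+1}{(p\,\mathrm{INR})^2}+o(N^{-1}).$$ 2. $$\mathrm E\|\mathbf P_{\hat{\mathbf a}}^\perp\mathbf a\|^2=\mathrm E\|\mathbf P_{\hat{\mathbf u}_1}^\perp\mathbf a\|^2=\frac{p(p-1)}N\,\frac{p\,\mathrm{INR}+1}{(p\,\mathrm{INR})^2}+o(N^{-1}).$$ 3. The residual interference is spatially white within the projected space, in the following sense. Almost surely $\hat{\mathbf u}_2,\dots,\hat{\mathbf u}_p$ span the projected space $\hat{\mathbf a}^\perp$; by part 1 the expected residual power is the same, up to $o(N^{-1})$, in each of these directions; $\mathrm E\{(\mathbf P_{\hat{\mathbf u}_m}\mathbf a)^H(\mathbf P_{\hat{\mathbf u}_n}\mathbf a)\}=0$ for $m\ne n$; and the covariance matrix of the residual interference satisfies, entrywise, $$\sigma_s^2\,\mathrm E\{(\mathbf P_{\hat{\mathbf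 a}}^\perp\mathbf a)(\mathbf P_{\hat{\mathbf a}}^\perp\mathbf a)^H\}=\frac{\sigma^2}N\Bigl(1+\frac1{p\,\mathrm{INR}}\Bigr)\mathbf P_{\mathbf a}^\perp+o(N^{-1}).$$ 4. The residual interference-to-noise ratio satisfies $$\mathrm{INR}':=\frac{\sigma_s^2}{\sigma^2}\,\frac{\mathrm E\|\mathbf P_{\hat{\mathbf a}}^\perp\mathbf a\|^2}{p-1}=\frac1N\Bigl(1+\frac1{p\,\mathrm{INR}}\Bigr)+o(N^{-1}).$$ -/

import Mathlib

open MeasureTheory ProbabilityTheory Filter Asymptotics Topology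
open scoped ComplexConjugate Matrix

namespace ResidualInterference

noncomputable section

/-- `X` is a zero-mean (circularly symmetric) complex Gaussian random vector with covariance
matrix `R`: it is jointly Gaussian as a real random vector, `E X = 0`, `E X Xᴴ = R` and
`E X Xᵀ = 0`. -/
structure IsComplexGaussian {Ω : Type*} [MeasurableSpace Ω] (P : Measure Ω) {p : ℕ}
    (X : Ω → EuclideanSpace ℂ (Fin p)) (R : Matrix (Fin p) (Fin p) ℂ) : Prop where
  gaussian : HasGaussianLaw X P
  mean : ∀ i, ∫ ω, X ω i ∂P = 0
  cov : ∀ i j, ∫ ω, X ω i * conj (X ω j) ∂P = R i j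
  pseudoCov : ∀ i j, ∫ ω, X ω i * X ω j ∂P = 0

/-- The covariance `σs² a aᴴ + σ² I` of one interferer of power `σs²` with spatial signature `a`
in white noise of power `σ²`. -/
def modelCov {p : ℕ} (a : EuclideanSpace ℂ (Fin p)) (σs σ : ℝ) : Matrix (Fin p) (Fin p) ℂ :=
  Matrix.of fun i j => ((σs ^ 2 : ℝ) : ℂ) * (a i * conj (a j)) + if i = j then ((σ ^ 2 : ℝ) : ℂ) else 0

/-- The sample covariance matrix `(1/N) ∑_{n<N} x(n) x(n)ᴴ`. -/
def sampleCov {p : ℕ} (N : ℕ) (x : ℕ → EuclideanSpace ℂ (Fin p)) : Matrix (Fin p) (Fin p) ℂ :=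
  Matrix.of fun i j => (N : ℂ)⁻¹ * ∑ n ∈ Finset.range N, x n i * conj (x n j)

/-- `u 0, …, u (p-1)` is an orthonormal basis of eigenvectors of `A`, arranged by decreasing
eigenvalue (so `u 0` is a dominant eigenvector). -/
def IsOrderedEigenbasis {p : ℕ} (A : Matrix (Fin p) (Fin p) ℂ)
    (u : Fin p → EuclideanSpace ℂ (Fin p)) : Prop :=
  Orthonormal ℂ u ∧ ∃ l : Fin p → ℝ, Antitone l ∧
    ∀ m, Matrix.toEuclideanLin A (u m) = (l m : ℂ) • u m

/-- The orthogonal projection `P_v = v (vᴴ v)⁻¹ vᴴ` onto the line spanned by `v`. -/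
def proj {p : ℕ} (v : EuclideanSpace ℂ (Fin p)) :
    EuclideanSpace ℂ (Fin p) →L[ℂ] EuclideanSpace ℂ (Fin p) :=
  (Submodule.span ℂ {v}).starProjection

/-- The complementary projection `P_v^⊥ = I - v (vᴴ v)⁻¹ vᴴ`. -/
def projPerp {p : ℕ} (v : EuclideanSpace ℂ (Fin p)) :
    EuclideanSpace ℂ (Fin p) →L[ℂ] EuclideanSpace ℂ (Fin p) :=
  (Submodule.span ℂ {v})ᗮ.starProjection

/-- The interference-to-noise ratio at the input. -/
def inr (σs σ : ℝ) : ℝ := σs ^ 2 / σ ^ 2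

/-- The interference-to-noise ratio after projecting out the estimated signature `aHat`:
`INR' = (σs² / σ²) · E ‖P_aHat^⊥ a‖² / (p - 1)`. -/
def residualINR {Ω : Type*} [MeasurableSpace Ω] (P : Measure Ω) {p : ℕ}
    (a : EuclideanSpace ℂ (Fin p)) (σs σ : ℝ) (aHat : Ω → EuclideanSpace ℂ (Fin p)) : ℝ :=
  σs ^ 2 / σ ^ 2 * ((∫ ω, ‖projPerp (aHat ω) a‖ ^ 2 ∂P) / ((p : ℝ) - 1))

/-- The `(i, j)` entry of the covariance matrix `σs² E [(P_aHat^⊥ a) (P_aHat^⊥ a)ᴴ]` of the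
residual interference. -/
def residualCov {Ω : Type*} [MeasurableSpace Ω] (P : Measure Ω) {p : ℕ}
    (a : EuclideanSpace ℂ (Fin p)) (σs : ℝ) (aHat : Ω → EuclideanSpace ℂ (Fin p)) :
    Matrix (Fin p) (Fin p) ℂ :=
  Matrix.of fun i j =>
    ((σs ^ 2 : ℝ) : ℂ) * ∫ ω, projPerp (aHat ω) a i * conj (projPerp (aHat ω) a j) ∂P

end

end ResidualInterference

/-!
Write `a = √p u` with `‖u‖ = 1`, put `δ = p σs²` and `v = σ²`, so that the covariance is the spike
`δ u uᴴ + v I`, and let `A` be the sample covariance. With respect to `u` and its orthogonal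
complement, `A` has a corner `r = uᴴ A u`, an off-diagonal block `c` and a compression `C`. The
components `s n = ⟪u, x n⟫` of the samples along `u` are independent of the components `w n`
orthogonal to `u`, which are circular white noise. All error terms below are of third order in
`Δ = ‖A - (δ u uᴴ + v I)‖`, and `N · E Δ³ → 0` because `E Δ⁴ = O(N⁻²)`
(`exists_integral_norm_sub_pow_four_le`).

*Residual covariance.* The component of `u` off the leading eigenvector is `-c / δ` to first order
(`norm_residual_add_le`), so its outer product is `c cᴴ / δ²` up to third order, and
`E c cᴴ = (δ + v) v / N · I` exactly (`integral_inner_cross`).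

*Individual directions.* The bulk eigenvalues are degenerate in the limit, so that the remaining
eigenvectors cannot be expanded around fixed vectors. They are instead reached through a convex
function. Eliminating the component along `u` from the eigenvalue equation of `û m`, `m ≥ 1`, with
eigenvalue `l`, shows that the part of `û m` orthogonal to `u` is an eigenvector of
`C - c cᴴ / (r - l)`. As `r ≈ δ + v` and `l ≈ v`, these operators all agree, up to third order, with
`schur t = C + (t / r) c cᴴ` at `t = t₀ = -(δ + v) / δ`. A rotation turns the parts into a genuine
orthonormal basis of almost eigenvectors (`exists_rotated_basis`, `norm_schur_sub_le`), on which
`c cᴴ / r` takes the values `δ² / (δ + v) · |⟪u, û m⟫|²` (`abs_coupling_sub_le`). By the variational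
principle of Ky Fan,
`δ² / (δ + v) · ∑ m ≤ k, |⟪u, û m⟫|²` is then, up to third order, a subgradient at `t₀` of
`t ↦ topSum k (schur t)`, the sum of the `k` largest eigenvalues (`topSum_schur_ge_global`). It
remains to find the expectation of the increments of this function: increments by `1` and by `-1`
bound the expected sum from above and from below.

*Expected Ky Fan sums.* Given the `s n`, a unitary rotation of the sample index carries
`c = N⁻¹ ∑ n, conj (s n) w n` to a multiple of a single noise vector while preserving the law of the
noise. The random scalars cancel, the coefficient of the rank-one term being `t / r` rather than a
constant, and `N · E topSum k (schur t)` is the expected Ky Fan sum of the Gram operator of `N - 1`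
white vectors plus `1 + t` times an independent rank-one sample (`integral_topSum_schur`). The effect
of such a sample is linear in the limit: it adds `k v (1 + t)` (`tendsto_meanTopRankOne_sub`). By
convexity and isotropy it adds at least this much. For weight one it adds no more, since the
expected Ky Fan sum of `n` vectors, divided by `n`, is decreasing (`meanTop_leave_one_out`) and tends
to `k v`; convexity and positivity carry this over to every weight, negative weights being traded
for positive ones along the other vectors of an orthonormal basis. Hence the expected increment from
`t₀` to `t₀ + h` is `k v h / N + o(1/N)`, which gives
`E ∑ m ≤ k, |⟪u, û m⟫|² = k v (δ + v) / (δ² N) + o(1/N)` for every `k`. Differences in `k` give the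
single directions, and `k = p - 1` gives the total.
-/

namespace ResidualInterference

open InnerProductSpace (rankOne)

/-! ### Ky Fan sums -/

section KyFan

variable {E : Type*} [NormedAddCommGroup E] [InnerProductSpace ℂ E]

/-- The Ky Fan sum: the supremum of `∑ i, ⟪g i, B (g i)⟫` over orthonormal `k`-families `g`. For a
self-adjoint `B` it is the sum of the `k` largest eigenvalues. -/
noncomputable def topSum (k : ℕ) (B : E →L[ℂ] E) : ℝ :=
  ⨆ g : {g : Fin k → E // Orthonormal ℂ g}, ∑ i, (inner ℂ (g.1 i) (B (g.1 i))).re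

lemma re_inner_real_smul (τ : ℝ) (v y : E) : (inner ℂ v (τ • y)).re = τ * (inner ℂ v y).re := by
  rw [← Complex.coe_smul, inner_smul_right]; simp

lemma re_inner_le_norm_mul_sq (B : E →L[ℂ] E) (v : E) :
    (inner ℂ v (B v)).re ≤ ‖B‖ * ‖v‖ ^ 2 := by
  have h1 := (Complex.re_le_norm (inner ℂ v (B v))).trans (norm_inner_le_norm (𝕜 := ℂ) v (B v))
  have h2 := B.le_opNorm v
  nlinarith [norm_nonneg v]

lemma frame_sum_le (k : ℕ) (B : E →L[ℂ] E) (g : Fin k → E) (hg : Orthonormal ℂ g) :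
    ∑ i, (inner ℂ (g i) (B (g i))).re ≤ k * ‖B‖ := by
  calc ∑ i, (inner ℂ (g i) (B (g i))).re ≤ ∑ i : Fin k, ‖B‖ := by
        refine Finset.sum_le_sum fun i _ => ?_
        simpa [hg.1 i] using re_inner_le_norm_mul_sq B (g i)
    _ = k * ‖B‖ := by simp

lemma bddAbove_frame_sums (k : ℕ) (B : E →L[ℂ] E) :
    BddAbove (Set.range fun g : {g : Fin k → E // Orthonormal ℂ g} =>
      ∑ i, (inner ℂ (g.1 i) (B (g.1 i))).re) :=
  ⟨k * ‖B‖, by rintro _ ⟨g, rfl⟩; exact frame_sum_le k B g.1 g.2⟩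

lemma frame_sum_le_topSum {k : ℕ} (B : E →L[ℂ] E) {g : Fin k → E} (hg : Orthonormal ℂ g) :
    ∑ i, (inner ℂ (g i) (B (g i))).re ≤ topSum k B :=
  le_ciSup (bddAbove_frame_sums k B) ⟨g, hg⟩

/-- Frames of `k` orthonormal vectors exist as long as `k` is at most the dimension. -/
lemma exists_orthonormal_fin [FiniteDimensional ℂ E] {k : ℕ} (hk : k ≤ Module.finrank ℂ E) :
    ∃ g : Fin k → E, Orthonormal ℂ g :=
  ⟨fun i => stdOrthonormalBasis ℂ E (Fin.castLE hk i),
    (stdOrthonormalBasis ℂ E).orthonormal.comp _ (Fin.castLE_injective hk)⟩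

lemma topSum_smul {k : ℕ} {τ : ℝ} (hτ : 0 ≤ τ) (B : E →L[ℂ] E) : topSum k (τ • B) = τ * topSum k B := by
  unfold topSum
  rw [Real.mul_iSup_of_nonneg hτ]
  congr 1; ext g
  simp only [smul_apply, re_inner_real_smul, Finset.mul_sum]

lemma topSum_zero {k : ℕ} : topSum k (0 : E →L[ℂ] E) = 0 := by
  simpa using topSum_smul (k := k) le_rfl (0 : E →L[ℂ] E)

variable [FiniteDimensional ℂ E] {k : ℕ}

lemma topSum_le (hk : k ≤ Module.finrank ℂ E)
    {B : E →L[ℂ] E} {M : ℝ}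
    (h : ∀ g : Fin k → E, Orthonormal ℂ g → ∑ i, (inner ℂ (g i) (B (g i))).re ≤ M) :
    topSum k B ≤ M := by
  obtain ⟨g, hg⟩ := exists_orthonormal_fin hk
  have : Nonempty {g : Fin k → E // Orthonormal ℂ g} := ⟨⟨g, hg⟩⟩
  exact ciSup_le fun g => h g.1 g.2

lemma topSum_add_le (hk : k ≤ Module.finrank ℂ E)
    (B B' : E →L[ℂ] E) : topSum k (B + B') ≤ topSum k B + topSum k B' := by
  refine topSum_le hk fun g hg => ?_
  have h1 := frame_sum_le_topSum B hg
  have h2 := frame_sum_le_topSum B' hg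
  simp only [add_apply, inner_add_right, Complex.add_re,
    Finset.sum_add_distrib]
  linarith

lemma topSum_add_smul_one (hk : k ≤ Module.finrank ℂ E)
    (τ : ℝ) (B : E →L[ℂ] E) :
    topSum k (B + τ • (1 : E →L[ℂ] E)) = topSum k B + k * τ := by
  have key : ∀ g : Fin k → E, Orthonormal ℂ g →
      ∑ i, (inner ℂ (g i) ((B + τ • (1 : E →L[ℂ] E)) (g i))).re
        = ∑ i, (inner ℂ (g i) (B (g i))).re + k * τ := by
    intro g hg
    simp [Finset.sum_add_distrib, hg.1]
  refine le_antisymm (topSum_le hk fun g hg => ?_) ?_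
  · rw [key g hg]; linarith [frame_sum_le_topSum B hg]
  · suffices topSum k B ≤ topSum k (B + τ • (1 : E →L[ℂ] E)) - k * τ by linarith
    refine topSum_le hk fun g hg => ?_
    have := frame_sum_le_topSum (B + τ • (1 : E →L[ℂ] E)) hg
    rw [key g hg] at this; linarith

lemma topSum_le_norm (hk : k ≤ Module.finrank ℂ E)
    (B : E →L[ℂ] E) : topSum k B ≤ k * ‖B‖ :=
  topSum_le hk fun g hg => frame_sum_le k B g hg

lemma topSum_sub_le (hk : k ≤ Module.finrank ℂ E)
    (B B' : E →L[ℂ] E) : topSum k B - topSum k B' ≤ k * ‖B - B'‖ := by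
  have h1 := topSum_add_le hk B' (B - B')
  rw [add_sub_cancel] at h1
  linarith [topSum_le_norm hk (B - B')]

lemma abs_topSum_sub_le (hk : k ≤ Module.finrank ℂ E)
    (B B' : E →L[ℂ] E) : |topSum k B - topSum k B'| ≤ k * ‖B - B'‖ := by
  rw [abs_le]
  have h1 := topSum_sub_le hk B B'
  have h2 := topSum_sub_le hk B' B
  rw [norm_sub_rev] at h2
  constructor <;> linarith

lemma abs_topSum_le (hk : k ≤ Module.finrank ℂ E)
    (B : E →L[ℂ] E) : |topSum k B| ≤ k * ‖B‖ := by
  simpa [topSum_zero] using abs_topSum_sub_le hk B 0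

lemma continuous_topSum (hk : k ≤ Module.finrank ℂ E) : Continuous (topSum k : (E →L[ℂ] E) → ℝ) := by
  refine (LipschitzWith.of_dist_le_mul (K := (k : NNReal)) fun B B' => ?_).continuous
  simpa [Real.dist_eq, dist_eq_norm] using abs_topSum_sub_le hk B B'

lemma topSum_sum_le (hk : k ≤ Module.finrank ℂ E)
    {ι : Type*} (s : Finset ι) (B : ι → E →L[ℂ] E) :
    topSum k (∑ i ∈ s, B i) ≤ ∑ i ∈ s, topSum k (B i) := by
  classical
  induction s using Finset.induction_on with
  | empty => simp [topSum_zero]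
  | insert a s ha ih =>
    rw [Finset.sum_insert ha, Finset.sum_insert ha]
    exact (topSum_add_le hk _ _).trans (by linarith)

/-- Ky Fan sums are invariant under unitary conjugation. -/
lemma topSum_congr_unitary (hk : k ≤ Module.finrank ℂ E)
    (U : E ≃ₗᵢ[ℂ] E) {B B' : E →L[ℂ] E}
    (h : ∀ v, inner ℂ (U v) (B' (U v)) = inner ℂ v (B v)) : topSum k B' = topSum k B := by
  refine le_antisymm (topSum_le hk fun g hg => ?_) (topSum_le hk fun g hg => ?_)
  · have := frame_sum_le_topSum B (g := fun i => U.symm (g i)) (hg.comp_linearIsometryEquiv U.symm)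
    refine le_trans (le_of_eq (Finset.sum_congr rfl fun i _ => ?_)) this
    rw [← h]; simp
  · have := frame_sum_le_topSum B' (g := fun i => U (g i)) (hg.comp_linearIsometryEquiv U)
    refine le_trans (le_of_eq (Finset.sum_congr rfl fun i _ => ?_)) this
    rw [h]

end KyFan

lemma sum_castLE {M : Type*} [AddCommMonoid M] {k q : ℕ} (h : k ≤ q) (F : Fin q → M) :
    ∑ i : Fin k, F (Fin.castLE h i) = ∑ m : Fin q with m.val < k, F m := by
  refine Finset.sum_bij (fun i _ => Fin.castLE h i) (by simp)
    (fun _ _ _ _ e => Fin.castLE_injective h e) (fun m hm => ?_) (by simp)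
  exact ⟨⟨m, by simpa using hm⟩, by simp, rfl⟩

/-- A weighted sum of a decreasing sequence, with weights in `[0, 1]` of total mass `k`, is at most
the sum of its first `k` terms. -/
lemma sum_weights_le {k q : ℕ} (l w : Fin q → ℝ) (hl : Antitone l)
    (hw0 : ∀ m, 0 ≤ w m) (hw1 : ∀ m, w m ≤ 1) (hw : ∑ m, w m = k) (hkq : k ≤ q) :
    ∑ m, w m * l m ≤ ∑ m : Fin q with m.val < k, l m := by
  rcases Nat.eq_zero_or_pos k with rfl | hk
  · have h0 : ∀ m, w m = 0 := fun m =>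
      (Finset.sum_eq_zero_iff_of_nonneg fun i _ => hw0 i).1 (by simpa using hw) m (Finset.mem_univ _)
    simp [h0]
  · set t := l ⟨k - 1, by omega⟩ with ht
    have h1 : ∀ m, w m * (l m - t) ≤ if (m : ℕ) < k then l m - t else 0 := by
      intro m
      split_ifs with hm
      · have : t ≤ l m := hl (by rw [Fin.le_def]; simp; omega)
        nlinarith [hw1 m]
      · have : l m ≤ t := hl (by rw [Fin.le_def]; simp; omega)
        nlinarith [hw0 m]
    have h2 := Finset.sum_le_sum fun m (_ : m ∈ Finset.univ) => h1 m
    rw [← Finset.sum_filter, Finset.sum_sub_distrib] at h2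
    have h3 : ∑ m : Fin q with m.val < k, t = k * t := by
      rw [← sum_castLE hkq (fun _ => t)]; simp
    simp only [mul_sub, Finset.sum_sub_distrib, ← Finset.sum_mul, hw] at h2
    linarith

/-- If `f` is an orthonormal basis of almost eigenvectors of `M`, with almost eigenvalues arranged
in decreasing order, the Ky Fan sum of `M` hardly exceeds the sum of the first `k` of them. -/
lemma topSum_le_of_almost_eigenbasis {E : Type*} [NormedAddCommGroup E] [InnerProductSpace ℂ E]
    [FiniteDimensional ℂ E] {k q : ℕ} (f : OrthonormalBasis (Fin q) ℂ E)
    (hkq : k ≤ q) (M : E →L[ℂ] E) (l : Fin q → ℝ) (hl : Antitone l) {κ : ℝ}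
    (hM : ∀ m, ‖M (f m) - (l m : ℂ) • f m‖ ≤ κ) :
    topSum k M ≤ ∑ m : Fin q with m.val < k, l m + k * (q * κ) := by
  have hq : Module.finrank ℂ E = q := by
    simpa using Module.finrank_eq_card_basis f.toBasis
  refine topSum_le (by omega) fun g hg => ?_
  have h1 : ∀ i, (inner ℂ (g i) (M (g i))).re
      ≤ ∑ m, ‖inner ℂ (f m) (g i)‖ ^ 2 * l m + q * κ := by
    intro i
    have e1 : M (g i) = ∑ m, (inner ℂ (f m) (g i)) • M (f m) := by
      conv_lhs => rw [← f.sum_repr' (g i)]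
      rw [map_sum]; simp
    rw [e1, inner_sum, Complex.re_sum]
    have : ∀ m, (inner ℂ (g i) ((inner ℂ (f m) (g i)) • M (f m))).re
        ≤ ‖inner ℂ (f m) (g i)‖ ^ 2 * l m + κ := by
      intro m
      have e2 : M (f m) = (l m : ℂ) • f m + (M (f m) - (l m : ℂ) • f m) := by abel
      rw [e2, inner_smul_right, inner_add_right, mul_add, Complex.add_re, inner_smul_right]
      refine add_le_add (le_of_eq ?_) ?_
      · rw [← inner_conj_symm (g i) (f m), mul_left_comm, Complex.mul_conj,
          Complex.normSq_eq_norm_sq]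
        rw [← Complex.ofReal_mul, Complex.ofReal_re, mul_comm]
      · refine (Complex.re_le_norm _).trans ?_
        rw [norm_mul]
        have a1 : ‖inner ℂ (f m) (g i)‖ ≤ 1 := by
          simpa [hg.1 i] using norm_inner_le_norm (𝕜 := ℂ) (f m) (g i)
        have a2 : ‖inner ℂ (g i) (M (f m) - (l m : ℂ) • f m)‖ ≤ κ := by
          refine (norm_inner_le_norm (𝕜 := ℂ) _ _).trans ?_
          rw [hg.1 i, one_mul]; exact hM m
        nlinarith [norm_nonneg (inner ℂ (f m) (g i)),
          norm_nonneg (inner ℂ (g i) (M (f m) - (l m : ℂ) • f m))]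
    refine (Finset.sum_le_sum fun m _ => this m).trans (le_of_eq ?_)
    rw [Finset.sum_add_distrib]; simp
  have h2 := Finset.sum_le_sum fun i (_ : i ∈ Finset.univ) => h1 i
  rw [Finset.sum_add_distrib, Finset.sum_comm] at h2
  simp_rw [← Finset.sum_mul] at h2
  have h3 := sum_weights_le l (fun m => ∑ i, ‖inner ℂ (f m) (g i)‖ ^ 2) hl
    (fun m => Finset.sum_nonneg fun i _ => by positivity) (fun m => ?_) ?_ hkq
  · simp only [Finset.sum_const, Finset.card_univ, Fintype.card_fin, nsmul_eq_mul] at h2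
    linarith
  · have := hg.sum_inner_products_le (f m) (s := Finset.univ)
    simpa [norm_inner_symm (f m)] using this
  · rw [Finset.sum_comm]
    simp [f.sum_sq_norm_inner_right, hg.1]

/-! ### Perturbation of the spiked covariance operator -/

section Perturbation

variable {F : Type*} [NormedAddCommGroup F] [InnerProductSpace ℂ F]

/-- The rank-one spike `δ u uᴴ + v I`. -/
noncomputable def spike (u : F) (δ v : ℝ) : F →L[ℂ] F :=
  δ • rankOne ℂ u u + v • (1 : F →L[ℂ] F)

/-- The orthogonal complement of the line through `u`. -/
noncomputable abbrev Perp (u : F) : Submodule ℂ F := (Submodule.span ℂ {u})ᗮ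

/-- The orthogonal projection onto `Perp u`. -/
noncomputable abbrev toPerp (u : F) : F →L[ℂ] Perp u := (Perp u).orthogonalProjectionOnto

/-- The diagonal block of `A` on the orthogonal complement of `u`. -/
noncomputable def compress (u : F) (A : F →L[ℂ] F) : Perp u →L[ℂ] Perp u :=
  toPerp u ∘L A ∘L (Perp u).subtypeL

/-- The off-diagonal block of `A`, as a vector of the orthogonal complement of `u`. -/
noncomputable def cross (u : F) (A : F →L[ℂ] F) : Perp u := toPerp u (A u)

/-- The diagonal entry of `A` at `u`. -/
noncomputable def corner (u : F) (A : F →L[ℂ] F) : ℝ := (inner ℂ u (A u)).re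

/-- `uh` is an orthonormal basis of eigenvectors of the self-adjoint operator `A`, with the
eigenvalues `l` in decreasing order, and `u` is a unit vector. -/
structure IsEigensystem {q : ℕ} (u : F) (A : F →L[ℂ] F) (uh : Fin (q + 1) → F)
    (l : Fin (q + 1) → ℝ) : Prop where
  unit : ‖u‖ = 1
  symm : ∀ x y, inner ℂ (A x) y = inner ℂ x (A y)
  orthonormal : Orthonormal ℂ uh
  finrank : Module.finrank ℂ F = q + 1
  anti : Antitone l
  eig : ∀ m, A (uh m) = (l m : ℂ) • uh m

lemma spike_apply (u : F) (δ v : ℝ) (x : F) :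
    spike u δ v x = ((δ : ℂ) * inner ℂ u x) • u + (v : ℂ) • x := by
  simp [spike, ← Complex.coe_smul, smul_smul]

lemma toPerp_self (u : F) : toPerp u u = 0 := by
  rw [Submodule.orthogonalProjectionOnto_eq_zero_iff]
  simp

lemma inner_perp (u : F) (y : Perp u) : inner ℂ u (y : F) = 0 :=
  Submodule.mem_orthogonal_singleton_iff_inner_right.1 y.2

lemma inner_toPerp (u : F) (y : Perp u) (x : F) :
    inner ℂ y (toPerp u x) = inner ℂ (y : F) x := by
  exact Submodule.inner_orthogonalProjectionOnto_eq_of_mem_left y x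

lemma eq_add_toPerp {u : F} (hu : ‖u‖ = 1) (x : F) : x = inner ℂ u x • u + (toPerp u x : F) := by
  have h := Submodule.starProjection_add_starProjection_orthogonal (K := Submodule.span ℂ {u}) x
  rw [Submodule.starProjection_unit_singleton ℂ hu] at h
  exact h.symm

lemma norm_toPerp_le (u : F) (x : F) : ‖toPerp u x‖ ≤ ‖x‖ :=
  Submodule.norm_orthogonalProjectionOnto_apply_le _ x

lemma toPerp_coe (u : F) (y : Perp u) : toPerp u (y : F) = y := by
  exact Submodule.orthogonalProjectionOnto_mem_subspace_eq_self y

namespace IsEigensystem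

variable {q : ℕ} {u : F} {A : F →L[ℂ] F} {uh : Fin (q + 1) → F} {l : Fin (q + 1) → ℝ}
  (H : IsEigensystem u A uh l) {δ v : ℝ}

lemma norm_perturb_le (x : F) : ‖A x - spike u δ v x‖ ≤ ‖A - spike u δ v‖ * ‖x‖ :=
  (A - spike u δ v).le_opNorm x

lemma re_inner_spike (x : F) :
    (inner ℂ x (spike u δ v x)).re = δ * ‖inner ℂ u x‖ ^ 2 + v * ‖x‖ ^ 2 := by
  rw [spike_apply, inner_add_right, inner_smul_right, inner_smul_right, mul_assoc,
    ← inner_conj_symm x u, Complex.mul_conj, Complex.normSq_eq_norm_sq, inner_self_eq_norm_sq_to_K]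
  simp [← Complex.ofReal_pow]

lemma abs_re_inner_sub_le (x : F) :
    |(inner ℂ x (A x)).re - (δ * ‖inner ℂ u x‖ ^ 2 + v * ‖x‖ ^ 2)|
      ≤ ‖A - spike u δ v‖ * ‖x‖ ^ 2 := by
  rw [← re_inner_spike, ← Complex.sub_re, ← inner_sub_right]
  refine (Complex.abs_re_le_norm _).trans ((norm_inner_le_norm _ _).trans ?_)
  nlinarith [norm_perturb_le (A := A) (u := u) (δ := δ) (v := v) x, norm_nonneg x]

include H

lemma re_inner_eig (m : Fin (q + 1)) : (inner ℂ (uh m) (A (uh m))).re = l m := by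
  rw [H.eig, inner_smul_right, inner_self_eq_norm_sq_to_K, H.orthonormal.1 m]; simp

/-- The eigenvectors as an orthonormal basis. -/
noncomputable def basis : OrthonormalBasis (Fin (q + 1)) ℂ F :=
  have := H.finrank
  (basisOfOrthonormalOfCardEqFinrank H.orthonormal (by simp [H.finrank])).toOrthonormalBasis
    (by simpa using H.orthonormal)

lemma basis_apply (m : Fin (q + 1)) : H.basis m = uh m := by
  simp [basis]

lemma re_inner_eq_sum (x : F) :
    (inner ℂ x (A x)).re = ∑ m, l m * ‖inner ℂ (uh m) x‖ ^ 2 := by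
  have e : A x = ∑ m, ((l m : ℂ) * inner ℂ (uh m) x) • uh m := by
    conv_lhs => rw [← H.basis.sum_repr' x]
    simp only [map_sum, map_smul, H.basis_apply, H.eig, smul_smul, mul_comm]
  rw [e, inner_sum, Complex.re_sum]
  refine Finset.sum_congr rfl fun m _ => ?_
  rw [inner_smul_right, mul_assoc, ← inner_conj_symm x (uh m), Complex.mul_conj,
    Complex.normSq_eq_norm_sq, ← Complex.ofReal_mul, Complex.ofReal_re]

lemma sum_sq_inner (x : F) : ∑ m, ‖inner ℂ (uh m) x‖ ^ 2 = ‖x‖ ^ 2 := by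
  rw [← H.basis.sum_sq_norm_inner_right x]; simp [H.basis_apply]

variable (hδ : 0 ≤ δ)
include hδ

/-- Weyl's inequality for the leading eigenvalue. -/
lemma abs_top_sub_le : |l 0 - (δ + v)| ≤ ‖A - spike u δ v‖ := by
  rw [abs_le]
  constructor
  · have h1 := H.re_inner_eq_sum u
    have h2 : ∑ m, l m * ‖inner ℂ (uh m) u‖ ^ 2 ≤ l 0 := by
      calc _ ≤ ∑ m, l 0 * ‖inner ℂ (uh m) u‖ ^ 2 :=
            Finset.sum_le_sum fun m _ => by gcongr; exact H.anti (Fin.zero_le m)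
        _ = l 0 := by rw [← Finset.mul_sum, H.sum_sq_inner]; simp [H.unit]
    have h3 := (abs_le.1 (abs_re_inner_sub_le (A := A) (u := u) (δ := δ) (v := v) u)).1
    rw [H.unit, inner_self_eq_norm_sq_to_K, H.unit] at h3
    simp at h3
    linarith
  · have h3 := (abs_le.1 (abs_re_inner_sub_le (A := A) (u := u) (δ := δ) (v := v) (uh 0))).2
    rw [H.re_inner_eig, H.orthonormal.1] at h3
    have h4 : ‖inner ℂ u (uh 0)‖ ≤ 1 := by
      simpa [H.unit, H.orthonormal.1] using norm_inner_le_norm (𝕜 := ℂ) u (uh 0)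
    have h5 : ‖inner ℂ u (uh 0)‖ ^ 2 ≤ 1 := pow_le_one₀ (norm_nonneg _) h4
    nlinarith

/-- Weyl's inequality for the other eigenvalues. -/
lemma abs_bulk_sub_le (m : Fin q) : |l m.succ - v| ≤ ‖A - spike u δ v‖ := by
  rw [abs_le]
  constructor
  · have h3 := (abs_le.1 (abs_re_inner_sub_le (A := A) (u := u) (δ := δ) (v := v) (uh m.succ))).1
    rw [H.re_inner_eig, H.orthonormal.1] at h3
    nlinarith [sq_nonneg ‖inner ℂ u (uh m.succ)‖]
  · -- the span of the leading eigenvector and the given one meets the complement of `u`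
    obtain ⟨x, hx0, hux, hx⟩ : ∃ x : F, x ≠ 0 ∧ inner ℂ u x = 0 ∧
        l m.succ * ‖x‖ ^ 2 ≤ (inner ℂ x (A x)).re := by
      by_cases hb : inner ℂ u (uh m.succ) = 0
      · refine ⟨uh m.succ, H.orthonormal.ne_zero _, hb, ?_⟩
        rw [H.re_inner_eig, H.orthonormal.1]; simp
      · set a := inner ℂ u (uh m.succ)
        set b := inner ℂ u (uh 0)
        refine ⟨a • uh 0 - b • uh m.succ, ?_, ?_, ?_⟩
        · intro h0
          have := congrArg (fun y => inner ℂ (uh 0) y) h0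
          simp only [inner_sub_right, inner_smul_right, inner_zero_right,
            H.orthonormal.2 (Fin.succ_ne_zero m).symm, inner_self_eq_norm_sq_to_K,
            H.orthonormal.1] at this
          simp at this
          exact hb this
        · simp [a, b, mul_comm]
        · have h0 := H.orthonormal.2 (Fin.succ_ne_zero m).symm
          have h1 := H.orthonormal.2 (Fin.succ_ne_zero m)
          have e1 : (inner ℂ (a • uh 0 - b • uh m.succ) (A (a • uh 0 - b • uh m.succ))).re
              = l 0 * ‖a‖ ^ 2 + l m.succ * ‖b‖ ^ 2 := by
            simp only [map_sub, map_smul, H.eig, inner_sub_left, inner_sub_right, inner_smul_left,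
              inner_smul_right, h0, h1, inner_self_eq_norm_sq_to_K, H.orthonormal.1]
            simp [← Complex.normSq_eq_norm_sq, Complex.normSq_apply]; ring
          have e2 : ‖a • uh 0 - b • uh m.succ‖ ^ 2 = ‖a‖ ^ 2 + ‖b‖ ^ 2 := by
            rw [@norm_sub_sq ℂ]
            simp [inner_smul_left, inner_smul_right, h0, norm_smul, H.orthonormal.1]
          rw [e1, e2]
          nlinarith [H.anti (Fin.zero_le m.succ), sq_nonneg ‖a‖]
    have h3 := (abs_le.1 (abs_re_inner_sub_le (A := A) (u := u) (δ := δ) (v := v) x)).2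
    rw [hux] at h3
    have hpos : 0 < ‖x‖ ^ 2 := by positivity
    simp at h3
    have : (l m.succ - v) * ‖x‖ ^ 2 ≤ ‖A - spike u δ v‖ * ‖x‖ ^ 2 := by nlinarith
    exact le_of_mul_le_mul_right this hpos

end IsEigensystem

end Perturbation

/-! ### Block equations of an eigenvector -/

section BlockEquations

variable {F : Type*} [NormedAddCommGroup F] [InnerProductSpace ℂ F] {u : F} {A : F →L[ℂ] F}
  {δ v : ℝ}

lemma toPerp_spike (u : F) (δ v : ℝ) (x : F) : toPerp u (spike u δ v x) = (v : ℂ) • toPerp u x := by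
  rw [spike_apply, map_add, map_smul, map_smul, toPerp_self]; simp

lemma cross_eq : cross u A = toPerp u (A u - spike u δ v u) := by
  rw [map_sub, toPerp_spike, toPerp_self]; simp [cross]

lemma norm_cross_le (hu : ‖u‖ = 1) : ‖cross u A‖ ≤ ‖A - spike u δ v‖ := by
  rw [cross_eq (δ := δ) (v := v)]
  refine (norm_toPerp_le _ _).trans ?_
  simpa [hu] using IsEigensystem.norm_perturb_le (A := A) (u := u) (δ := δ) (v := v) u

lemma abs_corner_sub_le (hu : ‖u‖ = 1) : |corner u A - (δ + v)| ≤ ‖A - spike u δ v‖ := by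
  have h := IsEigensystem.abs_re_inner_sub_le (A := A) (u := u) (δ := δ) (v := v) u
  rw [inner_self_eq_norm_sq_to_K, hu] at h
  simpa [corner] using h

lemma norm_compress_sub_le (y : Perp u) :
    ‖compress u A y - (v : ℂ) • y‖ ≤ ‖A - spike u δ v‖ * ‖y‖ := by
  have : compress u A y - (v : ℂ) • y = toPerp u (A (y : F) - spike u δ v (y : F)) := by
    rw [map_sub, toPerp_spike, toPerp_coe]; rfl
  rw [this]
  exact (norm_toPerp_le _ _).trans (IsEigensystem.norm_perturb_le _)

namespace IsEigensystem

variable {q : ℕ} {uh : Fin (q + 1) → F} {l : Fin (q + 1) → ℝ}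
  (H : IsEigensystem u A uh l)
include H

lemma self_adjoint_corner : inner ℂ u (A u) = (corner u A : ℂ) := by
  have : conj (inner ℂ u (A u)) = inner ℂ u (A u) := by
    rw [inner_conj_symm, H.symm]
  exact (Complex.conj_eq_iff_re.1 this).symm

/-- The lower block row of the eigenvalue equation. -/
lemma block_eq (m : Fin (q + 1)) :
    compress u A (toPerp u (uh m)) + inner ℂ u (uh m) • cross u A
      = (l m : ℂ) • toPerp u (uh m) := by
  have h := congrArg (toPerp u) (H.eig m)
  rw [(toPerp u).map_smul] at h
  rw [← h]
  conv_rhs => rw [eq_add_toPerp H.unit (uh m)]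
  rw [map_add, map_add, map_smul, map_smul, add_comm]; rfl

/-- The upper block row of the eigenvalue equation. -/
lemma corner_eq (m : Fin (q + 1)) :
    inner ℂ (cross u A) (toPerp u (uh m)) = -(((corner u A - l m : ℝ) : ℂ) * inner ℂ u (uh m)) := by
  have h1 : inner ℂ u (A (uh m)) = (l m : ℂ) * inner ℂ u (uh m) := by
    rw [H.eig, inner_smul_right]
  have h2 : inner ℂ u (A (uh m)) = (corner u A : ℂ) * inner ℂ u (uh m)
      + inner ℂ (cross u A) (toPerp u (uh m)) := by
    conv_lhs => rw [eq_add_toPerp H.unit (uh m)]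
    rw [map_add, map_smul, inner_add_right, inner_smul_right, H.self_adjoint_corner, mul_comm,
      ← H.symm u]
    congr 1
    rw [cross, ← inner_conj_symm (toPerp u (A u)), inner_toPerp, inner_conj_symm]
  rw [h1] at h2
  push_cast
  linear_combination -h2

/-- Davis–Kahan bound: the other eigenvectors are almost orthogonal to `u`. -/
lemma norm_inner_bulk_le (hδ : 0 < δ) (hΔ : ‖A - spike u δ v‖ ≤ δ / 4) (m : Fin q) :
    ‖inner ℂ u (uh m.succ)‖ ≤ 2 * ‖A - spike u δ v‖ / δ := by
  set Δ := ‖A - spike u δ v‖ with hΔ'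
  have h1 : inner ℂ u (A (uh m.succ) - spike u δ v (uh m.succ))
      = ((l m.succ - (δ + v) : ℝ) : ℂ) * inner ℂ u (uh m.succ) := by
    rw [inner_sub_right, H.eig, spike_apply, inner_add_right, inner_smul_right, inner_smul_right,
      inner_smul_right, inner_self_eq_norm_sq_to_K, H.unit]
    push_cast; ring
  have h2 : ‖inner ℂ u (A (uh m.succ) - spike u δ v (uh m.succ))‖ ≤ Δ := by
    refine (norm_inner_le_norm _ _).trans ?_
    have := norm_perturb_le (A := A) (u := u) (δ := δ) (v := v) (uh m.succ)
    rw [H.orthonormal.1, mul_one] at this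
    rw [H.unit, one_mul]; exact this
  rw [h1, norm_mul, Complex.norm_real, Real.norm_eq_abs] at h2
  have h3 := (abs_le.1 (H.abs_bulk_sub_le (v := v) hδ.le m)).2
  have h4 : δ / 2 ≤ |l m.succ - (δ + v)| := by
    rw [le_abs]; right; linarith
  rw [le_div_iff₀ hδ]
  nlinarith [norm_nonneg (inner ℂ u (uh m.succ))]

/-- Davis–Kahan bound: the leading eigenvector is almost parallel to `u`. -/
lemma norm_toPerp_top_le (hδ : 0 < δ) (hΔ : ‖A - spike u δ v‖ ≤ δ / 4) :
    ‖toPerp u (uh 0)‖ ≤ 2 * ‖A - spike u δ v‖ / δ := by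
  set Δ := ‖A - spike u δ v‖ with hΔ'
  have h1 : toPerp u (A (uh 0) - spike u δ v (uh 0)) = ((l 0 - v : ℝ) : ℂ) • toPerp u (uh 0) := by
    rw [map_sub, toPerp_spike, H.eig, map_smul]
    push_cast; rw [sub_smul]
  have h2 : ‖toPerp u (A (uh 0) - spike u δ v (uh 0))‖ ≤ Δ := by
    refine (norm_toPerp_le _ _).trans ?_
    have := norm_perturb_le (A := A) (u := u) (δ := δ) (v := v) (uh 0)
    rwa [H.orthonormal.1, mul_one] at this
  rw [h1, norm_smul, Complex.norm_real, Real.norm_eq_abs] at h2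
  have h3 := (abs_le.1 (H.abs_top_sub_le (v := v) hδ.le)).1
  have h4 : δ / 2 ≤ |l 0 - v| := by
    rw [le_abs]; left; linarith
  rw [le_div_iff₀ hδ]
  nlinarith [norm_nonneg (toPerp u (uh 0))]

lemma norm_inner_top_sq : ‖inner ℂ u (uh 0)‖ ^ 2 = 1 - ‖toPerp u (uh 0)‖ ^ 2 := by
  have h : ‖uh 0‖ ^ 2 = ‖inner ℂ u (uh 0)‖ ^ 2 + ‖toPerp u (uh 0)‖ ^ 2 := by
    conv_lhs => rw [eq_add_toPerp H.unit (uh 0)]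
    rw [@norm_add_sq ℂ, inner_smul_left, inner_perp]
    simp [norm_smul, H.unit]
  rw [H.orthonormal.1] at h
  linarith

/-- First-order expansion of the component of `u` off the leading eigenvector. -/
lemma norm_residual_add_le (hδ : 0 < δ) (hΔ : ‖A - spike u δ v‖ ≤ δ / 4) :
    ‖(u - inner ℂ (uh 0) u • uh 0) + (δ : ℂ)⁻¹ • (cross u A : F)‖
      ≤ 9 * ‖A - spike u δ v‖ ^ 2 / δ ^ 2 := by
  set Δ := ‖A - spike u δ v‖ with hΔ'
  have hΔ0 : 0 ≤ Δ := norm_nonneg _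
  set α := inner ℂ u (uh 0) with hα
  set w := toPerp u (uh 0) with hw
  set c := cross u A with hc
  have hw1 : ‖w‖ ≤ 2 * Δ / δ := H.norm_toPerp_top_le hδ hΔ
  have hα2 : ‖α‖ ^ 2 = 1 - ‖w‖ ^ 2 := H.norm_inner_top_sq
  have hα1 : ‖α‖ ≤ 1 := by
    have : ‖α‖ ^ 2 ≤ 1 := by rw [hα2]; linarith [sq_nonneg ‖w‖]
    exact (sq_le_one_iff₀ (norm_nonneg _)).1 this
  have hc1 : ‖c‖ ≤ Δ := norm_cross_le H.unit
  -- the lower block equation, with the eigenvalue and the compression replaced by their limits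
  have e0 : ‖(δ : ℂ) • w - α • c‖ ≤ 4 * Δ ^ 2 / δ := by
    have e1 : (δ : ℂ) • w - α • c = (compress u A w - (v : ℂ) • w)
        - ((l 0 - (δ + v) : ℝ) : ℂ) • w := by
      have := H.block_eq 0
      rw [← eq_sub_iff_add_eq'] at this
      rw [this]; push_cast; module
    rw [e1]
    refine (norm_sub_le _ _).trans ?_
    have a1 := norm_compress_sub_le (A := A) (δ := δ) (v := v) w
    have a2 : ‖((l 0 - (δ + v) : ℝ) : ℂ) • w‖ ≤ Δ * ‖w‖ := by
      rw [norm_smul, Complex.norm_real, Real.norm_eq_abs]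
      gcongr
      exact H.abs_top_sub_le hδ.le
    calc _ ≤ Δ * ‖w‖ + Δ * ‖w‖ := add_le_add a1 a2
      _ ≤ Δ * (2 * Δ / δ) + Δ * (2 * Δ / δ) := by gcongr
      _ = _ := by ring
  have hδc : (δ : ℂ) ≠ 0 := by exact_mod_cast hδ.ne'
  have e2 : (u - inner ℂ (uh 0) u • uh 0) + (δ : ℂ)⁻¹ • (c : F)
      = ((‖w‖ ^ 2 : ℝ) : ℂ) • u - (conj α * (δ : ℂ)⁻¹) • (((δ : ℂ) • w - α • c : Perp u) : F)
        + (((‖w‖ ^ 2 : ℝ) : ℂ) * (δ : ℂ)⁻¹) • (c : F) := by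
    have e3 : uh 0 = α • u + (w : F) := eq_add_toPerp H.unit (uh 0)
    have e4 : inner ℂ (uh 0) u = conj α := (inner_conj_symm _ _).symm
    have e5 : conj α * α = 1 - ((‖w‖ ^ 2 : ℝ) : ℂ) := by
      rw [mul_comm, Complex.mul_conj, Complex.normSq_eq_norm_sq, hα2]; push_cast; ring
    rw [e4]
    conv_lhs => rw [e3]
    rw [Submodule.coe_sub, Submodule.coe_smul, Submodule.coe_smul]
    have e6 : conj α • (α • u + (w : F)) = (conj α * α) • u + conj α • (w : F) := by module
    have e7 : (conj α * (δ : ℂ)⁻¹) • ((δ : ℂ) • (w : F) - α • (c : F))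
        = conj α • (w : F) - ((conj α * α) * (δ : ℂ)⁻¹) • (c : F) := by
      rw [smul_sub, smul_smul, smul_smul, inv_mul_cancel_right₀ hδc]; congr 2; ring
    rw [e6, e7, e5]; module
  rw [e2]
  have n1 : ‖((‖w‖ ^ 2 : ℝ) : ℂ) • u‖ ≤ 4 * Δ ^ 2 / δ ^ 2 := by
    rw [norm_smul, Complex.norm_real, H.unit, mul_one, Real.norm_of_nonneg (by positivity)]
    calc ‖w‖ ^ 2 ≤ (2 * Δ / δ) ^ 2 := by gcongr
      _ = _ := by ring
  have n2 : ‖(conj α * (δ : ℂ)⁻¹) • (((δ : ℂ) • w - α • c : Perp u) : F)‖ ≤ 4 * Δ ^ 2 / δ ^ 2 := by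
    rw [norm_smul, norm_mul, RCLike.norm_conj, norm_inv, Complex.norm_real,
      Real.norm_of_nonneg hδ.le]
    calc ‖α‖ * δ⁻¹ * ‖(δ : ℂ) • w - α • c‖ ≤ 1 * δ⁻¹ * (4 * Δ ^ 2 / δ) := by gcongr
      _ = _ := by field_simp
  have n3 : ‖(((‖w‖ ^ 2 : ℝ) : ℂ) * (δ : ℂ)⁻¹) • (c : F)‖ ≤ Δ ^ 2 / δ ^ 2 := by
    rw [norm_smul, norm_mul, norm_inv, Complex.norm_real, Complex.norm_real,
      Real.norm_of_nonneg hδ.le, Real.norm_of_nonneg (by positivity)]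
    calc ‖w‖ ^ 2 * δ⁻¹ * ‖c‖ ≤ (2 * Δ / δ) ^ 2 * δ⁻¹ * (δ / 4) := by
          gcongr; exact hc1.trans hΔ
      _ = _ := by field_simp; ring
  calc _ ≤ 4 * Δ ^ 2 / δ ^ 2 + 4 * Δ ^ 2 / δ ^ 2 + Δ ^ 2 / δ ^ 2 :=
        (norm_add_le _ _).trans (add_le_add ((norm_sub_le _ _).trans (add_le_add n1 n2)) n3)
    _ = _ := by ring

end IsEigensystem

end BlockEquations

/-! ### The Schur-type operator and its almost eigenvectors -/

/-- The Schur-type operator `C + t c cᴴ / r` built from the blocks `C`, `c`, `r` of `A`; the Schur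
complement is the case `t = -1`. When `r = 0` it is `C`. -/
noncomputable def schur {F : Type*} [NormedAddCommGroup F] [InnerProductSpace ℂ F]
    (u : F) (A : F →L[ℂ] F) (t : ℝ) : Perp u →L[ℂ] Perp u :=
  compress u A + (t / corner u A) • rankOne ℂ (cross u A) (cross u A)

section Comparison

variable {F : Type*} [NormedAddCommGroup F] [InnerProductSpace ℂ F] {u : F} {A : F →L[ℂ] F}
  {δ v : ℝ}

lemma finrank_perp [FiniteDimensional ℂ F] {q : ℕ} (hu : u ≠ 0)
    (hF : Module.finrank ℂ F = q + 1) : Module.finrank ℂ (Perp u) = q := by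
  have : Fact (Module.finrank ℂ F = q + 1) := ⟨hF⟩
  exact Submodule.finrank_orthogonal_span_singleton hu

namespace IsEigensystem

variable {q : ℕ} {uh : Fin (q + 1) → F} {l : Fin (q + 1) → ℝ}
  (H : IsEigensystem u A uh l)
include H

/-- The eigenvectors past the leading one, rotated into the orthogonal complement of `u`. The
rotation takes the leading eigenvector, in a suitable phase, to `-u`, and differs from the
projection only by a second-order term. -/
lemma exists_rotated_basis [FiniteDimensional ℂ F] (hδ : 0 < δ)
    (hΔ : ‖A - spike u δ v‖ ≤ δ / 4) :
    ∃ f : OrthonormalBasis (Fin q) ℂ (Perp u),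
      ∀ m, ‖f m - toPerp u (uh m.succ)‖ ≤ 4 * ‖A - spike u δ v‖ ^ 2 / δ ^ 2 := by
  set Δ := ‖A - spike u δ v‖
  obtain ⟨θ, hθ1, hθ⟩ := RCLike.exists_norm_eq_mul_self (inner ℂ u (uh 0))
  set β : ℝ := ‖inner ℂ u (uh 0)‖ with hβ
  have hβ0 : 0 ≤ β := norm_nonneg _
  have hβc : (1 + β : ℂ) ≠ 0 := by
    have : (1 + β : ℝ) ≠ 0 := by positivity
    exact_mod_cast this
  have hθ' : (β : ℂ) = θ * inner ℂ u (uh 0) := hθ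
  -- subtracting `κ m • η` is the reflection that takes `-θ • uh 0` to `u`
  set κ : Fin q → ℂ := fun m => inner ℂ u (uh m.succ) / (1 + β) with hκ
  set f : Fin q → Perp u := fun m => toPerp u (uh m.succ) - (κ m * θ) • toPerp u (uh 0) with hf
  set η : F := θ • uh 0 + u with hη
  have hfF : ∀ m, (f m : F) = uh m.succ - κ m • η := by
    intro m
    have e1 : ((toPerp u (uh m.succ) : Perp u) : F) = uh m.succ - inner ℂ u (uh m.succ) • u :=
      eq_sub_of_add_eq' (eq_add_toPerp H.unit (uh m.succ)).symm
    have e2 : ((toPerp u (uh 0) : Perp u) : F) = uh 0 - inner ℂ u (uh 0) • u :=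
      eq_sub_of_add_eq' (eq_add_toPerp H.unit (uh 0)).symm
    have e3 : inner ℂ u (uh m.succ) = κ m + κ m * (θ * inner ℂ u (uh 0)) := by
      rw [← hθ', hκ]; field_simp
    rw [hf, Submodule.coe_sub, Submodule.coe_smul, e1, e2, e3, hη]
    module
  have h00 : inner ℂ (uh 0) (uh 0) = 1 := by
    rw [inner_self_eq_norm_sq_to_K, H.orthonormal.1]; simp
  have huu : inner ℂ u u = 1 := by rw [inner_self_eq_norm_sq_to_K, H.unit]; simp
  have hθθ : conj θ * θ = 1 := by
    rw [mul_comm, Complex.mul_conj, Complex.normSq_eq_norm_sq, hθ1]; simp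
  have h0u : conj θ * inner ℂ (uh 0) u = (β : ℂ) := by
    rw [← inner_conj_symm, ← map_mul, ← hθ', Complex.conj_ofReal]
  have hηη : inner ℂ η η = 2 * (1 + β : ℂ) := by
    simp only [hη, inner_add_left, inner_add_right, inner_smul_left, inner_smul_right, h00, huu,
      h0u]
    linear_combination hθθ - hθ'
  have hηm : ∀ m : Fin q, inner ℂ η (uh m.succ) = inner ℂ u (uh m.succ) := by
    intro m
    rw [hη, inner_add_left, inner_smul_left, H.orthonormal.2 (Fin.succ_ne_zero m).symm]; simp
  have hmη : ∀ m : Fin q, inner ℂ (uh m.succ) η = conj (inner ℂ u (uh m.succ)) := by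
    intro m; rw [← hηm, inner_conj_symm]
  have hα : ∀ m : Fin q, inner ℂ u (uh m.succ) = κ m * (1 + β) := by
    intro m; rw [hκ]; field_simp
  have hon : Orthonormal ℂ f := by
    rw [orthonormal_iff_ite]
    intro m n
    rw [Submodule.coe_inner, hfF, hfF]
    simp only [inner_sub_left, inner_sub_right, inner_smul_left, inner_smul_right, hηη, hηm, hmη,
      hα, map_mul, map_add, map_one, Complex.conj_ofReal]
    rw [orthonormal_iff_ite.1 H.orthonormal m.succ n.succ]
    simp only [Fin.succ_inj]
    ring
  have hfr := finrank_perp (u := u) (by rintro rfl; simpa using H.unit) H.finrank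
  obtain ⟨b, hb⟩ := Orthonormal.exists_orthonormalBasis_extension_of_card_eq (ι := Fin q)
    (by simpa using hfr) (v := f) (s := Set.univ) (hon.comp _ Subtype.val_injective)
  refine ⟨b, fun m => ?_⟩
  rw [hb m (Set.mem_univ m), hf]
  simp only [sub_sub_cancel_left, norm_neg, norm_smul, norm_mul, hθ1, mul_one]
  have h1 : ‖κ m‖ ≤ 2 * Δ / δ := by
    rw [hκ]; simp only [norm_div]
    refine (div_le_self (norm_nonneg _) ?_).trans (H.norm_inner_bulk_le hδ hΔ m)
    have : ‖(1 + β : ℂ)‖ = 1 + β := by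
      rw [← Complex.ofReal_one, ← Complex.ofReal_add, Complex.norm_real,
        Real.norm_of_nonneg (by positivity)]
    rw [this]; linarith
  have h2 := H.norm_toPerp_top_le hδ hΔ
  calc ‖κ m‖ * ‖toPerp u (uh 0)‖ ≤ (2 * Δ / δ) * (2 * Δ / δ) := by gcongr
    _ = _ := by ring

/-- The corner of a positive operator dominates its off-diagonal block. -/
lemma norm_cross_sq_le (hl : ∀ m, 0 ≤ l m) : ‖cross u A‖ ^ 2 ≤ ‖A‖ * corner u A := by
  have h1 : ‖A u‖ ^ 2 = ∑ m, l m ^ 2 * ‖inner ℂ (uh m) u‖ ^ 2 := by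
    rw [← H.sum_sq_inner]
    refine Finset.sum_congr rfl fun m _ => ?_
    rw [← H.symm, H.eig, inner_smul_left, norm_mul, Complex.conj_ofReal, Complex.norm_real,
      Real.norm_eq_abs, mul_pow, sq_abs]
  have h2 : ∀ m, l m ≤ ‖A‖ := fun m => by
    have := A.le_opNorm (uh m)
    rw [H.eig, norm_smul, H.orthonormal.1, mul_one, mul_one, Complex.norm_real] at this
    exact (Real.le_norm_self _).trans this
  calc ‖cross u A‖ ^ 2 ≤ ‖A u‖ ^ 2 := by gcongr; exact norm_toPerp_le _ _
    _ = ∑ m, l m ^ 2 * ‖inner ℂ (uh m) u‖ ^ 2 := h1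
    _ ≤ ∑ m, ‖A‖ * (l m * ‖inner ℂ (uh m) u‖ ^ 2) := by
        refine Finset.sum_le_sum fun m _ => ?_
        have : l m ^ 2 ≤ ‖A‖ * l m := by nlinarith [h2 m, hl m]
        nlinarith [sq_nonneg ‖inner ℂ (uh m) u‖]
    _ = ‖A‖ * corner u A := by rw [← Finset.mul_sum, corner, H.re_inner_eq_sum]

/-- The rotated eigenvectors are almost eigenvectors of the Schur-type operator at the critical
value of its parameter. -/
lemma norm_schur_sub_le (hδ : 0 < δ) (hv : 0 < v) (hΔ : ‖A - spike u δ v‖ ≤ δ / 4)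
    (m : Fin q) {y : Perp u}
    (hy : ‖y - toPerp u (uh m.succ)‖ ≤ 4 * ‖A - spike u δ v‖ ^ 2 / δ ^ 2) :
    ‖schur u A (-((δ + v) / δ)) y - (l m.succ : ℂ) • y‖
      ≤ 24 * ‖A - spike u δ v‖ ^ 3 / δ ^ 2 := by
  set Δ := ‖A - spike u δ v‖ with hΔ'
  have hΔ0 : 0 ≤ Δ := norm_nonneg _
  set w := toPerp u (uh m.succ) with hw
  set c := cross u A with hc
  set r := corner u A with hr
  have hc1 : ‖c‖ ≤ Δ := norm_cross_le H.unit
  have hr1 := abs_le.1 (abs_corner_sub_le (A := A) (δ := δ) (v := v) H.unit)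
  have hl1 := abs_le.1 (H.abs_bulk_sub_le (v := v) hδ.le m)
  rw [← hΔ', ← hr] at hr1
  rw [← hΔ'] at hl1
  have hr0 : (δ + v) / 2 ≤ r := by linarith
  have hrl : δ / 2 ≤ r - l m.succ := by linarith
  have hrpos : 0 < r := by linarith
  have hrlpos : 0 < r - l m.succ := by linarith
  have hw1 : ‖w‖ ≤ 1 := (norm_toPerp_le _ _).trans (H.orthonormal.1 _).le
  -- the coefficient of the rank-one correction is off by a first-order term
  have hcoef : |(r - l m.succ)⁻¹ - (δ + v) / δ / r| ≤ 8 * Δ / δ ^ 2 := by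
    have e : (r - l m.succ)⁻¹ - (δ + v) / δ / r
        = ((δ + v) * (l m.succ - v) - v * (r - (δ + v))) / ((r - l m.succ) * (δ * r)) := by
      field_simp; ring
    rw [e, abs_div, abs_of_pos (by positivity : 0 < (r - l m.succ) * (δ * r))]
    have n1 : |(δ + v) * (l m.succ - v) - v * (r - (δ + v))| ≤ 2 * (δ + v) * Δ := by
      rw [abs_le]; constructor <;> nlinarith
    calc _ ≤ 2 * (δ + v) * Δ / ((δ / 2) * (δ * ((δ + v) / 2))) := by gcongr
      _ = _ := by field_simp; ring
  have hcv : inner ℂ u (uh m.succ) = -(((r - l m.succ)⁻¹ : ℝ) : ℂ) * inner ℂ c w := by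
    rw [H.corner_eq m.succ, ← hr]
    push_cast
    have : ((r : ℂ) - (l m.succ : ℂ)) ≠ 0 := by
      rw [← Complex.ofReal_sub]; exact_mod_cast hrlpos.ne'
    field_simp
  have e1 : schur u A (-((δ + v) / δ)) w - (l m.succ : ℂ) • w
      = (((r - l m.succ)⁻¹ - (δ + v) / δ / r : ℝ) : ℂ) • (inner ℂ c w • c) := by
    have hb := H.block_eq m.succ
    rw [← eq_sub_iff_add_eq] at hb
    rw [schur, add_apply, smul_apply, InnerProductSpace.rankOne_apply, hb, hcv,
      ← Complex.coe_smul (-((δ + v) / δ) / r)]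
    push_cast
    module
  have n1 : ‖schur u A (-((δ + v) / δ)) w - (l m.succ : ℂ) • w‖ ≤ 8 * Δ ^ 3 / δ ^ 2 := by
    rw [e1, norm_smul, norm_smul, Complex.norm_real, Real.norm_eq_abs]
    have := norm_inner_le_norm (𝕜 := ℂ) c w
    calc _ ≤ 8 * Δ / δ ^ 2 * (‖c‖ * ‖w‖ * ‖c‖) := by gcongr
      _ ≤ 8 * Δ / δ ^ 2 * (Δ * 1 * Δ) := by gcongr
      _ = _ := by ring
  have n2 : ‖schur u A (-((δ + v) / δ)) (y - w) - (l m.succ : ℂ) • (y - w)‖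
      ≤ 4 * Δ * ‖y - w‖ := by
    set z := y - w
    have e2 : schur u A (-((δ + v) / δ)) z - (l m.succ : ℂ) • z
        = (compress u A z - (v : ℂ) • z) - ((l m.succ - v : ℝ) : ℂ) • z
          - (((δ + v) / δ / r : ℝ) : ℂ) • (inner ℂ c z • c) := by
      rw [schur, add_apply, smul_apply, InnerProductSpace.rankOne_apply,
        ← Complex.coe_smul (-((δ + v) / δ) / r)]
      push_cast
      module
    rw [e2]
    have a1 := norm_compress_sub_le (A := A) (δ := δ) (v := v) z
    have a2 : ‖((l m.succ - v : ℝ) : ℂ) • z‖ ≤ Δ * ‖z‖ := by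
      rw [norm_smul, Complex.norm_real, Real.norm_eq_abs]
      gcongr; exact abs_le.2 hl1
    have a3 : ‖(((δ + v) / δ / r : ℝ) : ℂ) • (inner ℂ c z • c)‖ ≤ 2 * Δ * ‖z‖ := by
      rw [norm_smul, norm_smul, Complex.norm_real, Real.norm_of_nonneg (by positivity)]
      have b1 := norm_inner_le_norm (𝕜 := ℂ) c z
      have b2 : (δ + v) / δ / r ≤ 2 / δ := by
        rw [div_div, div_le_div_iff₀ (by positivity) hδ]; nlinarith
      calc _ ≤ 2 / δ * (Δ * ‖z‖ * (δ / 4)) := by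
            gcongr
            · exact b1.trans (by gcongr)
            · exact hc1.trans hΔ
        _ = Δ * ‖z‖ / 2 := by field_simp; ring
        _ ≤ _ := by nlinarith [mul_nonneg hΔ0 (norm_nonneg z)]
    calc _ ≤ Δ * ‖z‖ + Δ * ‖z‖ + 2 * Δ * ‖z‖ :=
          (norm_sub_le _ _).trans (add_le_add ((norm_sub_le _ _).trans (add_le_add a1 a2)) a3)
      _ = _ := by ring
  have e3 : schur u A (-((δ + v) / δ)) y - (l m.succ : ℂ) • y
      = (schur u A (-((δ + v) / δ)) w - (l m.succ : ℂ) • w)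
        + (schur u A (-((δ + v) / δ)) (y - w) - (l m.succ : ℂ) • (y - w)) := by
    rw [map_sub, smul_sub]; abel
  rw [e3]
  calc _ ≤ 8 * Δ ^ 3 / δ ^ 2 + 4 * Δ * (4 * Δ ^ 2 / δ ^ 2) :=
        (norm_add_le _ _).trans (add_le_add n1 (n2.trans (by gcongr)))
    _ = _ := by ring

set_option maxHeartbeats 800000 in
/-- To second order, the coupling of a rotated eigenvector to the off-diagonal block determines
the component of the eigenvector along `u`. -/
lemma abs_coupling_sub_le (hδ : 0 < δ) (hv : 0 < v) (hΔ : ‖A - spike u δ v‖ ≤ δ / 4)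
    (m : Fin q) {y : Perp u}
    (hy : ‖y - toPerp u (uh m.succ)‖ ≤ 4 * ‖A - spike u δ v‖ ^ 2 / δ ^ 2) :
    |‖inner ℂ (cross u A) y‖ ^ 2 / corner u A
      - δ ^ 2 / (δ + v) * ‖inner ℂ u (uh m.succ)‖ ^ 2|
      ≤ 60 * ‖A - spike u δ v‖ ^ 3 / (δ * (δ + v)) := by
  set Δ := ‖A - spike u δ v‖ with hΔ'
  have hΔ0 : 0 ≤ Δ := norm_nonneg _
  set w := toPerp u (uh m.succ) with hw
  set c := cross u A with hc
  set r := corner u A with hr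
  have hc1 : ‖c‖ ≤ Δ := norm_cross_le H.unit
  have hr1 := abs_le.1 (abs_corner_sub_le (A := A) (δ := δ) (v := v) H.unit)
  have hl1 := abs_le.1 (H.abs_bulk_sub_le (v := v) hδ.le m)
  rw [← hΔ', ← hr] at hr1
  rw [← hΔ'] at hl1
  have hr0 : (δ + v) / 2 ≤ r := by linarith
  have hrpos : 0 < r := by linarith
  have hw1 : ‖w‖ ≤ 1 := (norm_toPerp_le _ _).trans (H.orthonormal.1 _).le
  have hα := H.norm_inner_bulk_le (v := v) hδ hΔ m
  rw [← hΔ'] at hα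
  set a := ‖inner ℂ u (uh m.succ)‖ with ha
  have ha0 : 0 ≤ a := norm_nonneg _
  have hX : ‖inner ℂ c w‖ = |r - l m.succ| * a := by
    rw [H.corner_eq m.succ, norm_neg, norm_mul, Complex.norm_real, Real.norm_eq_abs]
  set X := ‖inner ℂ c w‖
  set Y := ‖inner ℂ c y‖
  have hXΔ : X ≤ Δ := (norm_inner_le_norm _ _).trans (by nlinarith [norm_nonneg c, norm_nonneg w])
  have hXY : |Y - X| ≤ Δ * (4 * Δ ^ 2 / δ ^ 2) := by
    refine (abs_norm_sub_norm_le _ _).trans ?_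
    rw [← inner_sub_right]
    refine (norm_inner_le_norm _ _).trans ?_
    gcongr
  have hΔδ : Δ ^ 2 / δ ^ 2 ≤ 1 / 16 := by
    rw [div_le_iff₀ (by positivity)]; nlinarith
  have hX0 : 0 ≤ X := norm_nonneg _
  have hY0 : 0 ≤ Y := norm_nonneg _
  have hXYs : |Y ^ 2 - X ^ 2| ≤ 3 * Δ ^ 3 / δ := by
    have e : Y ^ 2 - X ^ 2 = (Y - X) * (Y + X) := by ring
    have hYX : Y + X ≤ 3 * Δ := by
      have := (abs_le.1 hXY).2
      have h4 : Δ * (4 * Δ ^ 2 / δ ^ 2) ≤ Δ * (1 / 4) := by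
        refine mul_le_mul_of_nonneg_left ?_ hΔ0
        rw [mul_div_assoc]; linarith
      linarith
    rw [e, abs_mul, abs_of_nonneg (by positivity : 0 ≤ Y + X)]
    calc _ ≤ Δ * (4 * Δ ^ 2 / δ ^ 2) * (3 * (δ / 4)) := by
          gcongr; linarith
      _ = _ := by field_simp
  have hmain : |X ^ 2 / r - δ ^ 2 / (δ + v) * a ^ 2| ≤ 50 * Δ ^ 3 / (δ * (δ + v)) := by
    have e : X ^ 2 / r - δ ^ 2 / (δ + v) * a ^ 2
        = ((r - l m.succ) ^ 2 * (δ + v) - δ ^ 2 * r) / (r * (δ + v)) * a ^ 2 := by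
      rw [hX, mul_pow, sq_abs]; field_simp
    have n : |(r - l m.succ) ^ 2 * (δ + v) - δ ^ 2 * r| ≤ 6 * (δ + v) * δ * Δ := by
      obtain ⟨e1, he1⟩ : ∃ e1, e1 = r - l m.succ - δ := ⟨_, rfl⟩
      obtain ⟨e2, he2⟩ : ∃ e2, e2 = r - (δ + v) := ⟨_, rfl⟩
      have b1 : |e1| ≤ 2 * Δ := by rw [he1, abs_le]; constructor <;> linarith
      have b2 : |e2| ≤ Δ := by rw [he2, abs_le]; constructor <;> linarith
      have e' : (r - l m.succ) ^ 2 * (δ + v) - δ ^ 2 * r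
          = (δ + v) * (2 * δ * e1 + e1 * e1) - δ ^ 2 * e2 := by
        have h1 : r - l m.succ = δ + e1 := by linarith
        have h2 : r = δ + v + e2 := by linarith
        rw [h1, h2]; ring
      rw [e']
      calc _ ≤ |(δ + v) * (2 * δ * e1 + e1 * e1)| + |δ ^ 2 * e2| := abs_sub _ _
        _ ≤ (δ + v) * (2 * δ * |e1| + |e1| * |e1|) + δ ^ 2 * |e2| := by
            rw [abs_mul, abs_mul, abs_of_pos (by positivity : 0 < δ + v),
              abs_of_pos (by positivity : 0 < δ ^ 2)]
            gcongr
            refine (abs_add_le _ _).trans (le_of_eq ?_)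
            rw [abs_mul (2 * δ), abs_mul e1, abs_of_pos (by positivity : 0 < 2 * δ)]
        _ ≤ (δ + v) * (2 * δ * (2 * Δ) + (2 * (δ / 4)) * (2 * Δ)) + δ ^ 2 * Δ := by
            gcongr; linarith
        _ ≤ _ := by nlinarith [mul_nonneg (mul_nonneg hδ.le hv.le) hΔ0]
    rw [e, abs_mul, abs_div, abs_of_pos (by positivity : 0 < r * (δ + v)),
      abs_of_nonneg (by positivity : 0 ≤ a ^ 2)]
    calc _ ≤ 6 * (δ + v) * δ * Δ / ((δ + v) / 2 * (δ + v)) * (2 * Δ / δ) ^ 2 := by gcongr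
      _ = 48 * Δ ^ 3 / (δ * (δ + v)) := by field_simp; ring
      _ ≤ _ := by gcongr; norm_num
  have e : Y ^ 2 / r - δ ^ 2 / (δ + v) * a ^ 2
      = (Y ^ 2 - X ^ 2) / r + (X ^ 2 / r - δ ^ 2 / (δ + v) * a ^ 2) := by ring
  rw [e]
  have n3 : |(Y ^ 2 - X ^ 2) / r| ≤ 6 * Δ ^ 3 / (δ * (δ + v)) := by
    rw [abs_div, abs_of_pos hrpos]
    calc _ ≤ 3 * Δ ^ 3 / δ / ((δ + v) / 2) := by gcongr
      _ = _ := by field_simp; ring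
  calc _ ≤ 6 * Δ ^ 3 / (δ * (δ + v)) + 50 * Δ ^ 3 / (δ * (δ + v)) :=
        (abs_add_le _ _).trans (add_le_add n3 hmain)
    _ ≤ _ := by
      rw [← add_div]; gcongr; nlinarith [pow_nonneg hΔ0 3]

end IsEigensystem

end Comparison

/-! ### Subgradients of Ky Fan sums at the sample covariance -/

section GlobalComparison

variable {F : Type*} [NormedAddCommGroup F] [InnerProductSpace ℂ F] {u : F} {A : F →L[ℂ] F}
  {δ v : ℝ}

lemma norm_spike_le (hu : ‖u‖ = 1) (hδ : 0 < δ) (hv : 0 < v) : ‖spike u δ v‖ ≤ δ + v := by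
  refine (norm_add_le _ _).trans (add_le_add ?_ ?_)
  · rw [norm_smul, InnerProductSpace.norm_rankOne, hu, Real.norm_of_nonneg hδ.le]; simp
  · rw [norm_smul, Real.norm_of_nonneg hv.le]
    have : ‖(1 : F →L[ℂ] F)‖ ≤ 1 := ContinuousLinearMap.norm_id_le
    nlinarith

lemma schur_add (u : F) (A : F →L[ℂ] F) (t h : ℝ) :
    schur u A (t + h) = schur u A t
      + (h / corner u A) • rankOne ℂ (cross u A) (cross u A) := by
  rw [schur, schur, add_div, add_smul, add_assoc]

lemma re_inner_rankOne_smul {E : Type*} [NormedAddCommGroup E] [InnerProductSpace ℂ E]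
    (t : ℝ) (c y : E) : (inner ℂ y ((t • rankOne ℂ c c) y)).re = t * ‖inner ℂ c y‖ ^ 2 := by
  rw [smul_apply, re_inner_real_smul, InnerProductSpace.rankOne_apply, inner_smul_right,
    ← inner_conj_symm y c, Complex.mul_conj, Complex.normSq_eq_norm_sq, Complex.ofReal_re]

namespace IsEigensystem

variable {q : ℕ} {uh : Fin (q + 1) → F} {l : Fin (q + 1) → ℝ}

/-- The sum of the squared components along `u` of the first `k` eigenvectors past the leading one
is, up to a third-order term, a subgradient of the Ky Fan sum of the Schur-type operators. -/
lemma topSum_schur_ge [FiniteDimensional ℂ F] (H : IsEigensystem u A uh l) (hδ : 0 < δ)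
    (hv : 0 < v) (hΔ : ‖A - spike u δ v‖ ≤ δ / 4) {k : ℕ} (hk : k ≤ q) {h : ℝ} (hh : |h| ≤ 1) :
    h * (δ ^ 2 / (δ + v) * ∑ m : Fin q with m.val < k, ‖inner ℂ u (uh m.succ)‖ ^ 2)
      ≤ topSum k (schur u A (-((δ + v) / δ) + h)) - topSum k (schur u A (-((δ + v) / δ)))
        + (k * (q + 1) * (24 / δ ^ 2) + k * (60 / (δ * (δ + v)))) * ‖A - spike u δ v‖ ^ 3 := by
  obtain ⟨f, hf⟩ := H.exists_rotated_basis (v := v) hδ hΔ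
  have hS := fun m => H.norm_schur_sub_le hδ hv hΔ m (hf m)
  have hC := fun m => H.abs_coupling_sub_le hδ hv hΔ m (hf m)
  set Δ := ‖A - spike u δ v‖
  set S := schur u A (-((δ + v) / δ)) with hSdef
  set r := corner u A
  set c := cross u A
  -- the almost eigenvectors nearly attain the Ky Fan sum at `h = 0`, and compete in it at `h`
  have h1 := topSum_le_of_almost_eigenbasis f hk S (fun m => l m.succ)
    (fun i j hij => H.anti (Fin.succ_le_succ_iff.2 hij)) hS
  have h2 := frame_sum_le_topSum (schur u A (-((δ + v) / δ) + h))
    (g := fun i : Fin k => f (Fin.castLE hk i)) (f.orthonormal.comp _ (Fin.castLE_injective hk))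
  rw [sum_castLE hk (fun m => (inner ℂ (f m) (schur u A (-((δ + v) / δ) + h) (f m))).re)] at h2
  -- the diagonal entry splits into the almost eigenvalue and the rank-one term of weight `h`
  have h3 : ∀ m : Fin q, l m.succ - 24 * Δ ^ 3 / δ ^ 2
      + (h * (δ ^ 2 / (δ + v) * ‖inner ℂ u (uh m.succ)‖ ^ 2) - 60 * Δ ^ 3 / (δ * (δ + v)))
      ≤ (inner ℂ (f m) (schur u A (-((δ + v) / δ) + h) (f m))).re := by
    intro m
    rw [schur_add, add_apply, inner_add_right, Complex.add_re, re_inner_rankOne_smul]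
    refine add_le_add ?_ ?_
    · have e : inner ℂ (f m) (S (f m)) = (l m.succ : ℂ)
          + inner ℂ (f m) (S (f m) - (l m.succ : ℂ) • f m) := by
        rw [inner_sub_right, inner_smul_right, inner_self_eq_norm_sq_to_K, f.norm_eq_one]; simp
      have n : ‖inner ℂ (f m) (S (f m) - (l m.succ : ℂ) • f m)‖ ≤ 24 * Δ ^ 3 / δ ^ 2 := by
        refine (norm_inner_le_norm _ _).trans ?_
        rw [f.norm_eq_one, one_mul]; exact hS m
      rw [← hSdef, e, Complex.add_re, Complex.ofReal_re]
      have := (abs_le.1 ((Complex.abs_re_le_norm _).trans n)).1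
      linarith
    · have e : h / r * ‖inner ℂ c (f m)‖ ^ 2 = h * (‖inner ℂ c (f m)‖ ^ 2 / r) := by ring
      rw [e]
      have b : |h * (‖inner ℂ c (f m)‖ ^ 2 / r - δ ^ 2 / (δ + v) * ‖inner ℂ u (uh m.succ)‖ ^ 2)|
          ≤ 60 * Δ ^ 3 / (δ * (δ + v)) := by
        rw [abs_mul]
        exact (mul_le_of_le_one_left (abs_nonneg _) hh).trans (hC m)
      have := (abs_le.1 b).1
      rw [mul_sub] at this
      linarith
  have h4 := Finset.sum_le_sum fun m (_ : m ∈ (Finset.univ.filter fun m : Fin q => m.val < k)) => h3 m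
  have hcard : ((Finset.univ.filter fun m : Fin q => m.val < k).card : ℝ) = k := by
    rw [Finset.card_eq_sum_ones, ← sum_castLE hk (fun _ => 1)]; simp
  simp only [Finset.sum_add_distrib, Finset.sum_sub_distrib, Finset.sum_const, nsmul_eq_mul, hcard,
    ← Finset.mul_sum] at h4
  have e5 : (k * (q + 1) * (24 / δ ^ 2) + k * (60 / (δ * (δ + v)))) * Δ ^ 3
      = k * (q * (24 * Δ ^ 3 / δ ^ 2)) + k * (24 * Δ ^ 3 / δ ^ 2)
        + k * (60 * Δ ^ 3 / (δ * (δ + v))) := by ring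
  rw [e5]
  linarith

/-- The constant in the global comparison inequality. -/
noncomputable def comparisonConst (δ v : ℝ) (k q : ℕ) : ℝ :=
  (k * (q + 1) * (24 / δ ^ 2) + k * (60 / (δ * (δ + v))))
    + (64 / (δ * (δ + v)) + k * (64 * (δ + v) / δ ^ 3 + 16 / δ ^ 2))

/-- The comparison inequality holds for every positive operator: away from the spike, the
third-order term absorbs everything. -/
lemma topSum_schur_ge_global [FiniteDimensional ℂ F] (H : IsEigensystem u A uh l)
    (hl : ∀ m, 0 ≤ l m) (hδ : 0 < δ) (hv : 0 < v) {k : ℕ} (hk : k ≤ q) {h : ℝ} (hh : |h| ≤ 1) :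
    h * (δ ^ 2 / (δ + v) * ∑ m : Fin q with m.val < k, ‖inner ℂ u (uh m.succ)‖ ^ 2)
      ≤ topSum k (schur u A (-((δ + v) / δ) + h)) - topSum k (schur u A (-((δ + v) / δ)))
        + comparisonConst δ v k q * ‖A - spike u δ v‖ ^ 3 := by
  have hΔ0 : 0 ≤ ‖A - spike u δ v‖ ^ 3 := by positivity
  rcases le_or_gt ‖A - spike u δ v‖ (δ / 4) with hΔ | hΔ
  · refine (H.topSum_schur_ge hδ hv hΔ hk hh).trans ?_
    rw [comparisonConst, add_mul _ (64 / (δ * (δ + v)) + _)]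
    have : 0 ≤ (64 / (δ * (δ + v)) + k * (64 * (δ + v) / δ ^ 3 + 16 / δ ^ 2))
      * ‖A - spike u δ v‖ ^ 3 := by positivity
    linarith
  · -- here `δ / 4 < Δ`, so constants and first-order terms are bounded by multiples of `Δ ^ 3`
    set Δ := ‖A - spike u δ v‖
    have hΔpos : 0 < Δ := lt_trans (by positivity) hΔ
    have one_le : 1 ≤ 64 * Δ ^ 3 / δ ^ 3 := by
      rw [le_div_iff₀ (by positivity)]
      have : (δ / 4) ^ 3 ≤ Δ ^ 3 := by gcongr
      nlinarith
    have le_cube : Δ ≤ 16 * Δ ^ 3 / δ ^ 2 := by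
      rw [le_div_iff₀ (by positivity)]
      have : (δ / 4) ^ 2 ≤ Δ ^ 2 := by gcongr
      nlinarith
    have hsum : ∑ m : Fin q with m.val < k, ‖inner ℂ u (uh m.succ)‖ ^ 2 ≤ 1 := by
      have h1 := H.sum_sq_inner u
      rw [Fin.sum_univ_succ, H.unit] at h1
      have h2 : ∑ m : Fin q with m.val < k, ‖inner ℂ u (uh m.succ)‖ ^ 2
          ≤ ∑ m : Fin q, ‖inner ℂ (uh m.succ) u‖ ^ 2 := by
        refine (Finset.sum_le_sum_of_subset_of_nonneg (Finset.subset_univ _)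
          fun _ _ _ => by positivity).trans (le_of_eq ?_)
        simp_rw [norm_inner_symm u]
      nlinarith [sq_nonneg ‖inner ℂ (uh 0) u‖]
    have hL : h * (δ ^ 2 / (δ + v) * ∑ m : Fin q with m.val < k, ‖inner ℂ u (uh m.succ)‖ ^ 2)
        ≤ 64 / (δ * (δ + v)) * Δ ^ 3 := by
      have a1 : δ ^ 2 / (δ + v) * ∑ m : Fin q with m.val < k, ‖inner ℂ u (uh m.succ)‖ ^ 2
          ≤ δ ^ 2 / (δ + v) * (64 * Δ ^ 3 / δ ^ 3) := by
        gcongr; exact hsum.trans one_le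
      have a0 : 0 ≤ δ ^ 2 / (δ + v) * ∑ m : Fin q with m.val < k, ‖inner ℂ u (uh m.succ)‖ ^ 2 := by
        positivity
      have a2 : δ ^ 2 / (δ + v) * (64 * Δ ^ 3 / δ ^ 3) = 64 / (δ * (δ + v)) * Δ ^ 3 := by
        field_simp
      have := (abs_le.1 hh).2
      nlinarith
    have hfr := finrank_perp (u := u) (by rintro rfl; simpa using H.unit) H.finrank
    have hR : -(k * (64 * (δ + v) / δ ^ 3 + 16 / δ ^ 2) * Δ ^ 3)
        ≤ topSum k (schur u A (-((δ + v) / δ) + h)) - topSum k (schur u A (-((δ + v) / δ))) := by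
      have b1 := topSum_sub_le (k := k) (by rw [hfr]; exact hk) (schur u A (-((δ + v) / δ)))
        (schur u A (-((δ + v) / δ) + h))
      rw [schur_add, sub_add_cancel_left, norm_neg, norm_smul, InnerProductSpace.norm_rankOne,
        ← schur_add] at b1
      have hr0 : 0 ≤ corner u A := by
        rw [corner, H.re_inner_eq_sum]
        exact Finset.sum_nonneg fun m _ => mul_nonneg (hl m) (by positivity)
      have b2 : ‖h / corner u A‖ * (‖cross u A‖ * ‖cross u A‖) ≤ ‖A‖ := by
        rcases hr0.eq_or_lt with h0 | hpos
        · rw [← h0]; simp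
        · rw [norm_div, Real.norm_eq_abs, Real.norm_of_nonneg hr0, ← sq, div_mul_eq_mul_div,
            div_le_iff₀ hpos]
          exact (mul_le_of_le_one_left (by positivity) hh).trans (H.norm_cross_sq_le hl)
      have b3 : ‖A‖ ≤ (δ + v) + Δ := by
        have := norm_add_le (spike u δ v) (A - spike u δ v)
        rw [add_sub_cancel] at this
        linarith [norm_spike_le H.unit hδ hv]
      have b4 : ‖A‖ ≤ (64 * (δ + v) / δ ^ 3 + 16 / δ ^ 2) * Δ ^ 3 := by
        have e : (64 * (δ + v) / δ ^ 3 + 16 / δ ^ 2) * Δ ^ 3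
            = (δ + v) * (64 * Δ ^ 3 / δ ^ 3) + 16 * Δ ^ 3 / δ ^ 2 := by ring
        rw [e]
        nlinarith
      have b5 : (k : ℝ) * (‖h / corner u A‖ * (‖cross u A‖ * ‖cross u A‖))
          ≤ k * ((64 * (δ + v) / δ ^ 3 + 16 / δ ^ 2) * Δ ^ 3) := by
        exact mul_le_mul_of_nonneg_left (b2.trans b4) (Nat.cast_nonneg k)
      linarith
    have e : comparisonConst δ v k q * Δ ^ 3
        = (k * (q + 1) * (24 / δ ^ 2) + k * (60 / (δ * (δ + v)))) * Δ ^ 3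
          + 64 / (δ * (δ + v)) * Δ ^ 3
          + k * (64 * (δ + v) / δ ^ 3 + 16 / δ ^ 2) * Δ ^ 3 := by
      rw [comparisonConst]; ring
    have : 0 ≤ (k * (q + 1) * (24 / δ ^ 2) + k * (60 / (δ * (δ + v)))) * Δ ^ 3 := by positivity
    rw [e]
    linarith

/-- The matrix elements of the residual `d dᴴ`, where `d` is the component of `u` off the leading
eigenvector, agree with those of `c cᴴ / δ²` up to a third-order term. -/
lemma norm_residual_product_sub_le (H : IsEigensystem u A uh l) (hδ : 0 < δ) (y z : F) :
    ‖inner ℂ y (u - inner ℂ (uh 0) u • uh 0) * inner ℂ (u - inner ℂ (uh 0) u • uh 0) z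
        - ((δ ^ 2)⁻¹ : ℝ) * (inner ℂ y (cross u A : F) * inner ℂ (cross u A : F) z)‖
      ≤ 108 / δ ^ 3 * ‖A - spike u δ v‖ ^ 3 * (‖y‖ * ‖z‖) := by
  set d := u - inner ℂ (uh 0) u • uh 0 with hd
  set Δ := ‖A - spike u δ v‖ with hΔdef
  have hΔ0 : 0 ≤ Δ := norm_nonneg _
  set g : F := -((δ : ℂ)⁻¹ • (cross u A : F)) with hg
  have hg1 : ‖g‖ ≤ Δ / δ := by
    rw [hg, norm_neg, norm_smul, norm_inv, Complex.norm_real, Real.norm_of_nonneg hδ.le,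
      div_eq_inv_mul]
    gcongr
    exact norm_cross_le H.unit
  have e1 : ((δ ^ 2)⁻¹ : ℝ) * (inner ℂ y (cross u A : F) * inner ℂ (cross u A : F) z)
      = inner ℂ y g * inner ℂ g z := by
    rw [hg, inner_neg_left, inner_neg_right, inner_smul_left, inner_smul_right, map_inv₀,
      Complex.conj_ofReal]
    push_cast; ring
  rw [e1]
  rcases le_or_gt Δ (δ / 4) with hΔ | hΔ
  · have hdg : ‖d - g‖ ≤ 9 * Δ ^ 2 / δ ^ 2 := by
      rw [hg, sub_neg_eq_add]; exact H.norm_residual_add_le hδ hΔ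
    have hdg' : 9 * Δ ^ 2 / δ ^ 2 ≤ 3 * (Δ / δ) := by
      rw [mul_div_assoc', div_le_div_iff₀ (by positivity) hδ]
      nlinarith [mul_nonneg (mul_nonneg hΔ0 hδ.le) hδ.le, mul_nonneg hΔ0 hδ.le]
    have hd1 : ‖d‖ ≤ 4 * (Δ / δ) := by
      have := norm_add_le (d - g) g
      rw [sub_add_cancel] at this
      linarith
    have e2 : inner ℂ y d * inner ℂ d z - inner ℂ y g * inner ℂ g z
        = inner ℂ y (d - g) * inner ℂ d z + inner ℂ y g * inner ℂ (d - g) z := by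
      rw [inner_sub_left d g, inner_sub_right y d g]; ring
    rw [e2]
    have n1 : ‖inner ℂ y (d - g) * inner ℂ d z‖ ≤ (‖y‖ * (9 * Δ ^ 2 / δ ^ 2)) * (4 * (Δ / δ) * ‖z‖) := by
      rw [norm_mul]
      gcongr
      · exact (norm_inner_le_norm _ _).trans (by gcongr)
      · exact (norm_inner_le_norm _ _).trans (by gcongr)
    have n2 : ‖inner ℂ y g * inner ℂ (d - g) z‖ ≤ (‖y‖ * (Δ / δ)) * ((9 * Δ ^ 2 / δ ^ 2) * ‖z‖) := by
      rw [norm_mul]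
      gcongr
      · exact (norm_inner_le_norm _ _).trans (by gcongr)
      · exact (norm_inner_le_norm _ _).trans (by gcongr)
    calc _ ≤ (‖y‖ * (9 * Δ ^ 2 / δ ^ 2)) * (4 * (Δ / δ) * ‖z‖)
          + (‖y‖ * (Δ / δ)) * ((9 * Δ ^ 2 / δ ^ 2) * ‖z‖) :=
          (norm_add_le _ _).trans (add_le_add n1 n2)
      _ = 45 * (1 / δ ^ 3 * Δ ^ 3 * (‖y‖ * ‖z‖)) := by field_simp; ring
      _ ≤ 108 * (1 / δ ^ 3 * Δ ^ 3 * (‖y‖ * ‖z‖)) := by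
          gcongr; norm_num
      _ = _ := by ring
  · -- far from the spike, both products are bounded separately by multiples of `Δ ^ 3`
    have hd1 : ‖d‖ ≤ 1 := by
      have e3 : d = (Submodule.span ℂ {uh 0})ᗮ.starProjection u := by
        rw [Submodule.starProjection_orthogonal', sub_apply,
          Submodule.starProjection_unit_singleton ℂ (H.orthonormal.1 0)]; rfl
      rw [e3]
      exact (Submodule.norm_starProjection_apply_le _ _).trans H.unit.le
    have n1 : ‖inner ℂ y d * inner ℂ d z‖ ≤ (‖y‖ * 1) * (1 * ‖z‖) := by
      rw [norm_mul]
      gcongr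
      · exact (norm_inner_le_norm _ _).trans (by gcongr)
      · exact (norm_inner_le_norm _ _).trans (by gcongr)
    have n2 : ‖inner ℂ y g * inner ℂ g z‖ ≤ (‖y‖ * (Δ / δ)) * (Δ / δ * ‖z‖) := by
      rw [norm_mul]
      gcongr
      · exact (norm_inner_le_norm _ _).trans (by gcongr)
      · exact (norm_inner_le_norm _ _).trans (by gcongr)
    have hx : 1 ≤ 4 * (Δ / δ) := by
      rw [mul_div_assoc', le_div_iff₀ hδ]; linarith
    have hx3 : 1 + (Δ / δ) ^ 2 ≤ 108 * (Δ / δ) ^ 3 := by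
      have hx2 : 1 ≤ (4 * (Δ / δ)) ^ 2 := one_le_pow₀ hx
      nlinarith [mul_le_mul hx hx2 zero_le_one (by positivity), sq_nonneg (Δ / δ)]
    calc _ ≤ (‖y‖ * 1) * (1 * ‖z‖) + (‖y‖ * (Δ / δ)) * (Δ / δ * ‖z‖) :=
          (norm_sub_le _ _).trans (add_le_add n1 n2)
      _ = (1 + (Δ / δ) ^ 2) * (‖y‖ * ‖z‖) := by ring
      _ ≤ 108 * (Δ / δ) ^ 3 * (‖y‖ * ‖z‖) := by gcongr
      _ = _ := by ring

end IsEigensystem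

end GlobalComparison

/-! ### Expected Ky Fan sums of isotropic Gram operators -/

section Isotropic

variable {E : Type*} [NormedAddCommGroup E] [InnerProductSpace ℂ E]

/-- The Gram operator `∑ n, w n (w n)ᴴ`. -/
noncomputable def gram {N : ℕ} (w : Fin N → E) : E →L[ℂ] E := ∑ n, rankOne ℂ (w n) (w n)

lemma continuous_rankOne_self : Continuous fun y : E => rankOne ℂ y y := by
  exact ((ContinuousLinearMap.smulRightL ℂ E E).continuous.comp
    (innerSL ℂ).continuous).clm_apply continuous_id

lemma continuous_gram {N : ℕ} : Continuous (gram : (Fin N → E) → E →L[ℂ] E) :=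
  continuous_finsetSum _ fun n _ => continuous_rankOne_self.comp (continuous_apply n)

lemma norm_gram_le {N : ℕ} (w : Fin N → E) : ‖gram w‖ ≤ ∑ n, ‖w n‖ ^ 2 :=
  (norm_sum_le _ _).trans (le_of_eq (Finset.sum_congr rfl fun n _ => by
    rw [InnerProductSpace.norm_rankOne, sq]))

lemma inner_gram {N : ℕ} (w : Fin N → E) (x y : E) :
    inner ℂ x (gram w y) = ∑ n, inner ℂ x (w n) * inner ℂ (w n) y := by
  simp [gram, mul_comm]

lemma sum_rankOne_basis {q : ℕ} (b : OrthonormalBasis (Fin q) ℂ E) :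
    ∑ i, rankOne ℂ (b i) (b i) = 1 := by
  ext y
  simp [b.sum_repr' y]

lemma finrank_pos_of_norm [FiniteDimensional ℂ E] {e : E} (he : ‖e‖ = 1) : 0 < Module.finrank ℂ E :=
  Module.finrank_pos_iff_exists_ne_zero.2 ⟨e, by rintro rfl; simp at he⟩

lemma exists_unitary_map_eq [FiniteDimensional ℂ E] (e e' : E) (he : ‖e‖ = 1) (he' : ‖e'‖ = 1) :
    ∃ U : E ≃ₗᵢ[ℂ] E, U e = e' := by
  have hpos : 0 < Module.finrank ℂ E := finrank_pos_of_norm he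
  have key : ∀ x : E, ‖x‖ = 1 → ∃ b : OrthonormalBasis (Fin (Module.finrank ℂ E)) ℂ E,
      b ⟨0, hpos⟩ = x := by
    intro x hx
    obtain ⟨b, hb⟩ := Orthonormal.exists_orthonormalBasis_extension_of_card_eq (𝕜 := ℂ)
      (ι := Fin (Module.finrank ℂ E)) (by simp) (v := fun _ => x) (s := {⟨0, hpos⟩})
      ⟨fun _ => hx, fun i j hij => absurd (Subsingleton.elim i j) hij⟩
    exact ⟨b, hb _ rfl⟩
  obtain ⟨b, hb⟩ := key e he
  obtain ⟨b', hb'⟩ := key e' he'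
  exact ⟨b.equiv b' (Equiv.refl _), by rw [← hb, OrthonormalBasis.equiv_apply_basis]; simpa using hb'⟩

variable [MeasurableSpace E]

/-- A probability measure whose second moments are those of white noise of variance `v`, which is
invariant under unitary maps and charges the complement of every ball. -/
structure IsIsotropic (ν : Measure E) (v : ℝ) : Prop where
  prob : IsProbabilityMeasure ν
  integrable : Integrable (fun w => ‖w‖ ^ 2) ν
  second : ∀ z : E, ∫ w, ‖inner ℂ z w‖ ^ 2 ∂ν = v * ‖z‖ ^ 2
  unitary : ∀ U : E ≃ₗᵢ[ℂ] E, MeasurePreserving U ν ν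
  unbounded : ∀ ρ : ℝ, ν {w | ρ ≤ ‖w‖ ^ 2} ≠ 0

/-- The expected Ky Fan sum of a Gram operator of `N` independent vectors, shifted by `B`. -/
noncomputable def meanTop (ν : Measure E) (k N : ℕ) (B : E →L[ℂ] E) : ℝ :=
  ∫ w : Fin N → E, topSum k (gram w + B) ∂(Measure.pi fun _ => ν)

/-- The expected Ky Fan sum of a Gram operator perturbed by `t` times an independent rank-one
sample. -/
noncomputable def meanTopRankOne (ν : Measure E) (k N : ℕ) (t : ℝ) : ℝ :=
  ∫ y, meanTop ν k N (t • rankOne ℂ y y) ∂ν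

lemma IsIsotropic.integrable_sum_sq {ν : Measure E} {v : ℝ} (hν : IsIsotropic ν v) (N : ℕ) :
    Integrable (fun w : Fin N → E => ∑ n, ‖w n‖ ^ 2) (Measure.pi fun _ => ν) := by
  have := hν.prob
  refine integrable_finsetSum _ fun n _ => ?_
  exact (measurePreserving_eval (fun _ : Fin N => ν) n).integrable_comp_of_integrable hν.integrable

variable [BorelSpace E] [SecondCountableTopology E] [FiniteDimensional ℂ E]
  {ν : Measure E} {v : ℝ} {k : ℕ}

namespace IsIsotropic

lemma integrable_topSum (hν : IsIsotropic ν v) (hk : k ≤ Module.finrank ℂ E) (N : ℕ)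
    (B : E →L[ℂ] E) :
    Integrable (fun w : Fin N → E => topSum k (gram w + B)) (Measure.pi fun _ => ν) := by
  have := hν.prob
  refine Integrable.mono' (((hν.integrable_sum_sq N).add (integrable_const ‖B‖)).const_mul (k : ℝ))
    ?_ (ae_of_all _ fun w => ?_)
  · exact ((continuous_topSum hk).comp (continuous_gram.add continuous_const)).aestronglyMeasurable
  · refine (abs_topSum_le hk _).trans ?_
    simp only [Pi.add_apply]
    gcongr
    exact (norm_add_le _ _).trans (add_le_add_left (norm_gram_le w) _)

lemma meanTop_sub_le (hν : IsIsotropic ν v) (hk : k ≤ Module.finrank ℂ E) (N : ℕ)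
    (B B' : E →L[ℂ] E) : |meanTop ν k N B - meanTop ν k N B'| ≤ k * ‖B - B'‖ := by
  have := hν.prob
  rw [meanTop, meanTop, ← integral_sub (hν.integrable_topSum hk N B) (hν.integrable_topSum hk N B')]
  rw [← Real.norm_eq_abs]
  refine (norm_integral_le_of_norm_le_const (C := k * ‖B - B'‖) (ae_of_all _ fun w => ?_)).trans
    (by simp)
  simpa using abs_topSum_sub_le hk (gram w + B) (gram w + B')

lemma continuous_meanTop (hν : IsIsotropic ν v) (hk : k ≤ Module.finrank ℂ E) (N : ℕ) :
    Continuous (meanTop ν k N) := by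
  refine (LipschitzWith.of_dist_le_mul (K := (k : NNReal)) fun B B' => ?_).continuous
  simpa [Real.dist_eq, dist_eq_norm] using hν.meanTop_sub_le hk N B B'

lemma meanTop_add_smul_one (hν : IsIsotropic ν v) (hk : k ≤ Module.finrank ℂ E) (N : ℕ)
    (B : E →L[ℂ] E) (τ : ℝ) :
    meanTop ν k N (B + τ • (1 : E →L[ℂ] E)) = meanTop ν k N B + k * τ := by
  have := hν.prob
  simp_rw [meanTop, ← add_assoc, topSum_add_smul_one hk]
  rw [integral_add (hν.integrable_topSum hk N B) (integrable_const _)]; simp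

lemma meanTop_convex (hν : IsIsotropic ν v) (hk : k ≤ Module.finrank ℂ E) (N : ℕ)
    {ι : Type*} (s : Finset ι) (a : ι → ℝ) (ha : ∀ i ∈ s, 0 ≤ a i) (ha1 : ∑ i ∈ s, a i = 1)
    (B : ι → E →L[ℂ] E) :
    meanTop ν k N (∑ i ∈ s, a i • B i) ≤ ∑ i ∈ s, a i * meanTop ν k N (B i) := by
  simp_rw [meanTop, ← integral_const_mul]
  rw [← integral_finsetSum _ fun i _ => (hν.integrable_topSum hk N _).const_mul _]
  refine integral_mono (hν.integrable_topSum hk N _)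
    (integrable_finsetSum _ fun i _ => (hν.integrable_topSum hk N _).const_mul _) fun w => ?_
  have e : gram w + ∑ i ∈ s, a i • B i = ∑ i ∈ s, a i • (gram w + B i) := by
    simp_rw [smul_add, Finset.sum_add_distrib, ← Finset.sum_smul, ha1, one_smul]
  simp only [e]
  refine (topSum_sum_le hk s _).trans (le_of_eq (Finset.sum_congr rfl fun i hi => ?_))
  exact topSum_smul (ha i hi) _

lemma meanTop_unitary (hν : IsIsotropic ν v) (hk : k ≤ Module.finrank ℂ E) (N : ℕ)
    (U : E ≃ₗᵢ[ℂ] E) (ρ : ℝ) (e : E) :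
    meanTop ν k N (ρ • rankOne ℂ (U e) (U e)) = meanTop ν k N (ρ • rankOne ℂ e e) := by
  have := hν.prob
  have hmp : MeasurePreserving (fun (w : Fin N → E) n => U (w n)) (Measure.pi fun _ => ν)
      (Measure.pi fun _ => ν) := measurePreserving_pi _ _ fun _ => hν.unitary U
  have hcont : Continuous fun w : Fin N → E => topSum k (gram w + ρ • rankOne ℂ (U e) (U e)) :=
    (continuous_topSum hk).comp (continuous_gram.add continuous_const)
  rw [meanTop, meanTop]
  conv_lhs => rw [← hmp.map_eq]
  rw [integral_map hmp.measurable.aemeasurable hcont.aestronglyMeasurable]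
  congr 1; ext w
  refine topSum_congr_unitary hk U fun y => ?_
  simp only [add_apply, inner_add_right, inner_gram, LinearIsometryEquiv.inner_map_map]
  congr 1
  rw [smul_apply, smul_apply, ← Complex.coe_smul, ← Complex.coe_smul, inner_smul_right,
    inner_smul_right, InnerProductSpace.rankOne_apply, InnerProductSpace.rankOne_apply,
    inner_smul_right, inner_smul_right, U.inner_map_map, U.inner_map_map]

/-- By isotropy, the effect of a rank-one shift depends only on the norm of the vector. -/
lemma meanTop_eq_of_norm (hν : IsIsotropic ν v) (hk : k ≤ Module.finrank ℂ E) (N : ℕ)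
    {e : E} (he : ‖e‖ = 1) (t : ℝ) (y : E) :
    meanTop ν k N (t • rankOne ℂ y y) = meanTop ν k N ((t * ‖y‖ ^ 2) • rankOne ℂ e e) := by
  by_cases hy : y = 0
  · simp [hy]
  obtain ⟨U, hU⟩ := exists_unitary_map_eq e ((‖y‖⁻¹ : ℂ) • y) he
    (by rw [norm_smul, norm_inv, Complex.norm_real, norm_norm, inv_mul_cancel₀ (norm_ne_zero_iff.2 hy)])
  rw [← hν.meanTop_unitary hk N U _ e, hU]
  congr 1
  have hy' : (‖y‖ : ℂ) ≠ 0 := by exact_mod_cast norm_ne_zero_iff.2 hy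
  ext z
  simp only [smul_apply, InnerProductSpace.rankOne_apply, inner_smul_left, map_inv₀,
    Complex.conj_ofReal, ← Complex.coe_smul, smul_smul]
  congr 1
  push_cast
  field_simp

/-- The excess of the expected Ky Fan sum, after a rank-one shift by `ρ`, over its linear
prediction. -/
noncomputable def excess (ν : Measure E) (k N : ℕ) (e : E) (ρ : ℝ) : ℝ :=
  meanTop ν k N (ρ • rankOne ℂ e e) - meanTop ν k N 0 - k * ρ / Module.finrank ℂ E

lemma continuous_excess (hν : IsIsotropic ν v) (hk : k ≤ Module.finrank ℂ E) (N : ℕ) (e : E) :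
    Continuous (excess ν k N e) := by
  unfold excess
  have := (hν.continuous_meanTop hk N).comp
    ((continuous_id (X := ℝ)).smul (continuous_const (y := rankOne ℂ e e)))
  simp only [Function.comp_def] at this
  fun_prop

/-- The excess is nonnegative: the rank-one shifts along an orthonormal basis average to a multiple
of the identity. -/
lemma excess_nonneg (hν : IsIsotropic ν v) (hk : k ≤ Module.finrank ℂ E) (N : ℕ)
    {e : E} (he : ‖e‖ = 1) (ρ : ℝ) : 0 ≤ excess ν k N e ρ := by
  set q := Module.finrank ℂ E with hq
  have hq0 : (0 : ℝ) < q := by exact_mod_cast finrank_pos_of_norm he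
  set b := stdOrthonormalBasis ℂ E
  have h1 := hν.meanTop_convex hk N Finset.univ (fun _ : Fin q => (q : ℝ)⁻¹)
    (fun _ _ => by positivity) (by simp; field_simp) (fun i => ρ • rankOne ℂ (b i) (b i))
  have h2 : ∑ i : Fin q, (q : ℝ)⁻¹ • ρ • rankOne ℂ (b i) (b i)
      = 0 + (ρ / q) • (1 : E →L[ℂ] E) := by
    rw [← Finset.smul_sum, ← Finset.smul_sum, sum_rankOne_basis, smul_smul, zero_add,
      inv_mul_eq_div]
  rw [h2, hν.meanTop_add_smul_one hk] at h1
  have h3 : ∀ i : Fin q, meanTop ν k N (ρ • rankOne ℂ (b i) (b i))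
      = meanTop ν k N (ρ • rankOne ℂ e e) := fun i => by
    rw [hν.meanTop_eq_of_norm hk N he, b.norm_eq_one]; simp
  simp only [h3, Finset.sum_const, Finset.card_univ, Fintype.card_fin, nsmul_eq_mul] at h1
  rw [mul_inv_cancel_left₀ hq0.ne'] at h1
  rw [excess, ← hq]
  have : (k : ℝ) * (ρ / q) = k * ρ / q := by ring
  linarith

/-- Negative shifts reduce to positive ones: `-ρ e eᴴ` is `-ρ I` plus a positive combination of the
complementary projections. -/
lemma excess_neg_le (hν : IsIsotropic ν v) (hk : k ≤ Module.finrank ℂ E) (N : ℕ)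
    {e : E} (he : ‖e‖ = 1) (ρ : ℝ) :
    excess ν k N e (-ρ) ≤ excess ν k N e (Module.finrank ℂ E * ρ) := by
  set q := Module.finrank ℂ E with hq
  have hqpos : 0 < q := finrank_pos_of_norm he
  have hq0 : (0 : ℝ) < q := by exact_mod_cast hqpos
  set b : OrthonormalBasis (Fin q) ℂ E := stdOrthonormalBasis ℂ E
  set i₀ : Fin q := ⟨0, hqpos⟩
  set B : Fin q → E →L[ℂ] E := fun i => if i = i₀ then 0 else (q * ρ) • rankOne ℂ (b i) (b i)
  have h1 := hν.meanTop_convex hk N Finset.univ (fun _ : Fin q => (q : ℝ)⁻¹)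
    (fun _ _ => by positivity) (by simp; field_simp) B
  have h2 : -ρ • rankOne ℂ (b i₀) (b i₀)
      = ∑ i : Fin q, (q : ℝ)⁻¹ • B i + (-ρ) • (1 : E →L[ℂ] E) := by
    have e1 : ∀ i, (q : ℝ)⁻¹ • B i = ρ • rankOne ℂ (b i) (b i)
        - if i = i₀ then ρ • rankOne ℂ (b i) (b i) else 0 := by
      intro i
      by_cases hi : i = i₀
      · simp [B, hi]
      · simp only [B, hi, if_false, smul_smul, sub_zero]
        rw [inv_mul_cancel_left₀ hq0.ne']
    simp_rw [e1]
    rw [Finset.sum_sub_distrib, ← Finset.smul_sum, sum_rankOne_basis]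
    simp only [Finset.sum_ite_eq', Finset.mem_univ, if_true]
    module
  have h3 : ∀ i : Fin q, meanTop ν k N (B i) = meanTop ν k N ((q * ρ) • rankOne ℂ e e)
      - if i = i₀ then meanTop ν k N ((q * ρ) • rankOne ℂ e e) - meanTop ν k N 0 else 0 := by
    intro i
    by_cases hi : i = i₀
    · simp [B, hi]
    · simp only [B, hi, if_false, sub_zero]
      rw [hν.meanTop_eq_of_norm hk N he, b.norm_eq_one]; simp
  have h4 : meanTop ν k N (-ρ • rankOne ℂ (b i₀) (b i₀))
      = meanTop ν k N (-ρ • rankOne ℂ e e) := by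
    rw [hν.meanTop_eq_of_norm hk N he, b.norm_eq_one]; simp
  have h5 := hν.excess_nonneg hk N he (q * ρ)
  rw [h2, hν.meanTop_add_smul_one hk] at h4
  unfold excess at h5 ⊢
  rw [← h4]
  simp only [h3, ← Finset.mul_sum, Finset.sum_sub_distrib, Finset.sum_const, Finset.card_univ,
    Fintype.card_fin, nsmul_eq_mul, Finset.sum_ite_eq', Finset.mem_univ, if_true] at h1
  rw [mul_sub, inv_mul_cancel_left₀ hq0.ne'] at h1
  set G := meanTop ν k N ((q * ρ) • rankOne ℂ e e)
  set G0 := meanTop ν k N (0 : E →L[ℂ] E)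
  have e6 : (k : ℝ) * (q * ρ) / q = k * ρ := by field_simp
  have e7 : (q : ℝ)⁻¹ * (G - G0) = (q : ℝ)⁻¹ * (G - G0 - k * (q * ρ) / q) + k * ρ / q := by
    rw [e6]; field_simp; ring
  have h8 : 0 ≤ (q : ℝ)⁻¹ * (G - G0 - k * (q * ρ) / q) := by positivity
  have e9 : (k : ℝ) * -ρ / q = -(k * ρ / q) := by ring
  rw [← hq, e9]
  rw [e7] at h1
  have e10 : (k : ℝ) * -ρ = - (k * (q * ρ) / q) := by rw [e6]; ring
  rw [e10]
  linarith

/-- The excess is convex and vanishes at the origin, hence it is increasing. -/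
lemma excess_mono (hν : IsIsotropic ν v) (hk : k ≤ Module.finrank ℂ E) (N : ℕ)
    {e : E} (he : ‖e‖ = 1) {ρ ρ' : ℝ} (h0 : 0 ≤ ρ) (h : ρ ≤ ρ') :
    excess ν k N e ρ ≤ excess ν k N e ρ' := by
  rcases h0.eq_or_lt with rfl | hpos
  · have : excess ν k N e 0 = 0 := by simp [excess]
    rw [this]; exact hν.excess_nonneg hk N he ρ'
  have hpos' : 0 < ρ' := hpos.trans_le h
  set s := ρ / ρ' with hs
  have hs0 : 0 ≤ s := by positivity
  have hs1 : s ≤ 1 := by rw [hs, div_le_one hpos']; exact h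
  have hsρ : s * ρ' = ρ := by rw [hs]; field_simp
  have h1 := hν.meanTop_convex hk N Finset.univ ![s, 1 - s]
    (by intro i _; fin_cases i <;> simp [hs0, hs1]) (by simp) ![ρ' • rankOne ℂ e e, 0]
  simp only [Fin.sum_univ_two, Matrix.cons_val_zero, Matrix.cons_val_one, smul_zero, add_zero,
    smul_smul, hsρ] at h1
  have h2 := hν.excess_nonneg hk N he ρ'
  have h3 : excess ν k N e ρ ≤ s * excess ν k N e ρ' := by
    unfold excess
    have : s * (k * ρ' / Module.finrank ℂ E) = k * ρ / Module.finrank ℂ E := by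
      rw [← hsρ]; ring
    rw [mul_sub, mul_sub, this]
    linarith
  nlinarith

lemma abs_excess_le (hν : IsIsotropic ν v) (hk : k ≤ Module.finrank ℂ E) (N : ℕ)
    {e : E} (he : ‖e‖ = 1) (ρ : ℝ) : |excess ν k N e ρ| ≤ 2 * k * |ρ| := by
  have hq0 : (1 : ℝ) ≤ Module.finrank ℂ E := by exact_mod_cast finrank_pos_of_norm he
  have h1 := hν.meanTop_sub_le hk N (ρ • rankOne ℂ e e) 0
  rw [sub_zero, norm_smul, InnerProductSpace.norm_rankOne, he, one_mul, mul_one,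
    Real.norm_eq_abs] at h1
  have h2 : |(k : ℝ) * ρ / Module.finrank ℂ E| ≤ k * |ρ| := by
    rw [abs_div, abs_mul, Nat.abs_cast, Nat.abs_cast]
    exact div_le_self (by positivity) hq0
  calc _ ≤ _ := abs_sub _ _
    _ ≤ k * |ρ| + k * |ρ| := add_le_add h1 h2
    _ = _ := by ring

lemma integral_norm_sq (hν : IsIsotropic ν v) : ∫ y, ‖y‖ ^ 2 ∂ν = v * Module.finrank ℂ E := by
  have e : ∀ y : E, ‖y‖ ^ 2 = ∑ i, ‖inner ℂ (stdOrthonormalBasis ℂ E i) y‖ ^ 2 := fun y =>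
    ((stdOrthonormalBasis ℂ E).sum_sq_norm_inner_right y).symm
  have hint : ∀ z : E, ‖z‖ = 1 → Integrable (fun y => ‖inner ℂ z y‖ ^ 2) ν := fun z hz => by
    refine hν.integrable.mono' (by fun_prop) (ae_of_all _ fun y => ?_)
    have := norm_inner_le_norm (𝕜 := ℂ) z y
    rw [hz, one_mul] at this
    rw [norm_pow, norm_norm]; gcongr
  simp_rw [e]
  rw [integral_finsetSum _ fun i _ => hint _ (OrthonormalBasis.norm_eq_one _ i)]
  simp [hν.second, mul_comm]

/-- The nonlinear part of the effect of an independent rank-one sample is the mean excess at its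
squared norm. -/
lemma meanTopRankOne_sub_eq (hν : IsIsotropic ν v) (hk : k ≤ Module.finrank ℂ E) (N : ℕ)
    {e : E} (he : ‖e‖ = 1) (t : ℝ) :
    meanTopRankOne ν k N t - meanTop ν k N 0 - k * v * t
      = ∫ y, excess ν k N e (t * ‖y‖ ^ 2) ∂ν := by
  have := hν.prob
  have hq0 : (Module.finrank ℂ E : ℝ) ≠ 0 := by exact_mod_cast (finrank_pos_of_norm he).ne'
  have h1 : ∀ y, meanTop ν k N (t • rankOne ℂ y y)
      = excess ν k N e (t * ‖y‖ ^ 2) + meanTop ν k N 0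
        + k * t / Module.finrank ℂ E * ‖y‖ ^ 2 := fun y => by
    rw [hν.meanTop_eq_of_norm hk N he, excess]; ring
  have hint : Integrable (fun y => excess ν k N e (t * ‖y‖ ^ 2)) ν := by
    refine (hν.integrable.const_mul (2 * k * |t|)).mono' ?_ (ae_of_all _ fun y => ?_)
    · exact ((hν.continuous_excess hk N e).comp (by fun_prop)).aestronglyMeasurable
    · refine (hν.abs_excess_le hk N he _).trans (le_of_eq ?_)
      rw [abs_mul, abs_of_nonneg (by positivity : 0 ≤ ‖y‖ ^ 2)]; ring
  have hint' : Integrable (fun y => excess ν k N e (t * ‖y‖ ^ 2) + meanTop ν k N 0) ν :=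
    hint.add (integrable_const _)
  rw [meanTopRankOne]
  simp_rw [h1]
  rw [integral_add hint' (hν.integrable.const_mul _),
    integral_add hint (integrable_const _), integral_const_mul, hν.integral_norm_sq]
  simp only [integral_const, probReal_univ, smul_eq_mul, one_mul]
  field_simp
  ring

lemma gram_insertNth {E : Type*} [NormedAddCommGroup E] [InnerProductSpace ℂ E] {N : ℕ}
    (j : Fin (N + 1)) (w : Fin (N + 1) → E) :
    gram w = gram (fun i => w (j.succAbove i)) + rankOne ℂ (w j) (w j) := by
  rw [gram, Fin.sum_univ_succAbove _ j, add_comm]; rfl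

/-- Splitting off one of the independent vectors. -/
lemma integral_pi_succ (hν : IsIsotropic ν v) {N : ℕ} (j : Fin (N + 1))
    (G : E → (Fin N → E) → ℝ) :
    ∫ w : Fin (N + 1) → E, G (w j) (fun i => w (j.succAbove i)) ∂(Measure.pi fun _ => ν)
      = ∫ z, G z.1 z.2 ∂(ν.prod (Measure.pi fun _ => ν)) := by
  have := hν.prob
  have h := measurePreserving_piFinSuccAbove (fun _ : Fin (N + 1) => ν) j
  exact h.integral_comp' (g := fun z : E × (Fin N → E) => G z.1 z.2)

lemma integrable_topSum_prod (hν : IsIsotropic ν v) (hk : k ≤ Module.finrank ℂ E) (N : ℕ) (t : ℝ) :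
    Integrable (fun z : E × (Fin N → E) => topSum k (gram z.2 + t • rankOne ℂ z.1 z.1))
      (ν.prod (Measure.pi fun _ => ν)) := by
  have := hν.prob
  have i1 : Integrable (fun z : E × (Fin N → E) => ‖z.1‖ ^ 2) (ν.prod (Measure.pi fun _ => ν)) :=
    hν.integrable.comp_fst _
  have i2 : Integrable (fun z : E × (Fin N → E) => ∑ n, ‖z.2 n‖ ^ 2)
      (ν.prod (Measure.pi fun _ => ν)) := (hν.integrable_sum_sq N).comp_snd _
  refine ((i2.add (i1.const_mul |t|)).const_mul (k : ℝ)).mono' ?_ (ae_of_all _ fun z => ?_)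
  · refine Continuous.aestronglyMeasurable ((continuous_topSum hk).comp ?_)
    exact (continuous_gram.comp continuous_snd).add
      ((continuous_rankOne_self.comp continuous_fst).const_smul t)
  · refine (abs_topSum_le hk _).trans ?_
    simp only [Pi.add_apply]
    gcongr
    refine (norm_add_le _ _).trans (add_le_add (norm_gram_le _) (le_of_eq ?_))
    rw [norm_smul, InnerProductSpace.norm_rankOne, sq, Real.norm_eq_abs]

lemma integral_topSum_prod (hν : IsIsotropic ν v) (hk : k ≤ Module.finrank ℂ E) (N : ℕ) (t : ℝ) :
    ∫ z : E × (Fin N → E), topSum k (gram z.2 + t • rankOne ℂ z.1 z.1)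
      ∂(ν.prod (Measure.pi fun _ => ν)) = meanTopRankOne ν k N t := by
  have := hν.prob
  rw [integral_prod _ (hν.integrable_topSum_prod hk N t)]; rfl

/-- One summand of the Gram operator, reweighted by `1 + t`. -/
lemma integral_topSum_reweight (hν : IsIsotropic ν v) (hk : k ≤ Module.finrank ℂ E) (N : ℕ)
    (j : Fin (N + 1)) (t : ℝ) :
    ∫ w : Fin (N + 1) → E, topSum k (gram w + t • rankOne ℂ (w j) (w j)) ∂(Measure.pi fun _ => ν)
      = meanTopRankOne ν k N (1 + t) := by
  rw [← hν.integral_topSum_prod hk, ← hν.integral_pi_succ j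
    (fun y w => topSum k (gram w + (1 + t) • rankOne ℂ y y))]
  congr 1; ext w
  rw [gram_insertNth j w, add_smul, one_smul, add_assoc]

/-- An additional sample is an independent rank-one perturbation of weight one. -/
lemma meanTop_succ (hν : IsIsotropic ν v) (hk : k ≤ Module.finrank ℂ E) (N : ℕ) :
    meanTop ν k (N + 1) 0 = meanTopRankOne ν k N 1 := by
  rw [← add_zero (1 : ℝ), ← hν.integral_topSum_reweight hk N 0]; simp [meanTop]

/-- Averaging over the vector that is left out, and subadditivity. -/
lemma meanTop_leave_one_out (hν : IsIsotropic ν v) (hk : k ≤ Module.finrank ℂ E) (N : ℕ) :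
    N * meanTop ν k (N + 1) 0 ≤ (N + 1) * meanTop ν k N 0 := by
  have := hν.prob
  have h0 : meanTopRankOne ν k N 0 = meanTop ν k N 0 := by simp [meanTopRankOne]
  have hint : ∀ j : Fin (N + 1), Integrable
      (fun w : Fin (N + 1) → E => topSum k (gram w + (-1 : ℝ) • rankOne ℂ (w j) (w j)))
      (Measure.pi fun _ => ν) := by
    intro j
    refine ((hν.integrable_sum_sq (N + 1)).const_mul ((k : ℝ) * 2)).mono' ?_ (ae_of_all _ fun w => ?_)
    · refine Continuous.aestronglyMeasurable ((continuous_topSum hk).comp ?_)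
      have h : Continuous fun w : Fin (N + 1) → E => rankOne ℂ (w j) (w j) :=
        continuous_rankOne_self.comp (continuous_apply j)
      exact continuous_gram.add (h.const_smul (-1 : ℝ))
    · refine (abs_topSum_le hk _).trans ?_
      rw [mul_assoc]
      gcongr
      refine (norm_add_le _ _).trans ?_
      rw [norm_smul, InnerProductSpace.norm_rankOne, ← sq, norm_neg, norm_one, one_mul, two_mul]
      refine add_le_add (norm_gram_le _) ?_
      exact Finset.single_le_sum (f := fun n => ‖w n‖ ^ 2) (fun n _ => by positivity)
        (Finset.mem_univ j)
  have h1 : ∀ w : Fin (N + 1) → E, N * topSum k (gram w + 0)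
      ≤ ∑ j, topSum k (gram w + (-1 : ℝ) • rankOne ℂ (w j) (w j)) := by
    intro w
    rw [← topSum_smul (Nat.cast_nonneg N)]
    refine le_trans (le_of_eq ?_) (topSum_sum_le hk Finset.univ _)
    congr 1
    rw [Finset.sum_add_distrib, ← Finset.smul_sum]
    change _ = _ + (-1 : ℝ) • gram w
    simp only [Finset.sum_const, Finset.card_univ, Fintype.card_fin, add_zero]
    rw [← Nat.cast_smul_eq_nsmul ℝ]
    push_cast
    module
  have h2 := integral_mono ((hν.integrable_topSum hk (N + 1) 0).const_mul (N : ℝ))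
    (integrable_finsetSum _ fun j _ => hint j) h1
  rw [integral_const_mul, integral_finsetSum _ fun j _ => hint j] at h2
  simp_rw [hν.integral_topSum_reweight hk N] at h2
  simp only [add_neg_cancel, h0, Finset.sum_const, Finset.card_univ, Fintype.card_fin,
    nsmul_eq_mul] at h2
  push_cast at h2
  exact h2

/-- The excess tends to zero at each positive shift. The average of the excess over the size of an
independent sample vanishes in the limit, since the increments of the expected Ky Fan sum are
squeezed by convexity and by the leave-one-out inequality; as the sample exceeds any size with
positive probability and the excess is increasing, it vanishes everywhere. -/
lemma tendsto_excess_of_nonneg (hν : IsIsotropic ν v) (hk : k ≤ Module.finrank ℂ E)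
    (hlim : Tendsto (fun N : ℕ => meanTop ν k N 0 / N) atTop (𝓝 (k * v)))
    {e : E} (he : ‖e‖ = 1) {ρ : ℝ} (hρ : 0 ≤ ρ) :
    Tendsto (fun N : ℕ => excess ν k N e ρ) atTop (𝓝 0) := by
  have := hν.prob
  set c := ν.real {w | ρ ≤ ‖w‖ ^ 2} with hc
  have hcpos : 0 < c :=
    ENNReal.toReal_pos (hν.unbounded ρ) (measure_ne_top _ _)
  have hup : ∀ᶠ N : ℕ in atTop, excess ν k N e ρ ≤ c⁻¹ * (meanTop ν k N 0 / N - k * v) := by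
    filter_upwards [eventually_gt_atTop 0] with N hN
    have hN' : (0 : ℝ) < N := by exact_mod_cast hN
    have h1 := hν.meanTop_leave_one_out hk N
    have h2 := hν.meanTopRankOne_sub_eq hk N he 1
    rw [← hν.meanTop_succ hk] at h2
    simp only [one_mul, mul_one] at h2
    have hint : Integrable (fun y => excess ν k N e (‖y‖ ^ 2)) ν := by
      refine (hν.integrable.const_mul (2 * k)).mono' ?_ (ae_of_all _ fun y => ?_)
      · exact ((hν.continuous_excess hk N e).comp (by fun_prop)).aestronglyMeasurable
      · refine (hν.abs_excess_le hk N he _).trans (le_of_eq ?_)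
        rw [abs_of_nonneg (by positivity : 0 ≤ ‖y‖ ^ 2)]
    have h3 := mul_meas_ge_le_integral_of_nonneg (μ := ν)
      (f := fun y => excess ν k N e (‖y‖ ^ 2))
      (ae_of_all _ fun y => hν.excess_nonneg hk N he _) hint (excess ν k N e ρ)
    have h4 : c ≤ ν.real {y | excess ν k N e ρ ≤ excess ν k N e (‖y‖ ^ 2)} :=
      measureReal_mono fun y hy => hν.excess_mono hk N he hρ hy
    have h5 : excess ν k N e ρ * c ≤ meanTop ν k (N + 1) 0 - meanTop ν k N 0 - k * v := by
      rw [h2]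
      exact (mul_le_mul_of_nonneg_left h4 (hν.excess_nonneg hk N he ρ)).trans h3
    -- the leave-one-out inequality bounds the increment by the mean
    have h6 : meanTop ν k (N + 1) 0 - meanTop ν k N 0 ≤ meanTop ν k N 0 / N := by
      rw [le_div_iff₀ hN']; linarith
    rw [inv_mul_eq_div, le_div_iff₀ hcpos]
    linarith
  have hz : Tendsto (fun N : ℕ => c⁻¹ * (meanTop ν k N 0 / N - k * v)) atTop (𝓝 0) := by
    have := (hlim.sub_const (k * v)).const_mul c⁻¹
    simpa using this
  exact tendsto_of_tendsto_of_tendsto_of_le_of_le' tendsto_const_nhds hz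
    (Eventually.of_forall fun N => hν.excess_nonneg hk N he ρ) hup

lemma tendsto_excess (hν : IsIsotropic ν v) (hk : k ≤ Module.finrank ℂ E)
    (hlim : Tendsto (fun N : ℕ => meanTop ν k N 0 / N) atTop (𝓝 (k * v)))
    {e : E} (he : ‖e‖ = 1) (ρ : ℝ) :
    Tendsto (fun N : ℕ => excess ν k N e ρ) atTop (𝓝 0) := by
  rcases le_total 0 ρ with h | h
  · exact hν.tendsto_excess_of_nonneg hk hlim he h
  · refine tendsto_of_tendsto_of_tendsto_of_le_of_le tendsto_const_nhds
      (hν.tendsto_excess_of_nonneg hk hlim he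
        (mul_nonneg (Nat.cast_nonneg (Module.finrank ℂ E)) (neg_nonneg.2 h)))
      (fun N => hν.excess_nonneg hk N he ρ) fun N => ?_
    have := hν.excess_neg_le hk N he (-ρ)
    rwa [neg_neg] at this

/-- An independent rank-one perturbation of any fixed weight, of either sign, changes the expected
Ky Fan sum, in the limit, by the weight times `k v`. -/
theorem tendsto_meanTopRankOne_sub (hν : IsIsotropic ν v) (hk : k ≤ Module.finrank ℂ E)
    (hpos : 0 < Module.finrank ℂ E)
    (hlim : Tendsto (fun N : ℕ => meanTop ν k N 0 / N) atTop (𝓝 (k * v))) (t : ℝ) :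
    Tendsto (fun N : ℕ => meanTopRankOne ν k N t - meanTop ν k N 0) atTop (𝓝 (k * v * t)) := by
  have := hν.prob
  obtain ⟨e, he⟩ : ∃ e : E, ‖e‖ = 1 := ⟨stdOrthonormalBasis ℂ E ⟨0, hpos⟩,
    OrthonormalBasis.norm_eq_one _ _⟩
  have h1 : Tendsto (fun N : ℕ => ∫ y, excess ν k N e (t * ‖y‖ ^ 2) ∂ν) atTop
      (𝓝 (∫ _, (0 : ℝ) ∂ν)) := by
    refine tendsto_integral_of_dominated_convergence (fun y => 2 * k * |t| * ‖y‖ ^ 2)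
      (fun N => ((hν.continuous_excess hk N e).comp (by fun_prop)).aestronglyMeasurable)
      (hν.integrable.const_mul _) (fun N => ae_of_all _ fun y => ?_)
      (ae_of_all _ fun y => hν.tendsto_excess hk hlim he _)
    refine (hν.abs_excess_le hk N he _).trans (le_of_eq ?_)
    rw [abs_mul, abs_of_nonneg (by positivity : 0 ≤ ‖y‖ ^ 2)]; ring
  simp_rw [← hν.meanTopRankOne_sub_eq hk _ he t] at h1
  simpa using h1.add_const (k * v * t)

end IsIsotropic

end Isotropic

/-! ### Circular Gaussian vectors -/

section Circular

variable {E : Type*} [NormedAddCommGroup E] [InnerProductSpace ℂ E] [MeasurableSpace E]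
  {Ω : Type*} [MeasurableSpace Ω] {P : Measure Ω}

/-- Coordinate-free form of the circular symmetry: `X` is a centred Gaussian vector with covariance
operator `S` and vanishing pseudo-covariance. -/
structure IsCircular (P : Measure Ω) (X : Ω → E) (S : E →L[ℂ] E) : Prop where
  gaussian : HasGaussianLaw X P
  mean : ∀ y, ∫ ω, inner ℂ y (X ω) ∂P = 0
  cov : ∀ y z, ∫ ω, inner ℂ y (X ω) * inner ℂ (X ω) z ∂P = inner ℂ y (S z)
  pseudo : ∀ y z, ∫ ω, inner ℂ y (X ω) * inner ℂ z (X ω) ∂P = 0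

variable [FiniteDimensional ℂ E]

omit [MeasurableSpace E] in
lemma exists_re_inner_eq (L : StrongDual ℝ E) : ∃ z : E, ∀ x, L x = (inner ℂ z x).re := by
  have := FiniteDimensional.complete ℂ E
  let M : StrongDual ℂ E := L.extendRCLike
  refine ⟨(InnerProductSpace.toDual ℂ E).symm M, fun x => ?_⟩
  rw [InnerProductSpace.toDual_symm_apply]
  exact (StrongDual.re_extendRCLike_apply (𝕜 := ℂ) L x).symm

variable [BorelSpace E] [SecondCountableTopology E] {F : Type*} [NormedAddCommGroup F] [InnerProductSpace ℂ F]
  [MeasurableSpace F] [BorelSpace F] [FiniteDimensional ℂ F] [SecondCountableTopology F]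

namespace IsCircular

variable {X : Ω → E} {S : E →L[ℂ] E} (hX : IsCircular P X S)
include hX

omit [FiniteDimensional ℂ E] [BorelSpace E] [SecondCountableTopology E] in
lemma isProbabilityMeasure : IsProbabilityMeasure P := hX.gaussian.isProbabilityMeasure

lemma memLp {r : ENNReal} (hr : r ≠ ⊤) : MemLp X r P := by
  have := FiniteDimensional.complete ℂ E
  exact hX.gaussian.memLp hr

lemma memLp_inner (y : E) {r : ENNReal} (hr : r ≠ ⊤) : MemLp (fun ω => inner ℂ y (X ω)) r P :=
  (hX.memLp hr).const_inner y

lemma memLp_re_inner (y : E) {r : ENNReal} (hr : r ≠ ⊤) :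
    MemLp (fun ω => (inner ℂ y (X ω)).re) r P := (hX.memLp_inner y hr).re

lemma integral_re_inner (y : E) : ∫ ω, (inner ℂ y (X ω)).re ∂P = 0 := by
  have := hX.isProbabilityMeasure
  have h := integral_re ((hX.memLp_inner y (r := 1) (by simp)).integrable le_rfl)
  simp only [RCLike.re_eq_complex_re] at h
  rw [h, hX.mean]; simp

lemma integrable_inner_mul_inner (y z : E) :
    Integrable (fun ω => inner ℂ y (X ω) * inner ℂ z (X ω)) P :=
  (hX.memLp_inner y (r := 2) (by simp)).integrable_mul (hX.memLp_inner z (r := 2) (by simp))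

lemma integrable_inner_mul_inner' (y z : E) :
    Integrable (fun ω => inner ℂ y (X ω) * inner ℂ (X ω) z) P := by
  refine (hX.memLp_inner y (r := 2) (by simp)).integrable_mul
    (g := fun ω => inner ℂ (X ω) z) ((hX.memLp (r := 2) (by simp)).inner_const z)

lemma integral_re_mul_re (y z : E) :
    ∫ ω, (inner ℂ y (X ω)).re * (inner ℂ z (X ω)).re ∂P = (inner ℂ y (S z)).re / 2 := by
  have e : ∀ ω, (inner ℂ y (X ω)).re * (inner ℂ z (X ω)).re
      = (inner ℂ y (X ω) * inner ℂ (X ω) z + inner ℂ y (X ω) * inner ℂ z (X ω)).re / 2 := by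
    intro ω
    rw [← inner_conj_symm (X ω) z]
    simp only [Complex.add_re, Complex.mul_re, Complex.conj_re, Complex.conj_im]; ring
  simp_rw [e]
  rw [integral_div]
  have h := integral_re ((hX.integrable_inner_mul_inner' y z).add (hX.integrable_inner_mul_inner y z))
  simp only [RCLike.re_eq_complex_re, Pi.add_apply] at h
  rw [h, integral_add (hX.integrable_inner_mul_inner' y z) (hX.integrable_inner_mul_inner y z),
    hX.cov, hX.pseudo, add_zero]

lemma variance_re_inner (z : E) :
    Var[fun ω => (inner ℂ z (X ω)).re; P] = (inner ℂ z (S z)).re / 2 := by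
  rw [variance_of_integral_eq_zero (hX.memLp_re_inner z (r := 1) (by simp)).1.aemeasurable
    (hX.integral_re_inner z), ← hX.integral_re_mul_re]
  simp_rw [sq]

lemma charFunDual_map {L : StrongDual ℝ E} {z : E} (hL : ∀ x, L x = (inner ℂ z x).re) :
    charFunDual (P.map X) L = Complex.exp (-(((inner ℂ z (S z)).re / 4 : ℝ) : ℂ)) := by
  rw [hX.gaussian.charFunDual_map_eq_fun]
  simp_rw [hL]
  rw [hX.integral_re_inner, hX.variance_re_inner]
  congr 1; push_cast; ring

/-- The law of a circular Gaussian vector is determined by its covariance operator. -/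
lemma map_eq {Ω' : Type*} [MeasurableSpace Ω'] {P' : Measure Ω'} {Y : Ω' → E}
    (hY : IsCircular P' Y S) : P.map X = P'.map Y := by
  have := FiniteDimensional.complete ℂ E
  have := hX.gaussian.isGaussian_map
  have := hY.gaussian.isGaussian_map
  refine Measure.ext_of_charFunDual (funext fun L => ?_)
  obtain ⟨z, hz⟩ := exists_re_inner_eq L
  rw [hX.charFunDual_map hz, hY.charFunDual_map hz]

variable {v : ℝ} (hW : IsCircular P X (v • 1))
omit hX
include hW

lemma charFunDual_map_white {L : StrongDual ℝ E} {z : E} (hL : ∀ x, L x = (inner ℂ z x).re) :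
    charFunDual (P.map X) L = Complex.exp (-((v / 4 * ‖z‖ ^ 2 : ℝ) : ℂ)) := by
  rw [hW.charFunDual_map hL]
  congr 3
  rw [smul_apply, one_apply_eq_self, re_inner_real_smul,
    show (inner ℂ z z).re = ‖z‖ ^ 2 from inner_self_eq_norm_sq (𝕜 := ℂ) z]
  ring

lemma integral_norm_inner_sq (z : E) : ∫ ω, ‖inner ℂ z (X ω)‖ ^ 2 ∂P = v * ‖z‖ ^ 2 := by
  have e : ∀ ω, ‖inner ℂ z (X ω)‖ ^ 2 = (inner ℂ z (X ω) * inner ℂ (X ω) z).re := by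
    intro ω
    rw [← inner_conj_symm (X ω) z, Complex.mul_conj, Complex.normSq_eq_norm_sq, Complex.ofReal_re]
  simp_rw [e]
  have h := integral_re (hW.integrable_inner_mul_inner' z z)
  simp only [RCLike.re_eq_complex_re] at h
  rw [h, hW.cov, smul_apply, one_apply_eq_self,
    re_inner_real_smul, inner_self_eq_norm_sq_to_K]
  norm_cast

/-- The law of circular white noise is isotropic. -/
lemma isIsotropic (hv : 0 < v) (hpos : 0 < Module.finrank ℂ E) : IsIsotropic (P.map X) v where
  prob := by
    have := hW.isProbabilityMeasure
    exact Measure.isProbabilityMeasure_map hW.gaussian.aemeasurable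
  integrable := by
    rw [integrable_map_measure (by fun_prop) hW.gaussian.aemeasurable]
    exact (hW.memLp (r := 2) (by simp)).integrable_norm_pow (by simp)
  second z := by
    rw [integral_map hW.gaussian.aemeasurable (by fun_prop)]
    exact hW.integral_norm_inner_sq z
  unitary U := by
    refine ⟨U.continuous.measurable, ?_⟩
    have := FiniteDimensional.complete ℂ E
    have := hW.gaussian.isGaussian_map
    have hU : (U : E → E)
        = (U.toContinuousLinearEquiv : E →L[ℂ] E).restrictScalars ℝ := rfl
    have hm : Measurable U := U.continuous.measurable
    have := Measure.isProbabilityMeasure_map (μ := P.map X) hm.aemeasurable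
    refine Measure.ext_of_charFunDual (funext fun L => ?_)
    obtain ⟨z, hz⟩ := exists_re_inner_eq L
    rw [hW.charFunDual_map_white hz, hU, MeasureTheory.charFunDual_map,
      hW.charFunDual_map_white (z := U.symm z), LinearIsometryEquiv.norm_map]
    intro x
    simp [hz, LinearIsometryEquiv.inner_map_eq_flip]
  unbounded ρ := by
    obtain ⟨z, hz⟩ : ∃ z : E, ‖z‖ = 1 := ⟨stdOrthonormalBasis ℂ E ⟨0, hpos⟩,
      OrthonormalBasis.norm_eq_one _ _⟩
    have hg : HasGaussianLaw (fun ω => (inner ℂ z (X ω)).re) P :=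
      hW.gaussian.map_fun (Complex.reCLM ∘L (innerSL ℂ z).restrictScalars ℝ)
    have hvar : Var[fun ω => (inner ℂ z (X ω)).re; P] = v / 2 := by
      rw [hW.variance_re_inner, smul_apply, one_apply_eq_self,
        re_inner_real_smul, inner_self_eq_norm_sq_to_K, hz]
      simp
    have hmap := hg.map_eq_gaussianReal
    rw [hvar] at hmap
    have hne : (v / 2).toNNReal ≠ 0 := by simpa using hv
    have h1 : P.map (fun ω => (inner ℂ z (X ω)).re) (Set.Ici (√|ρ|)) ≠ 0 := fun h0 => by
      rw [hmap] at h0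
      have := gaussianReal_absolutelyContinuous' _ hne h0
      simp at this
    rw [Measure.map_apply_of_aemeasurable hg.aemeasurable measurableSet_Ici] at h1
    rw [Measure.map_apply_of_aemeasurable hW.gaussian.aemeasurable
      (measurableSet_le measurable_const (by fun_prop))]
    refine fun h0 => h1 (measure_mono_null (fun ω hω => ?_) h0)
    simp only [Set.mem_preimage, Set.mem_Ici, Set.mem_ofPred_eq] at hω ⊢
    have h2 : (inner ℂ z (X ω)).re ≤ ‖X ω‖ := by
      refine (Complex.re_le_norm _).trans ((norm_inner_le_norm _ _).trans ?_)
      rw [hz, one_mul]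
    calc ρ ≤ |ρ| := le_abs_self ρ
      _ = √|ρ| ^ 2 := (Real.sq_sqrt (abs_nonneg ρ)).symm
      _ ≤ ‖X ω‖ ^ 2 := by gcongr; exact hω.trans h2

/-- Circular white noise remains an independent family under unitary mixing of the samples. -/
lemma measurePreserving_mix {N : ℕ}
    (b : OrthonormalBasis (Fin N) ℂ (EuclideanSpace ℂ (Fin N))) :
    MeasurePreserving (fun w : Fin N → E => fun j => ∑ n, conj (b j n) • w n)
      (Measure.pi fun _ => P.map X) (Measure.pi fun _ => P.map X) := by
  have hc : Continuous (fun w : Fin N → E => fun j => ∑ n, conj (b j n) • w n) := by fun_prop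
  refine ⟨hc.measurable, ?_⟩
  have := FiniteDimensional.complete ℂ E
  have := hW.gaussian.isGaussian_map
  have := hW.isProbabilityMeasure
  have := Measure.isProbabilityMeasure_map (μ := P) hW.gaussian.aemeasurable
  have := Measure.isProbabilityMeasure_map (μ := Measure.pi fun _ : Fin N => P.map X)
    hc.measurable.aemeasurable
  let Φ : (Fin N → E) →L[ℝ] (Fin N → E) :=
    ContinuousLinearMap.pi fun j => ∑ n, (conj (b j n) • (ContinuousLinearMap.proj n :
      (Fin N → E) →L[ℂ] E)).restrictScalars ℝ
  have hΦ : (fun w : Fin N → E => fun j => ∑ n, conj (b j n) • w n) = Φ := by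
    ext w j; simp [Φ]
  refine Measure.ext_of_charFunDual (funext fun L => ?_)
  choose z hz using fun n => exists_re_inner_eq (L.comp (.single ℝ (fun _ : Fin N => E) n))
  have hL : ∀ w, L w = ∑ j, (inner ℂ (z j) (w j)).re := by
    intro w
    rw [← ContinuousLinearMap.sum_comp_single (L := L) (v := w)]
    exact Finset.sum_congr rfl fun j _ => hz j (w j)
  rw [hΦ, MeasureTheory.charFunDual_map, charFunDual_pi, charFunDual_pi]
  have e1 : ∀ n x, ((L.comp Φ).comp (.single ℝ (fun _ : Fin N => E) n)) x
      = (inner ℂ (∑ j, b j n • z j) x).re := by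
    intro n x
    simp only [ContinuousLinearMap.comp_apply, hL, sum_inner, Complex.re_sum]
    refine Finset.sum_congr rfl fun j _ => ?_
    have : Φ (ContinuousLinearMap.single ℝ (fun _ : Fin N => E) n x) j = conj (b j n) • x := by
      rw [← hΦ]
      simp [Pi.single_apply]
    rw [this, inner_smul_left, inner_smul_right]
  rw [Finset.prod_congr rfl fun n _ => hW.charFunDual_map_white (e1 n),
    Finset.prod_congr rfl fun n _ => hW.charFunDual_map_white (hz n),
    ← Complex.exp_sum, ← Complex.exp_sum, Finset.sum_neg_distrib, Finset.sum_neg_distrib]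
  congr 2
  norm_cast
  rw [← Finset.mul_sum, ← Finset.mul_sum]
  congr 1
  have hb : ∀ i j, ∑ n, conj (b i n) * b j n = if i = j then 1 else 0 := by
    intro i j
    rw [← orthonormal_iff_ite.1 b.orthonormal i j, PiLp.inner_apply]
    simp [mul_comm]
  have e2 : ((∑ n, ‖∑ j, b j n • z j‖ ^ 2 : ℝ) : ℂ) = ((∑ j, ‖z j‖ ^ 2 : ℝ) : ℂ) := by
    push_cast
    have : ∀ y : E, ((‖y‖ : ℂ)) ^ 2 = inner ℂ y y := fun y => by
      rw [inner_self_eq_norm_sq_to_K]; simp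
    simp_rw [this, sum_inner, inner_sum, inner_smul_left, inner_smul_right]
    rw [Finset.sum_comm]
    refine Finset.sum_congr rfl fun i _ => ?_
    rw [Finset.sum_comm]
    simp_rw [← mul_assoc, ← Finset.sum_mul, hb]
    simp
  exact_mod_cast e2

end IsCircular

end Circular

/-! ### The blocks of a spiked Gaussian sample covariance -/

section SpikedSample

variable {F : Type*} [NormedAddCommGroup F] [InnerProductSpace ℂ F]

lemma compress_gram (u : F) {N : ℕ} (x : Fin N → F) :
    compress u (gram x) = gram fun n => toPerp u (x n) := by
  ext y
  simp [compress, gram]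

lemma cross_gram (u : F) {N : ℕ} (x : Fin N → F) :
    cross u (gram x) = ∑ n, conj (inner ℂ u (x n)) • toPerp u (x n) := by
  simp [cross, gram]

lemma corner_gram (u : F) {N : ℕ} (x : Fin N → F) :
    corner u (gram x) = ∑ n, ‖inner ℂ u (x n)‖ ^ 2 := by
  rw [corner, inner_gram, Complex.re_sum]
  refine Finset.sum_congr rfl fun n _ => ?_
  rw [← inner_conj_symm (x n) u, Complex.mul_conj, Complex.normSq_eq_norm_sq, Complex.ofReal_re]

/-- The Schur-type operator of the sample covariance. Dividing by the corner makes it homogeneous of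
degree one in the Gram operator. -/
lemma schur_smul_gram (u : F) {N : ℕ} (hN : N ≠ 0) (x : Fin N → F) (t : ℝ) :
    schur u ((N : ℝ)⁻¹ • gram x) t = (N : ℝ)⁻¹ • (gram (fun n => toPerp u (x n))
      + (t / ∑ n, ‖inner ℂ u (x n)‖ ^ 2) • rankOne ℂ
          (∑ n, conj (inner ℂ u (x n)) • toPerp u (x n))
          (∑ n, conj (inner ℂ u (x n)) • toPerp u (x n))) := by
  have e1 : compress u ((N : ℝ)⁻¹ • gram x) = (N : ℝ)⁻¹ • compress u (gram x) := by
    ext y; simp [compress, ← Complex.coe_smul]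
  have e2 : cross u ((N : ℝ)⁻¹ • gram x) = (N : ℝ)⁻¹ • cross u (gram x) := by
    simp [cross, ← Complex.coe_smul]
  have e3 : corner u ((N : ℝ)⁻¹ • gram x) = (N : ℝ)⁻¹ * corner u (gram x) := by
    rw [corner, smul_apply, re_inner_real_smul, corner]
  rw [schur, e1, e2, e3, compress_gram, cross_gram, corner_gram, smul_add]
  congr 1
  set c := ∑ n, conj (inner ℂ u (x n)) • toPerp u (x n)
  set S := ∑ n, ‖inner ℂ u (x n)‖ ^ 2
  have e4 : rankOne ℂ ((N : ℝ)⁻¹ • c) ((N : ℝ)⁻¹ • c) = ((N : ℝ)⁻¹ * (N : ℝ)⁻¹) • rankOne ℂ c c := by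
    ext y
    simp [← Complex.coe_smul, smul_smul]
  rw [e4, smul_smul, smul_smul]
  congr 1
  have : (N : ℝ) ≠ 0 := by exact_mod_cast hN
  by_cases hS : S = 0
  · simp [hS]
  · field_simp

variable [MeasurableSpace F] [BorelSpace F] [FiniteDimensional ℂ F] [SecondCountableTopology F]
  {Ω : Type*} [MeasurableSpace Ω] {P : Measure Ω} {X : Ω → F} {u : F} {δ v : ℝ}

namespace IsCircular

omit [FiniteDimensional ℂ F] [SecondCountableTopology F] in
lemma toPerp_spike (hX : IsCircular P X (spike u δ v)) :
    IsCircular P (fun ω => toPerp u (X ω)) (v • (1 : Perp u →L[ℂ] Perp u)) where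
  gaussian := hX.gaussian.map_fun ((toPerp u).restrictScalars ℝ)
  mean y := by simp_rw [inner_toPerp]; exact hX.mean _
  cov y z := by
    have e : ∀ ω, inner ℂ (toPerp u (X ω)) z = inner ℂ (X ω) (z : F) := fun ω => by
      rw [← inner_conj_symm, inner_toPerp, inner_conj_symm]
    simp_rw [inner_toPerp, e]
    rw [hX.cov, spike_apply, inner_perp, mul_zero, zero_smul, zero_add, smul_apply,
      one_apply_eq_self, ← Complex.coe_smul, inner_smul_right, inner_smul_right]
    rfl
  pseudo y z := by simp_rw [inner_toPerp]; exact hX.pseudo _ _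

/-- As `u` is an eigenvector of the covariance, the components along `u` and orthogonal to it are
uncorrelated, hence independent. -/
lemma indepFun_inner_toPerp (hX : IsCircular P X (spike u δ v)) :
    IndepFun (fun ω => inner ℂ u (X ω)) (fun ω => toPerp u (X ω)) P := by
  have hG : HasGaussianLaw (fun ω => (inner ℂ u (X ω), toPerp u (X ω))) P :=
    hX.gaussian.map_fun (((innerSL ℂ u).restrictScalars ℝ).prod ((toPerp u).restrictScalars ℝ))
  have := hX.isProbabilityMeasure
  refine hG.indepFun_of_covariance_strongDual fun L₁ L₂ => ?_
  obtain ⟨z, hz⟩ := exists_re_inner_eq L₁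
  obtain ⟨y, hy⟩ := exists_re_inner_eq L₂
  have e1 : L₁ ∘ (fun ω => inner ℂ u (X ω)) = fun ω => (inner ℂ (z • u) (X ω)).re := by
    ext ω; simp [hz]
  have e2 : L₂ ∘ (fun ω => toPerp u (X ω)) = fun ω => (inner ℂ (y : F) (X ω)).re := by
    ext ω; rw [Function.comp_apply, hy, inner_toPerp]
  rw [e1, e2, covariance_eq_sub (hX.memLp_re_inner _ (by simp)) (hX.memLp_re_inner _ (by simp)),
    hX.integral_re_inner, hX.integral_re_inner]
  simp only [Pi.mul_apply]
  rw [hX.integral_re_mul_re, spike_apply, inner_perp]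
  simp [inner_perp]

omit [BorelSpace F] [FiniteDimensional ℂ F] [SecondCountableTopology F] in
lemma integral_norm_inner_spike_sq (hX : IsCircular P X (spike u δ v)) (hu : ‖u‖ = 1) :
    ∫ ω, ‖inner ℂ u (X ω)‖ ^ 2 ∂P = δ + v := by
  have e : ∀ ω, ((‖inner ℂ u (X ω)‖ ^ 2 : ℝ) : ℂ) = inner ℂ u (X ω) * inner ℂ (X ω) u := by
    intro ω
    rw [← inner_conj_symm (X ω) u, Complex.mul_conj, Complex.normSq_eq_norm_sq]
  have h := hX.cov u u
  simp_rw [← e] at h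
  rw [integral_complex_ofReal, spike_apply, inner_add_right, inner_smul_right, inner_smul_right,
    inner_self_eq_norm_sq_to_K, hu] at h
  simp only [RCLike.ofReal_one, one_pow, mul_one] at h
  exact_mod_cast h

lemma ae_inner_ne_zero (hX : IsCircular P X (spike u δ v)) (hu : ‖u‖ = 1) (h : 0 < δ + v) :
    ∀ᵐ ω ∂P, inner ℂ u (X ω) ≠ 0 := by
  have hg : HasGaussianLaw (fun ω => (inner ℂ u (X ω)).re) P :=
    hX.gaussian.map_fun (Complex.reCLM ∘L (innerSL ℂ u).restrictScalars ℝ)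
  have hvar : Var[fun ω => (inner ℂ u (X ω)).re; P] = (δ + v) / 2 := by
    rw [hX.variance_re_inner, IsEigensystem.re_inner_spike, inner_self_eq_norm_sq_to_K, hu]
    simp
  have hmap := hg.map_eq_gaussianReal
  rw [hvar] at hmap
  have hne : ((δ + v) / 2).toNNReal ≠ 0 := by simpa using h
  have := nullSingletonClass_gaussianReal (μ := P[fun ω => (inner ℂ u (X ω)).re]) hne
  have h0 : P.map (fun ω => (inner ℂ u (X ω)).re) {0} = 0 := by
    rw [hmap]; exact measure_singleton 0
  rw [Measure.map_apply_of_aemeasurable hg.aemeasurable (measurableSet_singleton 0)] at h0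
  refine measure_mono_null (fun ω hω => ?_) h0
  simp only [ne_eq, not_not, Set.mem_compl_iff, Set.mem_ofPred_eq] at hω
  simp [hω]

end IsCircular

/-- Gram operators are invariant under unitary mixing of the samples. -/
lemma gram_mix {E : Type*} [NormedAddCommGroup E] [InnerProductSpace ℂ E] {N : ℕ}
    (b : OrthonormalBasis (Fin N) ℂ (EuclideanSpace ℂ (Fin N))) (w : Fin N → E) :
    gram (fun j => ∑ n, conj (b j n) • w n) = gram w := by
  have hb : ∀ n m, ∑ j, b j m * conj (b j n) = if n = m then 1 else 0 := by
    intro n m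
    have := b.sum_inner_mul_inner (EuclideanSpace.single m 1) (EuclideanSpace.single n 1)
    simpa [EuclideanSpace.inner_single_left, EuclideanSpace.inner_single_right, Pi.single_apply,
      eq_comm] using this
  refine ContinuousLinearMap.ext fun y => ?_
  refine ext_inner_left ℂ fun z => ?_
  rw [inner_gram, inner_gram]
  simp_rw [inner_sum, sum_inner, inner_smul_left, inner_smul_right, Finset.sum_mul, Finset.mul_sum]
  rw [Finset.sum_comm]
  refine Finset.sum_congr rfl fun n _ => ?_
  rw [Finset.sum_comm]
  have : ∀ m j, conj (b j n) * inner ℂ z (w n) * (conj (conj (b j m)) * inner ℂ (w m) y)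
      = (b j m * conj (b j n)) * (inner ℂ z (w n) * inner ℂ (w m) y) := by
    intro m j; rw [Complex.conj_conj]; ring
  simp_rw [this, ← Finset.sum_mul, hb]
  simp

/-- Against independent white noise, a deterministic combination of the samples has the same joint
law with the Gram operator as a multiple of a single sample: rotate the sample index. -/
lemma IsCircular.integral_combination {E : Type*} [NormedAddCommGroup E] [InnerProductSpace ℂ E]
    [MeasurableSpace E] [BorelSpace E] [FiniteDimensional ℂ E] [SecondCountableTopology E]
    {W : Ω → E} (hW : IsCircular P W (v • 1)) {N : ℕ} (s : Fin (N + 1) → ℂ)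
    {G : Type*} [NormedAddCommGroup G] [NormedSpace ℝ G] (f : (E →L[ℂ] E) → E → G)
    (hf : Continuous fun q : (E →L[ℂ] E) × E => f q.1 q.2) :
    ∫ w : Fin (N + 1) → E, f (gram w) (∑ n, conj (s n) • w n) ∂(Measure.pi fun _ => P.map W)
      = ∫ w : Fin (N + 1) → E, f (gram w) (√(∑ n, ‖s n‖ ^ 2) • w 0)
          ∂(Measure.pi fun _ => P.map W) := by
  rcases eq_or_ne s 0 with rfl | hs
  · simp
  set e : EuclideanSpace ℂ (Fin (N + 1)) := WithLp.toLp 2 s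
  have hnorm : ‖e‖ = √(∑ n, ‖s n‖ ^ 2) := EuclideanSpace.norm_eq e
  have hpos : 0 < ‖e‖ := by
    rw [norm_pos_iff]
    intro h
    exact hs (by simpa [e] using h)
  obtain ⟨b, hb⟩ := Orthonormal.exists_orthonormalBasis_extension_of_card_eq (𝕜 := ℂ)
    (ι := Fin (N + 1)) (E := EuclideanSpace ℂ (Fin (N + 1))) (by simp)
    (v := fun _ => ((‖e‖⁻¹ : ℝ) : ℂ) • e) (s := {0})
    ⟨fun _ => by
        change ‖((‖e‖⁻¹ : ℝ) : ℂ) • e‖ = 1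
        rw [norm_smul]; simp [hpos.ne'],
      fun i j hij => absurd (Subsingleton.elim i j) hij⟩
  have hb0 : ∀ n, b 0 n = ((‖e‖⁻¹ : ℝ) : ℂ) * s n := fun n => by
    rw [hb 0 rfl]; rfl
  have hm := hW.measurePreserving_mix b
  have hc : Continuous fun w : Fin (N + 1) → E => f (gram w) (√(∑ n, ‖s n‖ ^ 2) • w 0) :=
    hf.comp (continuous_gram.prodMk (by fun_prop))
  symm
  calc _ = ∫ w : Fin (N + 1) → E, f (gram w) (√(∑ n, ‖s n‖ ^ 2) • w 0)
          ∂((Measure.pi fun _ => P.map W).map fun w j => ∑ n, conj (b j n) • w n) := by rw [hm.map_eq]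
    _ = _ := integral_map hm.measurable.aemeasurable hc.aestronglyMeasurable
    _ = _ := by
      refine integral_congr_ae (ae_of_all _ fun w => ?_)
      simp only [gram_mix, hb0, ← hnorm]
      congr 1
      rw [Finset.smul_sum]
      refine Finset.sum_congr rfl fun n _ => ?_
      rw [← Complex.coe_smul, smul_smul]
      congr 1
      have : (‖e‖ : ℂ) ≠ 0 := by exact_mod_cast hpos.ne'
      rw [map_mul, Complex.conj_ofReal, Complex.ofReal_inv, mul_inv_cancel_left₀ this]

/-- The joint law of the spike components and the noise components of independent samples. -/
lemma IsCircular.map_samples {x : ℕ → Ω → F} (hind : iIndepFun x P)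
    (hx : ∀ n, IsCircular P (x n) (spike u δ v)) (N : ℕ) :
    P.map (fun ω => ((fun n : Fin N => inner ℂ u (x n ω)), fun n : Fin N => toPerp u (x n ω)))
      = (Measure.pi fun _ => P.map fun ω => inner ℂ u (x 0 ω)).prod
          (Measure.pi fun _ => P.map fun ω => toPerp u (x 0 ω)) := by
  have hm : ∀ n, AEMeasurable (x n) P := fun n => (hx n).gaussian.aemeasurable
  have := (hx 0).isProbabilityMeasure
  have h1 : iIndepFun (fun n : Fin N => x n) P := hind.precomp Fin.val_injective
  have h2 := (iIndepFun_iff_map_fun_eq_pi_map fun n : Fin N => hm n).1 h1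
  have h3 : (fun n : Fin N => P.map (x n)) = fun _ => P.map (x 0) :=
    funext fun n => (hx n).map_eq (hx 0)
  rw [h3] at h2
  have h4 := (indepFun_iff_map_prod_eq_prod_map_map (by fun_prop) (by fun_prop)).1
    (hx 0).indepFun_inner_toPerp
  have p1 := Measure.isProbabilityMeasure_map (μ := P) (f := fun ω => inner ℂ u (x 0 ω)) (by fun_prop)
  have p2 := Measure.isProbabilityMeasure_map (μ := P) (f := fun ω => toPerp u (x 0 ω)) (by fun_prop)
  have p3 := Measure.isProbabilityMeasure_map (μ := P) (hm 0)
  have h5 := (measurePreserving_arrowProdEquivProdArrow ℂ (Perp u) (Fin N)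
    (fun _ => P.map fun ω => inner ℂ u (x 0 ω)) (fun _ => P.map fun ω => toPerp u (x 0 ω))).map_eq
  rw [← h5, ← h4]
  have h6 := Measure.pi_map_pi (ι := Fin N) (μ := fun _ => P.map (x 0))
    (f := fun _ y => (inner ℂ u y, toPerp u y))
    (hμ := fun _ => by
      have := Measure.isProbabilityMeasure_map (μ := P.map (x 0))
        (f := fun y => (inner ℂ u y, toPerp u y)) (by fun_prop)
      infer_instance) fun _ => by fun_prop
  have h7 : (P.map (x 0)).map (fun y => (inner ℂ u y, toPerp u y))
      = P.map fun ω => (inner ℂ u (x 0 ω), toPerp u (x 0 ω)) :=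
    AEMeasurable.map_map_of_aemeasurable (by fun_prop) (hm 0)
  simp_rw [h7] at h6
  have h8 := (MeasurableEquiv.arrowProdEquivProdArrow ℂ (Perp u) (Fin N)).measurable
  rw [← h6, ← h2, AEMeasurable.map_map_of_aemeasurable h8.aemeasurable (by fun_prop),
    AEMeasurable.map_map_of_aemeasurable (h8.comp_aemeasurable (by fun_prop)) (by fun_prop)]
  rfl

lemma continuous_add_smul_rankOne {E : Type*} [NormedAddCommGroup E] [InnerProductSpace ℂ E]
    (c : ℝ) : Continuous fun q : (E →L[ℂ] E) × E => q.1 + c • rankOne ℂ q.2 q.2 := by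
  have h : Continuous fun q : (E →L[ℂ] E) × E => rankOne ℂ q.2 q.2 :=
    continuous_rankOne_self.comp continuous_snd
  exact continuous_fst.add (h.const_smul c)

lemma norm_combination_sq_le {E : Type*} [NormedAddCommGroup E] [InnerProductSpace ℂ E] {N : ℕ}
    (s : Fin N → ℂ) (w : Fin N → E) :
    ‖∑ n, conj (s n) • w n‖ ^ 2 ≤ (∑ n, ‖s n‖ ^ 2) * ∑ n, ‖w n‖ ^ 2 := by
  refine le_trans ?_ (Finset.sum_mul_sq_le_sq_mul_sq Finset.univ (fun n => ‖s n‖) fun n => ‖w n‖)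
  gcongr
  refine (norm_sum_le _ _).trans (le_of_eq (Finset.sum_congr rfl fun n _ => ?_))
  rw [norm_smul, RCLike.norm_conj]

namespace IsCircular

variable {x : ℕ → Ω → F} (hind : iIndepFun x P) (hx : ∀ n, IsCircular P (x n) (spike u δ v))
include hind hx

lemma integrable_samples {N : ℕ} {G : Type*} [NormedAddCommGroup G]
    {f : (Fin N → ℂ) → (Fin N → Perp u) → G}
    (hint : Integrable (fun q : (Fin N → ℂ) × (Fin N → Perp u) => f q.1 q.2)
      ((Measure.pi fun _ => P.map fun ω => inner ℂ u (x 0 ω)).prod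
          (Measure.pi fun _ => P.map fun ω => toPerp u (x 0 ω)))) :
    Integrable (fun ω => f (fun n : Fin N => inner ℂ u (x n ω))
      (fun n : Fin N => toPerp u (x n ω))) P := by
  have hm : ∀ n, AEMeasurable (x n) P := fun n => (hx n).gaussian.aemeasurable
  rw [← map_samples hind hx N] at hint
  exact hint.comp_aemeasurable (by fun_prop)

/-- Expectations of functions of the blocks: given the spike components, the off-diagonal block may
be replaced by a multiple of a single noise vector. -/
lemma integral_samples {N : ℕ} {G : Type*} [NormedAddCommGroup G] [NormedSpace ℝ G]
    (f : ℝ → (Perp u →L[ℂ] Perp u) → Perp u → G)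
    (hf : ∀ S, Continuous fun q : (Perp u →L[ℂ] Perp u) × Perp u => f S q.1 q.2)
    (hint : Integrable (fun q : (Fin (N + 1) → ℂ) × (Fin (N + 1) → Perp u) =>
        f (∑ n, ‖q.1 n‖ ^ 2) (gram q.2) (∑ n, conj (q.1 n) • q.2 n))
      ((Measure.pi fun _ => P.map fun ω => inner ℂ u (x 0 ω)).prod
          (Measure.pi fun _ => P.map fun ω => toPerp u (x 0 ω)))) :
    ∫ ω, f (∑ n : Fin (N + 1), ‖inner ℂ u (x n ω)‖ ^ 2) (gram fun n : Fin (N + 1) => toPerp u (x n ω))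
        (∑ n : Fin (N + 1), conj (inner ℂ u (x n ω)) • toPerp u (x n ω)) ∂P
      = ∫ s : Fin (N + 1) → ℂ, ∫ w : Fin (N + 1) → Perp u,
          f (∑ n, ‖s n‖ ^ 2) (gram w) (√(∑ n, ‖s n‖ ^ 2) • w 0)
            ∂(Measure.pi fun _ => P.map fun ω => toPerp u (x 0 ω))
            ∂(Measure.pi fun _ => P.map fun ω => inner ℂ u (x 0 ω)) := by
  have hm : ∀ n, AEMeasurable (x n) P := fun n => (hx n).gaussian.aemeasurable
  have := (hx 0).isProbabilityMeasure
  have p1 := Measure.isProbabilityMeasure_map (μ := P) (f := fun ω => inner ℂ u (x 0 ω)) (by fun_prop)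
  have p2 := Measure.isProbabilityMeasure_map (μ := P) (f := fun ω => toPerp u (x 0 ω)) (by fun_prop)
  have hmap := map_samples hind hx (N + 1)
  have h1 := integral_map (μ := P)
    (φ := fun ω => ((fun n : Fin (N + 1) => inner ℂ u (x n ω)),
      fun n : Fin (N + 1) => toPerp u (x n ω))) (by fun_prop)
    (by rw [hmap]; exact hint.aestronglyMeasurable)
  rw [hmap, integral_prod _ hint] at h1
  rw [← h1]
  refine integral_congr_ae (ae_of_all _ fun s => ?_)
  exact (hx 0).toPerp_spike.integral_combination s (f (∑ n, ‖s n‖ ^ 2)) (hf _)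

omit hind in
lemma integrable_topSum_combination (hv : 0 < v)
    (hpos : 0 < Module.finrank ℂ (Perp u)) {k : ℕ} (hk : k ≤ Module.finrank ℂ (Perp u))
    (N : ℕ) (t : ℝ) :
    Integrable (fun q : (Fin N → ℂ) × (Fin N → Perp u) =>
        topSum k (gram q.2 + (t / ∑ n, ‖q.1 n‖ ^ 2) •
          rankOne ℂ (∑ n, conj (q.1 n) • q.2 n) (∑ n, conj (q.1 n) • q.2 n)))
      ((Measure.pi fun _ => P.map fun ω => inner ℂ u (x 0 ω)).prod
          (Measure.pi fun _ => P.map fun ω => toPerp u (x 0 ω))) := by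
  have hm : ∀ n, AEMeasurable (x n) P := fun n => (hx n).gaussian.aemeasurable
  have := (hx 0).isProbabilityMeasure
  have p1 := Measure.isProbabilityMeasure_map (μ := P) (f := fun ω => inner ℂ u (x 0 ω)) (by fun_prop)
  have hν := (hx 0).toPerp_spike.isIsotropic hv hpos
  have p2 := hν.prob
  refine Integrable.mono' (g := fun q => k * ((1 + |t|) * ∑ n, ‖q.2 n‖ ^ 2))
    ((((hν.integrable_sum_sq (N)).const_mul _).const_mul _).comp_snd _) ?_
    (ae_of_all _ fun q => ?_)
  · have h1 : Measurable fun q : (Fin (N) → ℂ) × (Fin (N) → Perp u) =>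
        t / ∑ n, ‖q.1 n‖ ^ 2 := by fun_prop
    have h2 : Continuous fun q : (Fin (N) → ℂ) × (Fin (N) → Perp u) =>
        rankOne ℂ (∑ n, conj (q.1 n) • q.2 n) (∑ n, conj (q.1 n) • q.2 n) :=
      continuous_rankOne_self.comp
        (f := fun q : (Fin (N) → ℂ) × (Fin (N) → Perp u) => ∑ n, conj (q.1 n) • q.2 n)
        (by fun_prop)
    have h3 := h1.aestronglyMeasurable.fun_smul (h2.aestronglyMeasurable (μ :=
      ((Measure.pi fun _ => P.map fun ω => inner ℂ u (x 0 ω)).prod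
        (Measure.pi fun _ => P.map fun ω => toPerp u (x 0 ω)))))
    exact (continuous_topSum hk).comp_aestronglyMeasurable
      ((continuous_gram.comp continuous_snd).aestronglyMeasurable.add h3)
  · refine (abs_topSum_le hk _).trans ?_
    gcongr
    refine (norm_add_le _ _).trans ?_
    rw [add_mul, one_mul]
    refine add_le_add (norm_gram_le _) ?_
    rw [norm_smul, InnerProductSpace.norm_rankOne, ← sq, Real.norm_eq_abs, abs_div]
    have h0 : 0 ≤ ∑ n, ‖q.1 n‖ ^ 2 := Finset.sum_nonneg fun _ _ => sq_nonneg _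
    have h1 : 0 ≤ ∑ n, ‖q.2 n‖ ^ 2 := Finset.sum_nonneg fun _ _ => sq_nonneg _
    have h2 := norm_combination_sq_le q.1 q.2
    rw [abs_of_nonneg h0]
    generalize (∑ n, ‖q.1 n‖ ^ 2) = S at *
    generalize (∑ n, ‖q.2 n‖ ^ 2) = T at *
    generalize ‖∑ n, conj (q.1 n) • q.2 n‖ ^ 2 = c at *
    rcases h0.eq_or_lt with h | h
    · rw [← h, div_zero, zero_mul]; positivity
    · calc |t| / S * c ≤ |t| / S * (S * T) := by gcongr
        _ = |t| * T := by field_simp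

lemma integrable_topSum_schur (hv : 0 < v)
    (hpos : 0 < Module.finrank ℂ (Perp u)) {k : ℕ} (hk : k ≤ Module.finrank ℂ (Perp u))
    {N : ℕ} (hN : N ≠ 0) (t : ℝ) :
    Integrable (fun ω => topSum k (schur u ((N : ℝ)⁻¹ • gram fun n : Fin N => x n ω) t)) P := by
  simp_rw [schur_smul_gram u hN, topSum_smul (inv_nonneg.2 (Nat.cast_nonneg _))]
  have h := integrable_samples hind hx (f := fun s w => topSum k (gram w +
    (t / ∑ n, ‖s n‖ ^ 2) • rankOne ℂ (∑ n, conj (s n) • w n) (∑ n, conj (s n) • w n)))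
    (integrable_topSum_combination hx hv hpos hk N t)
  exact h.const_mul _

/-- The expected Ky Fan sum of the Schur-type operator of `N + 1` samples is that of the Gram operator
of `N` noise vectors with an additional independent rank-one sample, weighted by `1 + t`. -/
theorem integral_topSum_schur (hu : ‖u‖ = 1) (hδ : 0 ≤ δ) (hv : 0 < v)
    (hpos : 0 < Module.finrank ℂ (Perp u)) {k : ℕ} (hk : k ≤ Module.finrank ℂ (Perp u))
    (N : ℕ) (t : ℝ) :
    ∫ ω, topSum k (schur u (((N + 1 : ℕ) : ℝ)⁻¹ • gram fun n : Fin (N + 1) => x n ω) t) ∂P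
      = ((N + 1 : ℕ) : ℝ)⁻¹ * meanTopRankOne (P.map fun ω => toPerp u (x 0 ω)) k N (1 + t) := by
  have hm : ∀ n, AEMeasurable (x n) P := fun n => (hx n).gaussian.aemeasurable
  have := (hx 0).isProbabilityMeasure
  have p1 := Measure.isProbabilityMeasure_map (μ := P) (f := fun ω => inner ℂ u (x 0 ω)) (by fun_prop)
  have hν := (hx 0).toPerp_spike.isIsotropic hv hpos
  have p2 := hν.prob
  simp_rw [schur_smul_gram u (Nat.succ_ne_zero N), topSum_smul (inv_nonneg.2 (Nat.cast_nonneg _))]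
  rw [integral_const_mul]
  congr 1
  rw [integral_samples hind hx (fun S M c => topSum k (M + (t / S) • rankOne ℂ c c))]
  · rw [← hν.integral_topSum_reweight hk N 0 t]
    have hne : ∀ᵐ s : Fin (N + 1) → ℂ ∂(Measure.pi fun _ => P.map fun ω => inner ℂ u (x 0 ω)),
        s 0 ≠ 0 := by
      refine (Measure.quasiMeasurePreserving_eval _ 0).ae (p := fun z => z ≠ 0) ?_
      refine (ae_map_iff (f := fun ω => inner ℂ u (x 0 ω)) (by fun_prop)
        (measurableSet_singleton 0).compl).2 ?_
      exact (hx 0).ae_inner_ne_zero hu (by linarith)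
    have key : ∀ᵐ s : Fin (N + 1) → ℂ ∂(Measure.pi fun _ => P.map fun ω => inner ℂ u (x 0 ω)),
        ∫ w : Fin (N + 1) → Perp u, topSum k (gram w + (t / ∑ n, ‖s n‖ ^ 2) •
            rankOne ℂ (√(∑ n, ‖s n‖ ^ 2) • w 0) (√(∑ n, ‖s n‖ ^ 2) • w 0))
              ∂(Measure.pi fun _ => P.map fun ω => toPerp u (x 0 ω))
          = ∫ w : Fin (N + 1) → Perp u, topSum k (gram w + t • rankOne ℂ (w 0) (w 0))
              ∂(Measure.pi fun _ => P.map fun ω => toPerp u (x 0 ω)) := by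
      filter_upwards [hne] with s hs
      -- the random scalar `∑ n, ‖s n‖ ^ 2` cancels as soon as it is nonzero
      have hS : 0 < ∑ n, ‖s n‖ ^ 2 :=
        Finset.sum_pos' (fun _ _ => by positivity) ⟨0, Finset.mem_univ _, by positivity⟩
      refine integral_congr_ae (ae_of_all _ fun w => ?_)
      have : (t / ∑ n, ‖s n‖ ^ 2) • rankOne ℂ (√(∑ n, ‖s n‖ ^ 2) • w 0) (√(∑ n, ‖s n‖ ^ 2) • w 0)
          = t • rankOne ℂ (w 0) (w 0) := by
        have e : rankOne ℂ (√(∑ n, ‖s n‖ ^ 2) • w 0) (√(∑ n, ‖s n‖ ^ 2) • w 0)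
            = (∑ n, ‖s n‖ ^ 2) • rankOne ℂ (w 0) (w 0) := by
          conv_rhs => rw [← Real.mul_self_sqrt hS.le]
          refine ContinuousLinearMap.ext fun y => ?_
          simp [-Real.mul_self_sqrt, ← Complex.coe_smul, smul_smul]
        rw [e, smul_smul, div_mul_cancel₀ _ hS.ne']
      simp only [this]
    rw [integral_congr_ae key]
    simp
  · intro S
    exact (continuous_topSum hk).comp (continuous_add_smul_rankOne (t / S))
  · exact integrable_topSum_combination hx hv hpos hk (N + 1) t

/-- Second moments of the coupling vector between the spike direction and its complement. -/
theorem integral_inner_cross (hu : ‖u‖ = 1) (hv : 0 < v)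
    (hpos : 0 < Module.finrank ℂ (Perp u)) (N : ℕ) (y z : Perp u) :
    ∫ ω, inner ℂ y (cross u (((N + 1 : ℕ) : ℝ)⁻¹ • gram fun n : Fin (N + 1) => x n ω))
        * inner ℂ (cross u (((N + 1 : ℕ) : ℝ)⁻¹ • gram fun n : Fin (N + 1) => x n ω)) z ∂P
      = ((((N + 1 : ℕ) : ℝ)⁻¹ * ((δ + v) * v) : ℝ) : ℂ) * inner ℂ y z := by
  have hm : ∀ n, AEMeasurable (x n) P := fun n => (hx n).gaussian.aemeasurable
  have := (hx 0).isProbabilityMeasure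
  have p1 := Measure.isProbabilityMeasure_map (μ := P) (f := fun ω => inner ℂ u (x 0 ω)) (by fun_prop)
  have hν := (hx 0).toPerp_spike.isIsotropic hv hpos
  have p2 := hν.prob
  have hs2 : Integrable (fun s : ℂ => ‖s‖ ^ 2) (P.map fun ω => inner ℂ u (x 0 ω)) := by
    rw [integrable_map_measure (by fun_prop) (by fun_prop)]
    exact ((hx 0).memLp_inner u (r := 2) (by simp)).integrable_norm_pow (by simp)
  have e : ∀ ω, inner ℂ y (cross u (((N + 1 : ℕ) : ℝ)⁻¹ • gram fun n : Fin (N + 1) => x n ω))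
        * inner ℂ (cross u (((N + 1 : ℕ) : ℝ)⁻¹ • gram fun n : Fin (N + 1) => x n ω)) z
      = ((((N + 1 : ℕ) : ℝ)⁻¹ ^ 2 : ℝ) : ℂ)
        * (inner ℂ y (∑ n : Fin (N + 1), conj (inner ℂ u (x n ω)) • toPerp u (x n ω))
          * inner ℂ (∑ n : Fin (N + 1), conj (inner ℂ u (x n ω)) • toPerp u (x n ω)) z) := by
    intro ω
    have e2 : cross u (((N + 1 : ℕ) : ℝ)⁻¹ • gram fun n : Fin (N + 1) => x n ω)
        = ((((N + 1 : ℕ) : ℝ)⁻¹ : ℝ) : ℂ) • cross u (gram fun n : Fin (N + 1) => x n ω) := by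
      simp [cross, ← Complex.coe_smul]
    rw [e2, cross_gram, inner_smul_left, inner_smul_right, Complex.conj_ofReal]
    push_cast; ring
  simp_rw [e]
  rw [integral_const_mul,
    integral_samples hind hx (fun _ _ c => inner ℂ y c * inner ℂ c z)]
  · have e3 : ∀ s : Fin (N + 1) → ℂ, ∫ w : Fin (N + 1) → Perp u,
        inner ℂ y (√(∑ n, ‖s n‖ ^ 2) • w 0) * inner ℂ (√(∑ n, ‖s n‖ ^ 2) • w 0) z
          ∂(Measure.pi fun _ => P.map fun ω => toPerp u (x 0 ω))
        = ((∑ n, ‖s n‖ ^ 2 : ℝ) : ℂ) * (v * inner ℂ y z) := by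
      intro s
      have h0 : 0 ≤ ∑ n, ‖s n‖ ^ 2 := Finset.sum_nonneg fun _ _ => sq_nonneg _
      have e4 : ∀ w : Fin (N + 1) → Perp u,
          inner ℂ y (√(∑ n, ‖s n‖ ^ 2) • w 0) * inner ℂ (√(∑ n, ‖s n‖ ^ 2) • w 0) z
          = ((∑ n, ‖s n‖ ^ 2 : ℝ) : ℂ) * (inner ℂ y (w 0) * inner ℂ (w 0) z) := by
        intro w
        rw [← Complex.coe_smul, inner_smul_left, inner_smul_right, Complex.conj_ofReal]
        conv_rhs => rw [← Real.mul_self_sqrt h0, Complex.ofReal_mul]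
        ring
      simp_rw [e4]
      rw [integral_const_mul, integral_comp_eval (μ := fun _ : Fin (N + 1) =>
        P.map fun ω => toPerp u (x 0 ω)) (i := 0) (f := fun w => inner ℂ y w * inner ℂ w z)
        (Continuous.aestronglyMeasurable (by fun_prop)), integral_map (by fun_prop)
        (Continuous.aestronglyMeasurable (by fun_prop)), (hx 0).toPerp_spike.cov]
      congr 1
      rw [smul_apply, one_apply_eq_self, ← Complex.coe_smul, inner_smul_right]
    simp_rw [e3]
    rw [integral_mul_const, integral_complex_ofReal, integral_finsetSum _ fun n _ =>
      integrable_comp_eval (μ := fun _ : Fin (N + 1) => P.map fun ω => inner ℂ u (x 0 ω)) hs2]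
    have e5 : ∀ n : Fin (N + 1), ∫ s : Fin (N + 1) → ℂ, ‖s n‖ ^ 2
        ∂(Measure.pi fun _ => P.map fun ω => inner ℂ u (x 0 ω)) = δ + v := by
      intro n
      rw [integral_comp_eval (μ := fun _ : Fin (N + 1) => P.map fun ω => inner ℂ u (x 0 ω))
        (f := fun s : ℂ => ‖s‖ ^ 2) (Continuous.aestronglyMeasurable (by fun_prop)),
        integral_map (by fun_prop) (Continuous.aestronglyMeasurable (by fun_prop))]
      exact (hx 0).integral_norm_inner_spike_sq hu
    simp_rw [e5]
    have : ((N : ℂ) + 1) ≠ 0 := by exact_mod_cast Nat.succ_ne_zero N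
    simp only [Finset.sum_const, Finset.card_univ, Fintype.card_fin, nsmul_eq_mul]
    push_cast
    field_simp
  · exact fun S => by fun_prop
  · have h1 : Integrable (fun s : Fin (N + 1) → ℂ => ∑ n, ‖s n‖ ^ 2)
        (Measure.pi fun _ => P.map fun ω => inner ℂ u (x 0 ω)) :=
      integrable_finsetSum _ fun n _ =>
        integrable_comp_eval (μ := fun _ : Fin (N + 1) => P.map fun ω => inner ℂ u (x 0 ω)) hs2
    refine Integrable.mono' (((h1.mul_prod (hν.integrable_sum_sq (N + 1)))).const_mul (‖y‖ * ‖z‖))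
      (Continuous.aestronglyMeasurable (by fun_prop)) (ae_of_all _ fun q => ?_)
    rw [norm_mul]
    refine (mul_le_mul (norm_inner_le_norm _ _) (norm_inner_le_norm _ _) (norm_nonneg _)
      (by positivity)).trans ?_
    calc _ = ‖y‖ * ‖z‖ * ‖∑ n, conj (q.1 n) • q.2 n‖ ^ 2 := by ring
      _ ≤ _ := by gcongr; exact norm_combination_sq_le _ _

end IsCircular

end SpikedSample

/-! ### Moments of the deviation of the sample covariance -/

section Moments

variable {Ω : Type*} [MeasurableSpace Ω] {P : Measure Ω}

lemma integrable_pow_of_memLp_four [IsFiniteMeasure P] {S : Ω → ℝ} (hS : MemLp S 4 P) {j : ℕ}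
    (hj : j ≤ 4) : Integrable (fun ω => S ω ^ j) P := by
  rcases Nat.eq_zero_or_pos j with rfl | h0
  · simp
  have h1 : MemLp S (j : ENNReal) P := hS.mono_exponent (by exact_mod_cast hj)
  have h2 := h1.integrable_norm_pow (by omega)
  exact h2.mono (hS.1.pow j) (ae_of_all _ fun ω => by simp)

/-- Second and fourth moments of a sum of two independent centred variables. -/
lemma integral_add_pow_of_indepFun [IsFiniteMeasure P] {S Z : Ω → ℝ} (hi : IndepFun S Z P)
    (hS : MemLp S 4 P) (hZ : MemLp Z 4 P) (hS0 : ∫ ω, S ω ∂P = 0) (hZ0 : ∫ ω, Z ω ∂P = 0) :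
    ∫ ω, (S ω + Z ω) ^ 2 ∂P = ∫ ω, S ω ^ 2 ∂P + ∫ ω, Z ω ^ 2 ∂P ∧
    ∫ ω, (S ω + Z ω) ^ 4 ∂P
      = ∫ ω, S ω ^ 4 ∂P + 6 * ((∫ ω, S ω ^ 2 ∂P) * ∫ ω, Z ω ^ 2 ∂P) + ∫ ω, Z ω ^ 4 ∂P := by
  have hpow : ∀ a b : ℕ, IndepFun (fun ω => S ω ^ a) (fun ω => Z ω ^ b) P := fun a b =>
    hi.comp (measurable_id.pow_const a) (measurable_id.pow_const b)
  have hint : ∀ a b : ℕ, a ≤ 4 → b ≤ 4 → Integrable (fun ω => S ω ^ a * Z ω ^ b) P := fun a b ha hb =>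
    (hpow a b).integrable_mul (integrable_pow_of_memLp_four hS ha) (integrable_pow_of_memLp_four hZ hb)
  have hmul : ∀ a b : ℕ, ∫ ω, S ω ^ a * Z ω ^ b ∂P = (∫ ω, S ω ^ a ∂P) * ∫ ω, Z ω ^ b ∂P :=
    fun a b => (hpow a b).integral_fun_mul_eq_mul_integral (hS.1.pow a) (hZ.1.pow b)
  have h11 := hmul 1 1
  have h31 := hmul 3 1
  have h22 := hmul 2 2
  have h13 := hmul 1 3
  simp only [pow_one, hS0, hZ0, mul_zero, zero_mul] at h11 h31 h13
  constructor
  · have e : ∀ ω, (S ω + Z ω) ^ 2 = S ω ^ 2 + (2 * (S ω * Z ω) + Z ω ^ 2) := fun ω => by ring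
    simp_rw [e]
    have i1 := (hint 1 1 (by simp) (by simp)).const_mul 2
    simp only [pow_one] at i1
    have i2 := integrable_pow_of_memLp_four hZ (j := 2) (by simp)
    have j1 : Integrable (fun ω => 2 * (S ω * Z ω) + Z ω ^ 2) P := i1.add i2
    rw [integral_add (integrable_pow_of_memLp_four hS (by simp)) j1, integral_add i1 i2,
      integral_const_mul, h11]
    ring
  · have e : ∀ ω, (S ω + Z ω) ^ 4 = S ω ^ 4 + (4 * (S ω ^ 3 * Z ω)
        + (6 * (S ω ^ 2 * Z ω ^ 2) + (4 * (S ω * Z ω ^ 3) + Z ω ^ 4))) := fun ω => by ring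
    simp_rw [e]
    have i1 := (hint 3 1 (by simp) (by simp)).const_mul 4
    have i2 := (hint 2 2 (by simp) (by simp)).const_mul 6
    have i3 := (hint 1 3 (by simp) (by simp)).const_mul 4
    have i4 := integrable_pow_of_memLp_four hZ le_rfl
    simp only [pow_one] at i1 i3
    have j3 : Integrable (fun ω => 4 * (S ω * Z ω ^ 3) + Z ω ^ 4) P := i3.add i4
    have j2 : Integrable (fun ω => 6 * (S ω ^ 2 * Z ω ^ 2)
        + (4 * (S ω * Z ω ^ 3) + Z ω ^ 4)) P := i2.add j3
    have j1 : Integrable (fun ω => 4 * (S ω ^ 3 * Z ω) + (6 * (S ω ^ 2 * Z ω ^ 2)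
        + (4 * (S ω * Z ω ^ 3) + Z ω ^ 4))) P := i1.add j2
    rw [integral_add (integrable_pow_of_memLp_four hS le_rfl) j1,
      integral_add i1 j2, integral_add i2 j3, integral_add i3 i4,
      integral_const_mul, integral_const_mul, integral_const_mul, h31, h22, h13]
    ring

/-- Marcinkiewicz–Zygmund bound of order four for sums of independent centred variables. -/
lemma integral_sum_pow_four_le {Y : ℕ → Ω → ℝ} (hind : iIndepFun Y P)
    (hL : ∀ n, MemLp (Y n) 4 P) (h0 : ∀ n, ∫ ω, Y n ω ∂P = 0) {M : ℝ}
    (h2 : ∀ n, ∫ ω, Y n ω ^ 2 ∂P ≤ M) (h4 : ∀ n, ∫ ω, Y n ω ^ 4 ∂P ≤ M ^ 2) (N : ℕ) :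
    ∫ ω, (∑ n ∈ Finset.range N, Y n ω) ^ 2 ∂P ≤ M * N ∧
      ∫ ω, (∑ n ∈ Finset.range N, Y n ω) ^ 4 ∂P ≤ 3 * M ^ 2 * N ^ 2 := by
  have := hind.isProbabilityMeasure
  have hM : 0 ≤ M := (integral_nonneg fun ω => sq_nonneg (Y 0 ω)).trans (h2 0)
  induction N with
  | zero => simp
  | succ N ih =>
    obtain ⟨ih2, ih4⟩ := ih
    have hS : MemLp (fun ω => ∑ n ∈ Finset.range N, Y n ω) 4 P :=
      memLp_finsetSum _ fun n _ => hL n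
    have hi : IndepFun (fun ω => ∑ n ∈ Finset.range N, Y n ω) (Y N) P := by
      have := hind.indepFun_finsetSum_of_notMem₀ (fun n => (hL n).1.aemeasurable)
        (s := Finset.range N) (i := N) (by simp)
      convert this using 1
      ext ω; simp
    have hS0 : ∫ ω, (∑ n ∈ Finset.range N, Y n ω) ∂P = 0 := by
      rw [integral_finsetSum _ fun n _ => (hL n).integrable (by norm_num)]
      simp [h0]
    obtain ⟨e2, e4⟩ := integral_add_pow_of_indepFun hi hS (hL N) hS0 (h0 N)
    simp_rw [Finset.sum_range_succ]
    rw [e2, e4]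
    have h2N : 0 ≤ ∫ ω, Y N ω ^ 2 ∂P := integral_nonneg fun ω => sq_nonneg _
    have h := mul_le_mul ih2 (h2 N) h2N (by positivity)
    push_cast
    constructor
    · linarith [h2 N]
    · nlinarith [h4 N, sq_nonneg M]

lemma opNorm_le_sum_entries {F : Type*} [NormedAddCommGroup F] [InnerProductSpace ℂ F]
    {ι : Type*} [Fintype ι] (b : OrthonormalBasis ι ℂ F) (B : F →L[ℂ] F) :
    ‖B‖ ≤ ∑ p : ι × ι, ‖inner ℂ (b p.1) (B (b p.2))‖ := by
  refine B.opNorm_le_bound (Finset.sum_nonneg fun _ _ => norm_nonneg _) fun y => ?_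
  have h1 : ∀ z, ‖z‖ ≤ ∑ i, ‖inner ℂ (b i) z‖ := fun z => by
    conv_lhs => rw [← b.sum_repr' z]
    refine (norm_sum_le _ _).trans (le_of_eq (Finset.sum_congr rfl fun i _ => ?_))
    rw [norm_smul, b.norm_eq_one, mul_one]
  calc ‖B y‖ = ‖∑ j, inner ℂ (b j) y • B (b j)‖ := by
        conv_lhs => rw [← b.sum_repr' y, map_sum]
        simp only [map_smul]
    _ ≤ ∑ j, ‖y‖ * ∑ i, ‖inner ℂ (b i) (B (b j))‖ := by
        refine (norm_sum_le _ _).trans (Finset.sum_le_sum fun j _ => ?_)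
        rw [norm_smul]
        refine mul_le_mul ?_ (h1 _) (norm_nonneg _) (norm_nonneg _)
        simpa [b.norm_eq_one] using norm_inner_le_norm (𝕜 := ℂ) (b j) y
    _ = _ := by
        rw [← Finset.mul_sum, mul_comm, Finset.sum_comm, Fintype.sum_prod_type]

/-- Interpolation between the powers `0` and `4` at the scale `ε`. -/
lemma pow_le_of_pow_four {d ε : ℝ} (hd : 0 ≤ d) (hε : 0 < ε) {i j : ℕ} (hij : i + j = 4) :
    d ^ i ≤ ε ^ i + d ^ 4 / ε ^ j := by
  rcases le_total d ε with h | h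
  · have : d ^ i ≤ ε ^ i := pow_le_pow_left₀ hd h i
    have h2 : 0 ≤ d ^ 4 / ε ^ j := by positivity
    linarith
  · have h1 : d ^ i ≤ d ^ 4 / ε ^ j := by
      rw [le_div_iff₀ (by positivity), ← hij, pow_add]
      gcongr
    have h2 : 0 ≤ ε ^ i := by positivity
    linarith

section Samples

variable {F : Type*} [NormedAddCommGroup F] [InnerProductSpace ℂ F] [MeasurableSpace F]
  [BorelSpace F] [FiniteDimensional ℂ F] [SecondCountableTopology F]
  {T : F →L[ℂ] F} {x : ℕ → Ω → F} (hind : iIndepFun x P) (hx : ∀ n, IsCircular P (x n) T)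
include hind hx

lemma IsCircular.exists_integral_sum_pow_four_le {g : F → ℝ} (hg : Continuous g)
    (hL : MemLp (fun ω => g (x 0 ω)) 4 P) (h0 : ∫ ω, g (x 0 ω) ∂P = 0) :
    ∃ K, 0 ≤ K ∧ ∀ N : ℕ, Integrable (fun ω => (∑ n ∈ Finset.range N, g (x n ω)) ^ 4) P ∧
      ∫ ω, (∑ n ∈ Finset.range N, g (x n ω)) ^ 4 ∂P ≤ K * N ^ 2 := by
  have := hind.isProbabilityMeasure
  have hm : ∀ n, AEMeasurable (x n) P := fun n => (hx n).gaussian.aemeasurable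
  have hlaw : ∀ n, IdentDistrib (x n) (x 0) P P := fun n =>
    ⟨hm n, hm 0, (hx n).map_eq (hx 0)⟩
  have hlg : ∀ n, IdentDistrib (fun ω => g (x n ω)) (fun ω => g (x 0 ω)) P P := fun n =>
    (hlaw n).comp hg.measurable
  have hLn : ∀ n, MemLp (fun ω => g (x n ω)) 4 P := fun n => (hlg n).symm.memLp_iff.1 hL
  set M := ∫ ω, g (x 0 ω) ^ 2 ∂P + ∫ ω, g (x 0 ω) ^ 4 ∂P + 1
  have p2 : 0 ≤ ∫ ω, g (x 0 ω) ^ 2 ∂P := integral_nonneg fun ω => sq_nonneg _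
  have p4 : 0 ≤ ∫ ω, g (x 0 ω) ^ 4 ∂P := integral_nonneg fun ω => by positivity
  refine ⟨3 * M ^ 2, by positivity, fun N => ⟨integrable_pow_of_memLp_four
    (memLp_finsetSum _ fun n _ => hLn n) le_rfl, ?_⟩⟩
  refine (integral_sum_pow_four_le (M := M) (Y := fun n ω => g (x n ω))
    (hind.comp (fun _ => g) fun _ => hg.measurable) hLn (fun n => ?_) (fun n => ?_) (fun n => ?_)
    N).2
  · rw [(hlg n).integral_eq, h0]
  · have := ((hlg n).comp (measurable_id.pow_const 2)).integral_eq
    simp only [Function.comp_def, id] at this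
    rw [this]; linarith
  · have := ((hlg n).comp (measurable_id.pow_const 4)).integral_eq
    simp only [Function.comp_def, id] at this
    rw [this]; nlinarith

lemma IsCircular.exists_integral_norm_sum_pow_four_le (y z : F) :
    ∃ K, 0 ≤ K ∧ ∀ N : ℕ,
      Integrable (fun ω => ‖∑ n ∈ Finset.range N,
        (inner ℂ y (x n ω) * inner ℂ (x n ω) z - inner ℂ y (T z))‖ ^ 4) P ∧
      ∫ ω, ‖∑ n ∈ Finset.range N,
        (inner ℂ y (x n ω) * inner ℂ (x n ω) z - inner ℂ y (T z))‖ ^ 4 ∂P ≤ K * N ^ 2 := by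
  have := hind.isProbabilityMeasure
  have : ENNReal.HolderTriple 8 8 4 := ⟨by
    rw [← two_mul, show (8 : ENNReal) = 2 * 4 by norm_num, ENNReal.mul_inv (by simp) (by simp),
      ← mul_assoc, ENNReal.mul_inv_cancel (by simp) (by simp), one_mul]⟩
  have hL : MemLp (fun ω => inner ℂ y (x 0 ω) * inner ℂ (x 0 ω) z - inner ℂ y (T z)) 4 P := by
    refine MemLp.sub ?_ (memLp_const _)
    exact MemLp.mul (p := 8) (q := 8) (((hx 0).memLp (r := 8) (by simp)).inner_const z)
      ((hx 0).memLp_inner y (r := 8) (by simp))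
  have h0 : ∫ ω, (inner ℂ y (x 0 ω) * inner ℂ (x 0 ω) z - inner ℂ y (T z)) ∂P = 0 := by
    rw [integral_sub ((hx 0).integrable_inner_mul_inner' y z) (integrable_const _), (hx 0).cov]
    simp
  have hre := integral_re (hL.integrable (by norm_num))
  have him := integral_im (hL.integrable (by norm_num))
  rw [h0] at hre him
  obtain ⟨K, hK, h⟩ := exists_integral_sum_pow_four_le hind hx
    (g := fun w => (inner ℂ y w * inner ℂ w z - inner ℂ y (T z)).re) (by fun_prop) hL.re
    (by simpa using hre)
  obtain ⟨K', hK', h'⟩ := exists_integral_sum_pow_four_le hind hx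
    (g := fun w => (inner ℂ y w * inner ℂ w z - inner ℂ y (T z)).im) (by fun_prop) hL.im
    (by simpa using him)
  have key : ∀ c : ℂ, ‖c‖ ^ 4 ≤ 2 * (c.re ^ 4 + c.im ^ 4) := fun c => by
    have : ‖c‖ ^ 4 = (c.re ^ 2 + c.im ^ 2) ^ 2 := by
      rw [show ‖c‖ ^ 4 = (‖c‖ ^ 2) ^ 2 by ring, ← Complex.normSq_eq_norm_sq, Complex.normSq_apply]
      ring
    rw [this]; nlinarith [sq_nonneg (c.re ^ 2 - c.im ^ 2)]
  refine ⟨2 * (K + K'), by positivity, fun N => ?_⟩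
  obtain ⟨i1, b1⟩ := h N
  obtain ⟨i2, b2⟩ := h' N
  simp_rw [← Complex.re_sum] at i1 b1
  simp_rw [← Complex.im_sum] at i2 b2
  have hmeas : AEStronglyMeasurable (fun ω => ‖∑ n ∈ Finset.range N,
        (inner ℂ y (x n ω) * inner ℂ (x n ω) z - inner ℂ y (T z))‖ ^ 4) P := by
    have hm : ∀ n, AEMeasurable (x n) P := fun n => (hx n).gaussian.aemeasurable
    exact AEMeasurable.aestronglyMeasurable (by fun_prop)
  have hint := (i1.add i2).const_mul 2
  have hi : Integrable (fun ω => ‖∑ n ∈ Finset.range N,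
        (inner ℂ y (x n ω) * inner ℂ (x n ω) z - inner ℂ y (T z))‖ ^ 4) P :=
    hint.mono' hmeas (ae_of_all _ fun ω => by
      rw [Real.norm_of_nonneg (by positivity)]; exact key _)
  refine ⟨hi, (integral_mono hi hint fun ω => key _).trans ?_⟩
  simp only [Pi.add_apply]
  rw [integral_const_mul, integral_add i1 i2]
  linarith

/-- The fourth moment of the deviation of the sample covariance is of order `N⁻²`. -/
lemma IsCircular.exists_integral_norm_sub_pow_four_le :
    ∃ K, 0 ≤ K ∧ ∀ N : ℕ, N ≠ 0 →
      Integrable (fun ω => ‖(N : ℝ)⁻¹ • gram (fun n : Fin N => x n ω) - T‖ ^ 4) P ∧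
      ∫ ω, ‖(N : ℝ)⁻¹ • gram (fun n : Fin N => x n ω) - T‖ ^ 4 ∂P ≤ K / N ^ 2 := by
  have := hind.isProbabilityMeasure
  let b := stdOrthonormalBasis ℂ F
  choose K hK hi hb using fun p : Fin (Module.finrank ℂ F) × Fin (Module.finrank ℂ F) =>
    exists_integral_norm_sum_pow_four_le hind hx (b p.1) (b p.2)
  set m : ℝ := (Fintype.card (Fin (Module.finrank ℂ F) × Fin (Module.finrank ℂ F)) : ℝ)
  refine ⟨m ^ 3 * ∑ p, K p, mul_nonneg (by positivity) (Finset.sum_nonneg fun p _ => hK p),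
    fun N hN => ?_⟩
  have hN' : (N : ℝ) ≠ 0 := by exact_mod_cast hN
  have key : ∀ ω, ‖(N : ℝ)⁻¹ • gram (fun n : Fin N => x n ω) - T‖ ^ 4
      ≤ m ^ 3 * ∑ p : Fin (Module.finrank ℂ F) × Fin (Module.finrank ℂ F),
        (N : ℝ)⁻¹ ^ 4 * ‖∑ n ∈ Finset.range N,
        (inner ℂ (b p.1) (x n ω) * inner ℂ (x n ω) (b p.2) - inner ℂ (b p.1) (T (b p.2)))‖ ^ 4 := by
    intro ω
    set B := (N : ℝ)⁻¹ • gram (fun n : Fin N => x n ω) - T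
    have e : ∀ y z, inner ℂ y (B z) = (((N : ℝ)⁻¹ : ℝ) : ℂ) * ∑ n ∈ Finset.range N,
        (inner ℂ y (x n ω) * inner ℂ (x n ω) z - inner ℂ y (T z)) := by
      intro y z
      have hNc : (N : ℂ) ≠ 0 := by exact_mod_cast hN
      rw [sub_apply, inner_sub_right, smul_apply, ← Complex.coe_smul, inner_smul_right, inner_gram,
        Finset.sum_sub_distrib, Finset.sum_const, Finset.card_range, nsmul_eq_mul, mul_sub,
        Finset.sum_range fun n => inner ℂ y (x n ω) * inner ℂ (x n ω) z]
      congr 1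
      push_cast
      rw [inv_mul_cancel_left₀ hNc]
    have h1 := pow_sum_div_card_le_sum_pow (s := Finset.univ)
      (f := fun p : Fin (Module.finrank ℂ F) × Fin (Module.finrank ℂ F) =>
        ‖inner ℂ (b p.1) (B (b p.2))‖) (fun _ _ => norm_nonneg _) 3
    have h2 : ‖B‖ ^ 4 ≤ (∑ p : Fin (Module.finrank ℂ F) × Fin (Module.finrank ℂ F),
        ‖inner ℂ (b p.1) (B (b p.2))‖) ^ 4 := by
      gcongr; exact opNorm_le_sum_entries b B
    refine h2.trans ?_
    have e4 : ∀ p : Fin (Module.finrank ℂ F) × Fin (Module.finrank ℂ F),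
        ‖inner ℂ (b p.1) (B (b p.2))‖ ^ 4 = (N : ℝ)⁻¹ ^ 4 * ‖∑ n ∈ Finset.range N,
        (inner ℂ (b p.1) (x n ω) * inner ℂ (x n ω) (b p.2) - inner ℂ (b p.1) (T (b p.2)))‖ ^ 4 := by
      intro p
      rw [e, norm_mul, mul_pow, Complex.norm_real, Real.norm_of_nonneg (by positivity)]
    simp_rw [e4] at h1
    rcases (Nat.cast_nonneg (Fintype.card _) : (0 : ℝ) ≤ m).eq_or_lt with h0 | h0
    · have hemp : IsEmpty (Fin (Module.finrank ℂ F) × Fin (Module.finrank ℂ F)) := by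
        rw [← Fintype.card_eq_zero_iff]; exact_mod_cast h0.symm
      simp
    · rw [Finset.card_univ, div_le_iff₀ (by positivity)] at h1
      linarith
  have hint : Integrable (fun ω => m ^ 3 * ∑ p : Fin (Module.finrank ℂ F) × Fin (Module.finrank ℂ F),
        (N : ℝ)⁻¹ ^ 4 * ‖∑ n ∈ Finset.range N,
        (inner ℂ (b p.1) (x n ω) * inner ℂ (x n ω) (b p.2)
          - inner ℂ (b p.1) (T (b p.2)))‖ ^ 4) P :=
    (integrable_finsetSum _ fun p _ => (hi p N).const_mul _).const_mul _
  have hm : ∀ n, AEMeasurable (x n) P := fun n => (hx n).gaussian.aemeasurable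
  have hmeas : AEStronglyMeasurable
      (fun ω => ‖(N : ℝ)⁻¹ • gram (fun n : Fin N => x n ω) - T‖ ^ 4) P := by
    have h1 : Continuous fun w : Fin N → F => ‖(N : ℝ)⁻¹ • gram w - T‖ ^ 4 :=
      (((continuous_gram.const_smul ((N : ℝ)⁻¹)).sub continuous_const).norm).pow 4
    exact (h1.measurable.comp_aemeasurable (by fun_prop)).aestronglyMeasurable
  refine ⟨hint.mono' hmeas (ae_of_all _ fun ω => ?_), ?_⟩
  · rw [Real.norm_of_nonneg (by positivity)]; exact key ω
  · refine (integral_mono (hint.mono' hmeas (ae_of_all _ fun ω => ?_)) hint key).trans ?_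
    · rw [Real.norm_of_nonneg (by positivity)]; exact key ω
    rw [integral_const_mul, integral_finsetSum _ fun p _ => (hi p N).const_mul _, mul_div_assoc,
      Finset.sum_div]
    gcongr with p
    rw [integral_const_mul]
    calc _ ≤ (N : ℝ)⁻¹ ^ 4 * (K p * N ^ 2) := by gcongr; exact hb p N
      _ = _ := by field_simp

lemma IsCircular.integrable_norm_sub_pow {i : ℕ} (hij : i ≤ 4) {N : ℕ} (hN : N ≠ 0) :
    Integrable (fun ω => ‖(N : ℝ)⁻¹ • gram (fun n : Fin N => x n ω) - T‖ ^ i) P := by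
  have := hind.isProbabilityMeasure
  have hm : ∀ n, AEMeasurable (x n) P := fun n => (hx n).gaussian.aemeasurable
  obtain ⟨K, hK, h⟩ := exists_integral_norm_sub_pow_four_le hind hx
  obtain ⟨j, hj⟩ : ∃ j, i + j = 4 := ⟨4 - i, by omega⟩
  have hc : Continuous fun w : Fin N → F => ‖(N : ℝ)⁻¹ • gram w - T‖ ^ i :=
    (((continuous_gram.const_smul ((N : ℝ)⁻¹)).sub continuous_const).norm).pow i
  refine (((h N hN).1.const_mul 1).add (integrable_const 1)).mono'
    (hc.measurable.comp_aemeasurable (by fun_prop)).aestronglyMeasurable (ae_of_all _ fun ω => ?_)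
  have := pow_le_of_pow_four (norm_nonneg ((N : ℝ)⁻¹ • gram (fun n : Fin N => x n ω) - T)) one_pos hj
  rw [Real.norm_of_nonneg (by positivity)]
  simp only [one_pow, div_one, Pi.add_apply, one_mul] at this ⊢
  linarith

/-- Moments of order `i ≤ 4` of the deviation are of order `N ^ (-i/2)`. -/
lemma IsCircular.exists_integral_norm_sub_pow_le :
    ∃ K, 0 ≤ K ∧ ∀ i j : ℕ, i + j = 4 → ∀ N : ℕ, N ≠ 0 →
      ∫ ω, ‖(N : ℝ)⁻¹ • gram (fun n : Fin N => x n ω) - T‖ ^ i ∂P ≤ K * (√N)⁻¹ ^ i := by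
  have := hind.isProbabilityMeasure
  obtain ⟨K, hK, h⟩ := exists_integral_norm_sub_pow_four_le hind hx
  refine ⟨1 + K, by positivity, fun i j hij N hN => ?_⟩
  have hN0 : (0 : ℝ) < N := by exact_mod_cast Nat.pos_of_ne_zero hN
  have hs : 0 < √(N : ℝ) := Real.sqrt_pos.2 hN0
  have h1 := integral_mono (integrable_norm_sub_pow hind hx (i := i) (by omega) hN)
    ((integrable_const ((√(N : ℝ))⁻¹ ^ i)).add ((h N hN).1.div_const ((√(N : ℝ))⁻¹ ^ j)))
    fun ω => pow_le_of_pow_four (norm_nonneg _) (inv_pos.2 hs) hij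
  refine h1.trans ?_
  simp only [Pi.add_apply]
  rw [integral_add (integrable_const _) ((h N hN).1.div_const _), integral_div]
  simp only [integral_const, probReal_univ, smul_eq_mul, one_mul]
  rw [add_mul, one_mul]
  gcongr
  rw [div_le_iff₀ (by positivity)]
  refine ((h N hN).2).trans (le_of_eq ?_)
  rw [mul_assoc, ← pow_add, hij, div_eq_mul_inv]
  congr 1
  rw [inv_pow, show √(N : ℝ) ^ 4 = (√(N : ℝ) ^ 2) ^ 2 by ring, Real.sq_sqrt hN0.le]

lemma IsCircular.tendsto_mul_integral_norm_sub_pow_three :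
    Tendsto (fun N : ℕ => (N : ℝ) * ∫ ω, ‖(N : ℝ)⁻¹ • gram (fun n : Fin N => x n ω) - T‖ ^ 3 ∂P)
      atTop (𝓝 0) := by
  obtain ⟨K, hK, h⟩ := exists_integral_norm_sub_pow_le hind hx
  have hlim : Tendsto (fun N : ℕ => K * (√(N : ℝ))⁻¹) atTop (𝓝 0) := by
    simpa using ((tendsto_inv_atTop_zero.comp (Real.tendsto_sqrt_atTop.comp
      tendsto_natCast_atTop_atTop)).const_mul K)
  refine squeeze_zero' (Eventually.of_forall fun N => mul_nonneg (Nat.cast_nonneg _)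
    (integral_nonneg fun ω => by positivity)) ?_ hlim
  filter_upwards [eventually_ne_atTop 0] with N hN
  have hN0 : (0 : ℝ) < N := by exact_mod_cast Nat.pos_of_ne_zero hN
  have hs : 0 < √(N : ℝ) := Real.sqrt_pos.2 hN0
  calc _ ≤ (N : ℝ) * (K * (√N)⁻¹ ^ 3) := by gcongr; exact h 3 1 rfl N hN
    _ = K * (√N)⁻¹ * ((N : ℝ) / (√N) ^ 2) := by rw [inv_pow]; field_simp
    _ = _ := by rw [Real.sq_sqrt hN0.le, div_self hN0.ne', mul_one]

lemma IsCircular.tendsto_integral_norm_sub :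
    Tendsto (fun N : ℕ => ∫ ω, ‖(N : ℝ)⁻¹ • gram (fun n : Fin N => x n ω) - T‖ ∂P)
      atTop (𝓝 0) := by
  obtain ⟨K, hK, h⟩ := exists_integral_norm_sub_pow_le hind hx
  have hlim : Tendsto (fun N : ℕ => K * (√(N : ℝ))⁻¹) atTop (𝓝 0) := by
    simpa using ((tendsto_inv_atTop_zero.comp (Real.tendsto_sqrt_atTop.comp
      tendsto_natCast_atTop_atTop)).const_mul K)
  refine squeeze_zero' (Eventually.of_forall fun N => integral_nonneg fun ω => norm_nonneg _) ?_ hlim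
  filter_upwards [eventually_ne_atTop 0] with N hN
  simpa using h 1 3 rfl N hN

end Samples

section White

variable {E : Type*} [NormedAddCommGroup E] [InnerProductSpace ℂ E] [MeasurableSpace E]
  [BorelSpace E] [FiniteDimensional ℂ E] [SecondCountableTopology E] {v : ℝ} {w : ℕ → Ω → E}

/-- Law of large numbers for the Ky Fan sums of white noise. -/
theorem IsCircular.tendsto_meanTop_div (hind : iIndepFun w P)
    (hw : ∀ n, IsCircular P (w n) (v • (1 : E →L[ℂ] E))) {k : ℕ} (hk : k ≤ Module.finrank ℂ E) :
    Tendsto (fun N : ℕ => meanTop (P.map (w 0)) k N 0 / N) atTop (𝓝 (k * v)) := by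
  have := hind.isProbabilityMeasure
  have hm : ∀ n, AEMeasurable (w n) P := fun n => (hw n).gaussian.aemeasurable
  have hlim := (tendsto_integral_norm_sub hind hw).const_mul (k : ℝ)
  rw [mul_zero] at hlim
  rw [tendsto_iff_dist_tendsto_zero]
  refine squeeze_zero' (Eventually.of_forall fun N => dist_nonneg) ?_ hlim
  filter_upwards [eventually_ne_atTop 0] with N hN
  have hN0 : (0 : ℝ) < N := by exact_mod_cast Nat.pos_of_ne_zero hN
  have h1 := (iIndepFun_iff_map_fun_eq_pi_map fun n : Fin N => hm n).1
    (hind.precomp Fin.val_injective)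
  have h2 : (fun n : Fin N => P.map (w n)) = fun _ => P.map (w 0) :=
    funext fun n => (hw n).map_eq (hw 0)
  rw [h2] at h1
  have hc : Continuous fun y : Fin N → E => topSum k (gram y + 0) :=
    (continuous_topSum hk).comp (continuous_gram.add continuous_const)
  have h3 : meanTop (P.map (w 0)) k N 0 / N
      = ∫ ω, topSum k ((N : ℝ)⁻¹ • gram fun n : Fin N => w n ω) ∂P := by
    rw [meanTop, ← h1, integral_map (by fun_prop) hc.aestronglyMeasurable]
    simp_rw [topSum_smul (inv_nonneg.2 (Nat.cast_nonneg N))]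
    rw [integral_const_mul, div_eq_inv_mul]
    simp
  have h4 : topSum k (v • (1 : E →L[ℂ] E)) = k * v := by
    have := topSum_add_smul_one hk v (0 : E →L[ℂ] E)
    simpa [topSum_zero] using this
  have hi := integrable_norm_sub_pow hind hw (i := 1) (by simp) hN
  simp only [pow_one] at hi
  have hb : ∀ ω, ‖topSum k ((N : ℝ)⁻¹ • gram fun n : Fin N => w n ω) - k * v‖
      ≤ k * ‖(N : ℝ)⁻¹ • gram (fun n : Fin N => w n ω) - v • (1 : E →L[ℂ] E)‖ := fun ω => by
    rw [← h4]; exact abs_topSum_sub_le hk _ _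
  have hmeas : AEStronglyMeasurable
      (fun ω => topSum k ((N : ℝ)⁻¹ • gram fun n : Fin N => w n ω)) P := by
    have h1 : Continuous fun y : Fin N → E => topSum k ((N : ℝ)⁻¹ • gram y) :=
      (continuous_topSum hk).comp (continuous_gram.const_smul ((N : ℝ)⁻¹))
    exact (h1.measurable.comp_aemeasurable (by fun_prop)).aestronglyMeasurable
  have hi2 : Integrable
      (fun ω => topSum k ((N : ℝ)⁻¹ • gram fun n : Fin N => w n ω) - k * v) P :=
    (hi.const_mul (k : ℝ)).mono' (hmeas.sub aestronglyMeasurable_const) (ae_of_all _ hb)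
  have h5 : meanTop (P.map (w 0)) k N 0 / N - k * v
      = ∫ ω, (topSum k ((N : ℝ)⁻¹ • gram fun n : Fin N => w n ω) - k * v) ∂P := by
    have hi3 : Integrable (fun ω => topSum k ((N : ℝ)⁻¹ • gram fun n : Fin N => w n ω)) P := by
      have h6 := hi2.add (integrable_const ((k : ℝ) * v))
      refine h6.congr (ae_of_all _ fun ω => ?_)
      simp
    rw [integral_sub hi3 (integrable_const _), h3]
    simp
  rw [dist_eq_norm, h5, ← integral_const_mul]
  exact norm_integral_le_of_norm_le (hi.const_mul _) (ae_of_all _ hb)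

end White

end Moments

/-! ### Asymptotics of the residual of the spike direction -/

section Asymptotics

variable {Ω : Type*} [MeasurableSpace Ω] {P : Measure Ω}
  {F : Type*} [NormedAddCommGroup F] [InnerProductSpace ℂ F] [MeasurableSpace F]
  [BorelSpace F] [FiniteDimensional ℂ F] [SecondCountableTopology F]
  {u : F} {δ v : ℝ} {q : ℕ} {x : ℕ → Ω → F} {uh : ℕ → Ω → Fin (q + 1) → F}

namespace IsCircular

lemma tendsto_meanTopRankOne_sub_meanTopRankOne (hind : iIndepFun x P)
    (hx : ∀ n, IsCircular P (x n) (spike u δ v)) (hv : 0 < v)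
    (hpos : 0 < Module.finrank ℂ (Perp u)) {k : ℕ} (hk : k ≤ Module.finrank ℂ (Perp u)) (t h : ℝ) :
    Tendsto (fun N : ℕ => meanTopRankOne (P.map fun ω => toPerp u (x 0 ω)) k N (1 + (t + h))
      - meanTopRankOne (P.map fun ω => toPerp u (x 0 ω)) k N (1 + t)) atTop (𝓝 (k * v * h)) := by
  have hw : ∀ n, IsCircular P (fun ω => toPerp u (x n ω)) (v • (1 : Perp u →L[ℂ] Perp u)) :=
    fun n => (hx n).toPerp_spike
  have hindw : iIndepFun (fun n ω => toPerp u (x n ω)) P :=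
    hind.comp (fun _ => toPerp u) fun _ => by fun_prop
  have hν := (hw 0).isIsotropic hv hpos
  have hlim := tendsto_meanTop_div hindw hw hk
  have h1 := (hν.tendsto_meanTopRankOne_sub hk hpos hlim (1 + (t + h))).sub
    (hν.tendsto_meanTopRankOne_sub hk hpos hlim (1 + t))
  convert h1 using 2 <;> ring

variable (hind : iIndepFun x P) (hx : ∀ n, IsCircular P (x n) (spike u δ v))
  (hδ : 0 < δ) (hv : 0 < v) (hq : 0 < q)
  (hmeas : ∀ (N : ℕ) m, AEMeasurable (fun ω => uh N ω m) P)
  (hH : ∀ N : ℕ, ∀ᵐ ω ∂P, ∃ l : Fin (q + 1) → ℝ, (∀ m, 0 ≤ l m) ∧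
    IsEigensystem u ((N : ℝ)⁻¹ • gram fun n : Fin N => x n ω) (uh N ω) l)
include hind hx hδ hv hq hmeas hH

omit hind hx hδ hv hq [FiniteDimensional ℂ F] in
lemma integrable_norm_inner_eig_sq [IsProbabilityMeasure P] (N : ℕ) (m : Fin (q + 1)) :
    Integrable (fun ω => ‖inner ℂ u (uh N ω m)‖ ^ 2) P := by
  have hm := hmeas N m
  refine (integrable_const (1 : ℝ)).mono' (AEMeasurable.aestronglyMeasurable (by fun_prop)) ?_
  filter_upwards [hH N] with ω ⟨l, _, H⟩
  have : ‖inner ℂ u (uh N ω m)‖ ≤ 1 := by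
    simpa [H.unit, H.orthonormal.1] using norm_inner_le_norm (𝕜 := ℂ) u (uh N ω m)
  rw [Real.norm_of_nonneg (by positivity)]
  exact pow_le_one₀ (norm_nonneg _) this

/-- The expectation of the subgradient inequality at an increment `h` of the parameter. -/
lemma mul_integral_sum_le (hu : ‖u‖ = 1) (hF : Module.finrank ℂ F = q + 1) {k : ℕ} (hk : k ≤ q)
    {h : ℝ} (hh : |h| ≤ 1) (N : ℕ) :
    h * (δ ^ 2 / (δ + v) * (((N + 1 : ℕ) : ℝ) * ∫ ω, ∑ m : Fin q with m.val < k,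
        ‖inner ℂ u (uh (N + 1) ω m.succ)‖ ^ 2 ∂P))
      ≤ (meanTopRankOne (P.map fun ω => toPerp u (x 0 ω)) k N (1 + (-((δ + v) / δ) + h))
        - meanTopRankOne (P.map fun ω => toPerp u (x 0 ω)) k N (1 + -((δ + v) / δ)))
        + IsEigensystem.comparisonConst δ v k q * (((N + 1 : ℕ) : ℝ) * ∫ ω,
          ‖((N + 1 : ℕ) : ℝ)⁻¹ • gram (fun n : Fin (N + 1) => x n ω) - spike u δ v‖ ^ 3 ∂P) := by
  have := hind.isProbabilityMeasure
  have hf : Module.finrank ℂ (Perp u) = q :=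
    finrank_perp (by rintro rfl; simp at hu) hF
  have hpos : 0 < Module.finrank ℂ (Perp u) := by omega
  have hk' : k ≤ Module.finrank ℂ (Perp u) := by omega
  have hNpos : (0 : ℝ) < ((N + 1 : ℕ) : ℝ) := by positivity
  have i1 := integrable_topSum_schur hind hx hv hpos hk' (Nat.succ_ne_zero N)
    (-((δ + v) / δ) + h)
  have i2 := integrable_topSum_schur hind hx hv hpos hk' (Nat.succ_ne_zero N) (-((δ + v) / δ))
  have i3 := integrable_norm_sub_pow hind hx (i := 3) (by simp) (Nat.succ_ne_zero N)
  have i4 : Integrable (fun ω => ∑ m : Fin q with m.val < k,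
      ‖inner ℂ u (uh (N + 1) ω m.succ)‖ ^ 2) P :=
    integrable_finsetSum _ fun m _ => integrable_norm_inner_eig_sq hmeas hH (N + 1) m.succ
  have h1 := integral_mono_ae ((i4.const_mul (δ ^ 2 / (δ + v))).const_mul h)
    ((i1.sub i2).add (i3.const_mul (IsEigensystem.comparisonConst δ v k q))) (by
      filter_upwards [hH (N + 1)] with ω ⟨l, hl, H⟩
      exact H.topSum_schur_ge_global hl hδ hv hk hh)
  have i12 : Integrable (fun ω =>
      topSum k (schur u (((N + 1 : ℕ) : ℝ)⁻¹ • gram fun n : Fin (N + 1) => x n ω) (-((δ + v) / δ) + h))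
      - topSum k (schur u (((N + 1 : ℕ) : ℝ)⁻¹ • gram fun n : Fin (N + 1) => x n ω) (-((δ + v) / δ))))
      P := i1.sub i2
  simp only [Pi.add_apply, Pi.sub_apply] at h1
  rw [integral_const_mul, integral_const_mul, integral_add i12 (i3.const_mul _),
    integral_sub i1 i2, integral_const_mul,
    integral_topSum_schur hind hx hu hδ.le hv hpos hk', integral_topSum_schur hind hx hu hδ.le hv
      hpos hk'] at h1
  have h2 := mul_le_mul_of_nonneg_left h1 hNpos.le
  refine le_trans (le_of_eq ?_) (h2.trans (le_of_eq ?_))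
  · ring
  · field_simp

/-- The expected squared coefficients of the spike direction along the `k` eigenvectors following
the leading one. The subgradient inequality at the increments `1` and `-1` bounds them from both
sides, and both bounds have the same limit. -/
theorem tendsto_mul_integral_sum (hu : ‖u‖ = 1) (hF : Module.finrank ℂ F = q + 1) {k : ℕ}
    (hk : k ≤ q) :
    Tendsto (fun N : ℕ => (N : ℝ) * ∫ ω, ∑ m : Fin q with m.val < k,
        ‖inner ℂ u (uh N ω m.succ)‖ ^ 2 ∂P) atTop (𝓝 (k * (v * (δ + v) / δ ^ 2))) := by
  have hf : Module.finrank ℂ (Perp u) = q :=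
    finrank_perp (by rintro rfl; simp at hu) hF
  have hpos : 0 < Module.finrank ℂ (Perp u) := by omega
  have hk' : k ≤ Module.finrank ℂ (Perp u) := by omega
  rw [← tendsto_add_atTop_iff_nat 1]
  have h3 := ((tendsto_add_atTop_iff_nat 1).2
    (tendsto_mul_integral_norm_sub_pow_three hind hx)).const_mul (IsEigensystem.comparisonConst δ v k q)
  have hR : ∀ h : ℝ, Tendsto (fun N : ℕ =>
      (meanTopRankOne (P.map fun ω => toPerp u (x 0 ω)) k N (1 + (-((δ + v) / δ) + h))
        - meanTopRankOne (P.map fun ω => toPerp u (x 0 ω)) k N (1 + -((δ + v) / δ)))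
        + IsEigensystem.comparisonConst δ v k q * (((N + 1 : ℕ) : ℝ) * ∫ ω,
          ‖((N + 1 : ℕ) : ℝ)⁻¹ • gram (fun n : Fin (N + 1) => x n ω) - spike u δ v‖ ^ 3 ∂P))
      atTop (𝓝 (k * v * h)) := fun h => by
    simpa using (tendsto_meanTopRankOne_sub_meanTopRankOne hind hx hv hpos hk'
      (-((δ + v) / δ)) h).add h3
  have hc : 0 < (δ + v) / δ ^ 2 := by positivity
  have hup := (hR 1).const_mul ((δ + v) / δ ^ 2)
  have hlo := ((hR (-1)).const_mul ((δ + v) / δ ^ 2)).neg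
  have e1 : (δ + v) / δ ^ 2 * (k * v * 1) = k * (v * (δ + v) / δ ^ 2) := by ring
  have e2 : -((δ + v) / δ ^ 2 * (k * v * -1)) = k * (v * (δ + v) / δ ^ 2) := by ring
  rw [e1] at hup
  rw [e2] at hlo
  have hcancel : ∀ X : ℝ, (δ + v) / δ ^ 2 * (δ ^ 2 / (δ + v) * X) = X := fun X => by
    have : δ + v ≠ 0 := by positivity
    field_simp
  refine tendsto_of_tendsto_of_tendsto_of_le_of_le hlo hup (fun N => ?_) fun N => ?_
  · have h := mul_le_mul_of_nonneg_left (mul_integral_sum_le hind hx hδ hv hq hmeas hH hu hF hk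
      (h := -1) (by simp) N) hc.le
    rw [neg_one_mul, mul_neg, hcancel] at h
    dsimp only
    linarith
  · have h := mul_le_mul_of_nonneg_left (mul_integral_sum_le hind hx hδ hv hq hmeas hH hu hF hk
      (h := 1) (by simp) N) hc.le
    rw [one_mul, hcancel] at h
    exact h

/-- The expected squared coefficient along a single eigenvector, as the difference of the sums over
`k = m + 1` and `k = m` eigenvectors. -/
theorem tendsto_mul_integral_norm_inner_sq (hu : ‖u‖ = 1) (hF : Module.finrank ℂ F = q + 1)
    (m : Fin q) :
    Tendsto (fun N : ℕ => (N : ℝ) * ∫ ω, ‖inner ℂ u (uh N ω m.succ)‖ ^ 2 ∂P) atTop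
      (𝓝 (v * (δ + v) / δ ^ 2)) := by
  have := hind.isProbabilityMeasure
  have h1 := tendsto_mul_integral_sum hind hx hδ hv hq hmeas hH hu hF (k := m.val + 1) m.2
  have h0 := tendsto_mul_integral_sum hind hx hδ hv hq hmeas hH hu hF (k := m.val) m.2.le
  convert h1.sub h0 using 2 with N
  · have i : ∀ j : Fin q, Integrable (fun ω => ‖inner ℂ u (uh N ω j.succ)‖ ^ 2) P := fun j =>
      integrable_norm_inner_eig_sq hmeas hH N j.succ
    have e : ({j : Fin q | j.val < m.val + 1} : Finset (Fin q))
        = insert m ({j : Fin q | j.val < m.val} : Finset (Fin q)) := by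
      ext j; simp [Fin.ext_iff]; omega
    rw [e, integral_finsetSum _ fun j _ => i j, integral_finsetSum _ fun j _ => i j,
      Finset.sum_insert (by simp)]
    ring
  · push_cast; ring

/-- The second-moment matrix of the component of `u` off the leading eigenvector, compared with that
of the off-diagonal block divided by `δ`. -/
theorem tendsto_mul_integral_residual (hu : ‖u‖ = 1) (hF : Module.finrank ℂ F = q + 1) (y z : F) :
    Tendsto (fun N : ℕ => (N : ℂ) * ∫ ω, inner ℂ y (u - inner ℂ (uh N ω 0) u • uh N ω 0)
        * inner ℂ (u - inner ℂ (uh N ω 0) u • uh N ω 0) z ∂P) atTop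
      (𝓝 ((v * (δ + v) / δ ^ 2 : ℝ) * inner ℂ (toPerp u y) (toPerp u z))) := by
  have := hind.isProbabilityMeasure
  have hf : Module.finrank ℂ (Perp u) = q :=
    finrank_perp (by rintro rfl; simp at hu) hF
  have hpos : 0 < Module.finrank ℂ (Perp u) := by omega
  rw [← tendsto_add_atTop_iff_nat 1, tendsto_iff_dist_tendsto_zero]
  have h3 := ((tendsto_add_atTop_iff_nat 1).2
    (tendsto_mul_integral_norm_sub_pow_three hind hx)).const_mul (108 / δ ^ 3 * (‖y‖ * ‖z‖))
  rw [mul_zero] at h3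
  refine squeeze_zero (fun N => dist_nonneg) (fun N => ?_) h3
  have hm : ∀ n, AEMeasurable (x n) P := fun n => (hx n).gaussian.aemeasurable
  have hm0 := hmeas (N + 1) 0
  have i3 := integrable_norm_sub_pow hind hx (i := 3) (by simp) (Nat.succ_ne_zero N)
  have i1 : Integrable (fun ω => inner ℂ y (u - inner ℂ (uh (N + 1) ω 0) u • uh (N + 1) ω 0)
        * inner ℂ (u - inner ℂ (uh (N + 1) ω 0) u • uh (N + 1) ω 0) z) P := by
    refine (integrable_const ((‖y‖ * 2) * (2 * ‖z‖))).mono'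
      (AEMeasurable.aestronglyMeasurable (by fun_prop)) ?_
    filter_upwards [hH (N + 1)] with ω ⟨l, _, H⟩
    have h1 : ‖u - inner ℂ (uh (N + 1) ω 0) u • uh (N + 1) ω 0‖ ≤ 2 := by
      refine (norm_sub_le _ _).trans ?_
      rw [norm_smul, H.unit, H.orthonormal.1, mul_one]
      have : ‖inner ℂ (uh (N + 1) ω 0) u‖ ≤ 1 := by
        simpa [H.unit, H.orthonormal.1] using norm_inner_le_norm (𝕜 := ℂ) (uh (N + 1) ω 0) u
      linarith
    rw [norm_mul]
    gcongr
    · exact (norm_inner_le_norm _ _).trans (by gcongr)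
    · exact (norm_inner_le_norm _ _).trans (by gcongr)
  set c := fun ω => cross u (((N + 1 : ℕ) : ℝ)⁻¹ • gram fun n : Fin (N + 1) => x n ω) with hc
  have e : ∀ ω, inner ℂ y (c ω : F) * inner ℂ (c ω : F) z
      = inner ℂ (toPerp u y) (c ω) * inner ℂ (c ω) (toPerp u z) := by
    intro ω
    rw [inner_toPerp, ← inner_conj_symm y (c ω : F), ← inner_toPerp, inner_conj_symm]
  have hcross := integral_inner_cross hind hx hu hv hpos N (toPerp u y) (toPerp u z)
  have hbound : ∀ᵐ ω ∂P, ‖inner ℂ y (u - inner ℂ (uh (N + 1) ω 0) u • uh (N + 1) ω 0)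
        * inner ℂ (u - inner ℂ (uh (N + 1) ω 0) u • uh (N + 1) ω 0) z
        - (((δ ^ 2)⁻¹ : ℝ) : ℂ) * (inner ℂ (toPerp u y) (c ω) * inner ℂ (c ω) (toPerp u z))‖
      ≤ 108 / δ ^ 3 * (‖y‖ * ‖z‖) *
        ‖((N + 1 : ℕ) : ℝ)⁻¹ • gram (fun n : Fin (N + 1) => x n ω) - spike u δ v‖ ^ 3 := by
    filter_upwards [hH (N + 1)] with ω ⟨l, _, H⟩
    rw [← e]
    refine (H.norm_residual_product_sub_le hδ y z).trans (le_of_eq (by ring))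
  have hcm : AEMeasurable c P := by
    have h1 : Continuous fun w : Fin (N + 1) → F => cross u (((N + 1 : ℕ) : ℝ)⁻¹ • gram w) :=
      (toPerp u).continuous.comp
        ((continuous_gram.const_smul (((N + 1 : ℕ) : ℝ)⁻¹)).clm_apply continuous_const)
    exact h1.measurable.comp_aemeasurable (f := fun ω => fun n : Fin (N + 1) => x n ω) (by fun_prop)
  have i5 : Integrable (fun ω => inner ℂ y (u - inner ℂ (uh (N + 1) ω 0) u • uh (N + 1) ω 0)
        * inner ℂ (u - inner ℂ (uh (N + 1) ω 0) u • uh (N + 1) ω 0) z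
        - (((δ ^ 2)⁻¹ : ℝ) : ℂ) * (inner ℂ (toPerp u y) (c ω) * inner ℂ (c ω) (toPerp u z))) P :=
    (i3.const_mul _).mono' (AEMeasurable.aestronglyMeasurable (by fun_prop)) hbound
  have i6 : Integrable (fun ω => (((δ ^ 2)⁻¹ : ℝ) : ℂ)
      * (inner ℂ (toPerp u y) (c ω) * inner ℂ (c ω) (toPerp u z))) P := by
    refine (i1.sub i5).congr (ae_of_all _ fun ω => ?_)
    simp
  have h1 := norm_integral_le_of_norm_le (i3.const_mul _) hbound
  rw [integral_sub i1 i6, integral_const_mul, integral_const_mul, hcross] at h1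
  have hNpos : (0 : ℝ) < ((N + 1 : ℕ) : ℝ) := by positivity
  have h2 := mul_le_mul_of_nonneg_left h1 hNpos.le
  rw [dist_eq_norm]
  refine le_trans (le_of_eq ?_) (h2.trans (le_of_eq ?_))
  · have hnorm : ∀ Z : ℂ, ((N + 1 : ℕ) : ℝ) * ‖Z‖ = ‖((N + 1 : ℕ) : ℂ) * Z‖ := fun Z => by
      rw [norm_mul, Complex.norm_natCast]
    rw [hnorm]
    congr 1
    have hN : ((N : ℂ) + 1) ≠ 0 := by exact_mod_cast Nat.succ_ne_zero N
    have hδc : (δ : ℂ) ≠ 0 := by exact_mod_cast hδ.ne'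
    push_cast
    field_simp
  · ring

end IsCircular

end Asymptotics

/-! ### Translation to coordinates -/

section Coordinates

variable {Ω : Type*} [MeasurableSpace Ω] {P : Measure Ω} {p : ℕ}

/-- For `a = c u`, the model covariance is the spike with `δ = σs² c²` and `v = σ²`. -/
lemma IsComplexGaussian.isCircular {X : Ω → EuclideanSpace ℂ (Fin p)}
    {a u : EuclideanSpace ℂ (Fin p)} {σs σ c : ℝ} (ha : a = (c : ℂ) • u)
    (hX : IsComplexGaussian P X (modelCov a σs σ)) :
    IsCircular P X (spike u (σs ^ 2 * c ^ 2) (σ ^ 2)) := by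
  have hL : MemLp X 2 P := hX.gaussian.memLp (by simp)
  have hLi : ∀ i, MemLp (fun ω => X ω i) 2 P := fun i => by
    have := hL.const_inner (𝕜 := ℂ) (EuclideanSpace.single i (1 : ℂ))
    simpa only [EuclideanSpace.inner_single_left, map_one, one_mul] using this
  have := hX.gaussian.isProbabilityMeasure
  have hLc : ∀ i, MemLp (fun ω => conj (X ω i)) 2 P := fun i => (hLi i).star
  have hexp : ∀ y ω, inner ℂ y (X ω) = ∑ i, conj (y i) * X ω i := fun y ω => by
    simp [PiLp.inner_apply, mul_comm]
  have hexp' : ∀ z ω, inner ℂ (X ω) z = ∑ j, z j * conj (X ω j) := fun z ω => by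
    simp [PiLp.inner_apply]
  refine ⟨hX.gaussian, fun y => ?_, fun y z => ?_, fun y z => ?_⟩
  · simp_rw [hexp]
    rw [integral_finsetSum _ fun i _ => ((hLi i).integrable (by norm_num)).const_mul _]
    simp_rw [integral_const_mul, hX.mean]
    simp
  · have e : ∀ ω, inner ℂ y (X ω) * inner ℂ (X ω) z
        = ∑ i, ∑ j, conj (y i) * z j * (X ω i * conj (X ω j)) := fun ω => by
      rw [hexp, hexp', Finset.sum_mul_sum]
      exact Finset.sum_congr rfl fun i _ => Finset.sum_congr rfl fun j _ => by ring
    have hi : ∀ i j, Integrable (fun ω => conj (y i) * z j * (X ω i * conj (X ω j))) P :=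
      fun i j => ((hLi i).integrable_mul (hLc j)).const_mul _
    simp_rw [e]
    rw [integral_finsetSum _ fun i _ => integrable_finsetSum _ fun j _ => hi i j]
    simp_rw [integral_finsetSum _ fun j _ => hi _ j, integral_const_mul, hX.cov]
    have e2 : ∑ i, ∑ j, conj (y i) * z j * modelCov a σs σ i j
        = ((σs ^ 2 : ℝ) : ℂ) * (inner ℂ y a * inner ℂ a z) + ((σ ^ 2 : ℝ) : ℂ) * inner ℂ y z := by
      simp only [PiLp.inner_apply, modelCov, Matrix.of_apply, mul_add, mul_ite, mul_zero,
        Finset.sum_add_distrib, Finset.sum_ite_eq, Finset.mem_univ, if_true, RCLike.inner_apply]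
      rw [Finset.sum_mul_sum, Finset.mul_sum, Finset.mul_sum]
      congr 1
      · refine Finset.sum_congr rfl fun i _ => ?_
        rw [Finset.mul_sum]
        exact Finset.sum_congr rfl fun j _ => by ring
      · exact Finset.sum_congr rfl fun i _ => by ring
    rw [e2, spike_apply, inner_add_right, inner_smul_right, inner_smul_right, ha,
      inner_smul_left, inner_smul_right, Complex.conj_ofReal]
    push_cast; ring
  · have e : ∀ ω, inner ℂ y (X ω) * inner ℂ z (X ω)
        = ∑ i, ∑ j, conj (y i) * conj (z j) * (X ω i * X ω j) := fun ω => by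
      rw [hexp, hexp, Finset.sum_mul_sum]
      exact Finset.sum_congr rfl fun i _ => Finset.sum_congr rfl fun j _ => by ring
    have hi : ∀ i j, Integrable (fun ω => conj (y i) * conj (z j) * (X ω i * X ω j)) P :=
      fun i j => ((hLi i).integrable_mul (hLi j)).const_mul _
    simp_rw [e]
    rw [integral_finsetSum _ fun i _ => integrable_finsetSum _ fun j _ => hi i j]
    simp_rw [integral_finsetSum _ fun j _ => hi _ j, integral_const_mul, hX.pseudoCov]
    simp

lemma toEuclideanLin_sampleCov (N : ℕ) (x : ℕ → EuclideanSpace ℂ (Fin p))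
    (z : EuclideanSpace ℂ (Fin p)) :
    Matrix.toEuclideanLin (sampleCov N x) z = ((N : ℝ)⁻¹ • gram fun n : Fin N => x n) z := by
  ext i
  have e : ((N : ℝ)⁻¹ • gram fun n : Fin N => x n) z
      = (N : ℂ)⁻¹ • ∑ n ∈ Finset.range N, inner ℂ (x n) z • x n := by
    rw [smul_apply, Finset.sum_range fun n => inner ℂ (x n) z • x n, ← Complex.coe_smul]
    simp [gram]
  rw [e]
  simp only [Matrix.toLpLin_apply, Matrix.mulVec, dotProduct, sampleCov, Matrix.of_apply,
    PiLp.smul_apply, WithLp.ofLp_sum, Finset.sum_apply, PiLp.inner_apply, smul_eq_mul,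
    RCLike.inner_apply]
  simp_rw [mul_assoc, ← Finset.mul_sum, Finset.sum_mul]
  congr 1
  rw [Finset.sum_comm]
  exact Finset.sum_congr rfl fun n _ => Finset.sum_congr rfl fun j _ => by ring

/-- Eigenbases of the sample covariance matrix are eigensystems of the corresponding operator, with
nonnegative eigenvalues. -/
lemma IsOrderedEigenbasis.exists_isEigensystem {q N : ℕ} {x : ℕ → EuclideanSpace ℂ (Fin (q + 1))}
    {uh : Fin (q + 1) → EuclideanSpace ℂ (Fin (q + 1))}
    (h : IsOrderedEigenbasis (sampleCov N x) uh) {u : EuclideanSpace ℂ (Fin (q + 1))}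
    (hu : ‖u‖ = 1) :
    ∃ l : Fin (q + 1) → ℝ, (∀ m, 0 ≤ l m) ∧
      IsEigensystem u ((N : ℝ)⁻¹ • gram fun n : Fin N => x n) uh l := by
  obtain ⟨ho, l, hl, he⟩ := h
  have H : IsEigensystem u ((N : ℝ)⁻¹ • gram fun n : Fin N => x n) uh l :=
    { unit := hu
      symm := fun y z => by
        rw [smul_apply, smul_apply, ← Complex.coe_smul, ← Complex.coe_smul, inner_smul_left,
          inner_smul_right, Complex.conj_ofReal, ← inner_conj_symm, inner_gram, inner_gram, map_sum]
        congr 1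
        refine Finset.sum_congr rfl fun n _ => ?_
        rw [map_mul, inner_conj_symm, inner_conj_symm, mul_comm]
      orthonormal := ho
      finrank := by simp
      anti := hl
      eig := fun m => by rw [← toEuclideanLin_sampleCov, he] }
  refine ⟨l, fun m => ?_, H⟩
  rw [← H.re_inner_eig m, smul_apply, re_inner_real_smul, inner_gram, Complex.re_sum]
  refine mul_nonneg (by positivity) (Finset.sum_nonneg fun n _ => ?_)
  rw [← inner_conj_symm (x n) (uh m), Complex.mul_conj, Complex.ofReal_re]
  exact Complex.normSq_nonneg _

lemma projPerp_smul {c : ℂ} (hc : c ≠ 0) (y : EuclideanSpace ℂ (Fin p)) :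
    projPerp (c • y) = projPerp y := by
  rw [projPerp, projPerp]
  simp only [Submodule.span_singleton_smul_eq (IsUnit.mk0 c hc) y]

lemma proj_apply_of_unit {y : EuclideanSpace ℂ (Fin p)} (hy : ‖y‖ = 1)
    (z : EuclideanSpace ℂ (Fin p)) : proj y z = inner ℂ y z • y :=
  Submodule.starProjection_unit_singleton ℂ hy z

lemma projPerp_apply_of_unit {y : EuclideanSpace ℂ (Fin p)} (hy : ‖y‖ = 1)
    (z : EuclideanSpace ℂ (Fin p)) : projPerp y z = z - inner ℂ y z • y := by
  have h := Submodule.starProjection_add_starProjection_orthogonal (K := Submodule.span ℂ {y}) z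
  rw [Submodule.starProjection_unit_singleton ℂ hy] at h
  exact eq_sub_of_add_eq' h

lemma inner_toPerp_toPerp (u y z : EuclideanSpace ℂ (Fin p)) :
    inner ℂ (toPerp u y) (toPerp u z) = inner ℂ y (projPerp u z) := by
  rw [← inner_conj_symm, inner_toPerp, inner_conj_symm]
  rfl

lemma span_image_eq_orthogonal {q : ℕ} {uh : Fin (q + 1) → EuclideanSpace ℂ (Fin (q + 1))}
    (ho : Orthonormal ℂ uh) :
    Submodule.span ℂ (uh '' {m | (m : ℕ) ≠ 0}) = (Submodule.span ℂ {uh 0})ᗮ := by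
  have hne : ∀ m : Fin (q + 1), (m : ℕ) ≠ 0 ↔ m ≠ 0 := fun m => by rw [Ne, Ne, Fin.ext_iff]; rfl
  apply le_antisymm
  · rw [Submodule.span_le]
    rintro _ ⟨m, hm, rfl⟩
    exact Submodule.mem_orthogonal_singleton_iff_inner_right.2 (ho.2 ((hne m).1 hm).symm)
  · intro y hy
    have h0 := Submodule.mem_orthogonal_singleton_iff_inner_right.1 hy
    let b : OrthonormalBasis (Fin (q + 1)) ℂ (EuclideanSpace ℂ (Fin (q + 1))) :=
      (basisOfOrthonormalOfCardEqFinrank ho (by simp)).toOrthonormalBasis (by simpa using ho)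
    have hb : ∀ m, b m = uh m := fun m => by simp [b]
    rw [← b.sum_repr' y]
    refine Submodule.sum_mem _ fun m _ => ?_
    by_cases hm : m = 0
    · rw [hm, hb, h0, zero_smul]; exact Submodule.zero_mem _
    · rw [hb]
      exact Submodule.smul_mem _ _ (Submodule.subset_span ⟨m, (hne m).2 hm, rfl⟩)

lemma IsEigensystem.norm_projPerp_sq {q : ℕ} {u : EuclideanSpace ℂ (Fin p)}
    {A : EuclideanSpace ℂ (Fin p) →L[ℂ] EuclideanSpace ℂ (Fin p)}
    {uh : Fin (q + 1) → EuclideanSpace ℂ (Fin p)} {l : Fin (q + 1) → ℝ}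
    (H : IsEigensystem u A uh l) (z : EuclideanSpace ℂ (Fin p)) :
    ‖projPerp (uh 0) z‖ ^ 2 = ∑ m : Fin q, ‖inner ℂ z (uh m.succ)‖ ^ 2 := by
  rw [← H.sum_sq_inner, Fin.sum_univ_succ, projPerp_apply_of_unit (H.orthonormal.1 0)]
  have h0 : inner ℂ (uh 0) (z - inner ℂ (uh 0) z • uh 0) = 0 := by
    rw [inner_sub_right, inner_smul_right, inner_self_eq_norm_sq_to_K, H.orthonormal.1]
    simp
  rw [h0, norm_zero, zero_pow two_ne_zero, zero_add]
  refine Finset.sum_congr rfl fun m _ => ?_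
  rw [inner_sub_right, inner_smul_right, H.orthonormal.2 (Fin.succ_ne_zero m), mul_zero, sub_zero,
    norm_inner_symm]

lemma isLittleO_one_div_of_tendsto {G : Type*} [NormedAddCommGroup G] [NormedSpace ℝ G]
    {f : ℕ → G} {g : ℕ → G} {c : G} (h : Tendsto (fun N : ℕ => (N : ℝ) • f N) atTop (𝓝 c))
    (hg : ∀ N : ℕ, N ≠ 0 → (N : ℝ) • g N = c) :
    (fun N => f N - g N) =o[atTop] fun N : ℕ => (1 : ℝ) / N := by
  have h1 : (fun N : ℕ => (N : ℝ) • f N - c) =o[atTop] fun _ : ℕ => (1 : ℝ) :=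
    (isLittleO_one_iff ℝ).2 (by simpa using h.sub_const c)
  have h2 := (isBigO_refl (fun N : ℕ => (1 : ℝ) / N) atTop).smul_isLittleO h1
  simp only [smul_eq_mul, mul_one] at h2
  refine h2.congr' ?_ EventuallyEq.rfl
  filter_upwards [eventually_ne_atTop 0] with N hN
  have hN' : (N : ℝ) ≠ 0 := by exact_mod_cast hN
  rw [← hg N hN, ← smul_sub, smul_smul, one_div, inv_mul_cancel₀ hN', one_smul]

end Coordinates

end ResidualInterference

/-! ### The residual interference after projection -/

open ResidualInterference

theorem mainTheorem4 {Ω : Type*} [MeasurableSpace Ω] (P : Measure Ω) [IsProbabilityMeasure P]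
    (p : ℕ) (hp : 2 ≤ p) (σs σ : ℝ) (hσs : 0 < σs) (hσ : 0 < σ)
    (a : EuclideanSpace ℂ (Fin p)) (ha : ‖a‖ ^ 2 = p)
    -- independent complex Gaussian samples
    (x : ℕ → Ω → EuclideanSpace ℂ (Fin p)) (hindep : iIndepFun x P)
    (hx : ∀ n, ResidualInterference.IsComplexGaussian P (x n)
      (ResidualInterference.modelCov a σs σ))
    -- ordered eigenvectors of the `N`-sample covariance matrix
    (uHat : ℕ → Ω → Fin p → EuclideanSpace ℂ (Fin p))
    (huHat_meas : ∀ N m, AEMeasurable (fun ω => uHat N ω m) P)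
    (huHat : ∀ N, ∀ᵐ ω ∂P, ResidualInterference.IsOrderedEigenbasis
      (ResidualInterference.sampleCov N fun n => x n ω) (uHat N ω))
    -- the estimated signature: the dominant eigenvector, in any scaling
    (aHat : ℕ → Ω → EuclideanSpace ℂ (Fin p))
    (haHat : ∀ N, ∀ᵐ ω ∂P, ∃ c : ℂ, c ≠ 0 ∧ aHat N ω = c • uHat N ω ⟨0, by omega⟩) :
    -- expected residual power in each of the directions `uHat m`, for `m` past the dominant one
    (∀ m : Fin p, (m : ℕ) ≠ 0 →
      (fun N : ℕ => (∫ ω, ‖ResidualInterference.proj (uHat N ω m) a‖ ^ 2 ∂P)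
          - p / N * ((p * ResidualInterference.inr σs σ + 1)
              / (p * ResidualInterference.inr σs σ) ^ 2))
        =o[atTop] fun N : ℕ => (1 : ℝ) / N) ∧
    -- the same constant in terms of the powers
    (∀ N : ℕ, (p : ℝ) * (σ ^ 2 / N) * ((p * σs ^ 2 + σ ^ 2) / (p * σs ^ 2) ^ 2)
      = p / N * ((p * ResidualInterference.inr σs σ + 1)
              / (p * ResidualInterference.inr σs σ) ^ 2)) ∧
    -- total expected residual power
    (∀ N, ∫ ω, ‖ResidualInterference.projPerp (aHat N ω) a‖ ^ 2 ∂P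
      = ∫ ω, ‖ResidualInterference.projPerp (uHat N ω ⟨0, by omega⟩) a‖ ^ 2 ∂P) ∧
    ((fun N : ℕ => (∫ ω, ‖ResidualInterference.projPerp (aHat N ω) a‖ ^ 2 ∂P)
          - p * (p - 1) / N * ((p * ResidualInterference.inr σs σ + 1)
              / (p * ResidualInterference.inr σs σ) ^ 2))
        =o[atTop] fun N : ℕ => (1 : ℝ) / N) ∧
    -- whiteness: the directions `uHat m` span the projected space, the components along different
    -- directions are orthogonal, and the residual covariance is a multiple of the projection
    (∀ N, ∀ᵐ ω ∂P, Submodule.span ℂ (uHat N ω '' {m | (m : ℕ) ≠ 0})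
      = (Submodule.span ℂ {aHat N ω})ᗮ) ∧
    (∀ N, ∀ m n : Fin p, m ≠ n →
      ∫ ω, inner ℂ (ResidualInterference.proj (uHat N ω m) a)
        (ResidualInterference.proj (uHat N ω n) a) ∂P = 0) ∧
    (∀ i j : Fin p,
      (fun N : ℕ => ResidualInterference.residualCov P a σs (aHat N) i j
          - ((σ ^ 2 * (1 / N * (1 + 1 / (p * ResidualInterference.inr σs σ))) : ℝ) : ℂ)
            * ResidualInterference.projPerp a (EuclideanSpace.single j 1) i)
        =o[atTop] fun N : ℕ => (1 : ℝ) / N) ∧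
    -- residual interference-to-noise ratio
    ((fun N : ℕ => ResidualInterference.residualINR P a σs σ (aHat N)
          - 1 / N * (1 + 1 / (p * ResidualInterference.inr σs σ)))
        =o[atTop] fun N : ℕ => (1 : ℝ) / N) := by
  have hp' : ∃ q, p = q + 1 ∧ 0 < q := ⟨p - 1, by omega, by omega⟩
  obtain ⟨q, rfl, hq⟩ := hp'
  have h00 : ∀ h : 0 < q + 1, (⟨0, h⟩ : Fin (q + 1)) = 0 := fun _ => rfl
  simp only [h00] at haHat ⊢
  -- normalize the signature: `a = √p u` with `‖u‖ = 1`
  set s : ℝ := √((q + 1 : ℕ) : ℝ) with hs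
  have hs2 : s ^ 2 = ((q + 1 : ℕ) : ℝ) := Real.sq_sqrt (Nat.cast_nonneg _)
  have hppos : (0 : ℝ) < ((q + 1 : ℕ) : ℝ) := by positivity
  have hspos : 0 < s := Real.sqrt_pos.2 hppos
  have hsc : (s : ℂ) ≠ 0 := by exact_mod_cast hspos.ne'
  obtain ⟨u, hau⟩ : ∃ u, a = (s : ℂ) • u := ⟨(s : ℂ)⁻¹ • a, (smul_inv_smul₀ hsc a).symm⟩
  have hu : ‖u‖ = 1 := by
    rw [hau, norm_smul, Complex.norm_real, Real.norm_of_nonneg hspos.le, mul_pow, hs2] at ha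
    have h1 : ‖u‖ ^ 2 = 1 := by
      have := mul_left_cancel₀ hppos.ne' (ha.trans (mul_one _).symm)
      exact this
    exact (pow_eq_one_iff_of_nonneg (norm_nonneg u) two_ne_zero).1 h1
  set δ : ℝ := σs ^ 2 * s ^ 2 with hδdef
  set v : ℝ := σ ^ 2 with hvdef
  have hδ : 0 < δ := by positivity
  have hv : 0 < v := by positivity
  have hδp : δ = ((q + 1 : ℕ) : ℝ) * σs ^ 2 := by rw [hδdef, hs2, mul_comm]
  have hcirc : ∀ n, IsCircular P (x n) (spike u δ v) := fun n => (hx n).isCircular hau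
  have hH : ∀ N : ℕ, ∀ᵐ ω ∂P, ∃ l : Fin (q + 1) → ℝ, (∀ m, 0 ≤ l m) ∧
      IsEigensystem u ((N : ℝ)⁻¹ • gram fun n : Fin N => x n ω) (uHat N ω) l := fun N => by
    filter_upwards [huHat N] with ω h
    exact h.exists_isEigensystem hu
  have hF : Module.finrank ℂ (EuclideanSpace ℂ (Fin (q + 1))) = q + 1 := by simp
  have hinner : ∀ y, ‖inner ℂ a y‖ ^ 2 = ((q + 1 : ℕ) : ℝ) * ‖inner ℂ u y‖ ^ 2 := fun y => by
    rw [hau, inner_smul_left, norm_mul, mul_pow, RCLike.norm_conj, Complex.norm_real,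
      Real.norm_of_nonneg hspos.le, hs2]
  have hperp : ∀ N, ∀ᵐ ω ∂P, projPerp (aHat N ω) = projPerp (uHat N ω 0) := fun N => by
    filter_upwards [haHat N] with ω ⟨c, hc, h⟩
    rw [h, projPerp_smul hc]
  -- the constants in terms of the interference-to-noise ratio
  have hconst : ((q + 1 : ℕ) : ℝ) * (v * (δ + v) / δ ^ 2)
      = ((q + 1 : ℕ) : ℝ) * ((((q + 1 : ℕ) : ℝ) * inr σs σ + 1)
        / (((q + 1 : ℕ) : ℝ) * inr σs σ) ^ 2) := by
    rw [hδp, hvdef, inr]; field_simp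
  have hconst2 : σs ^ 2 * s ^ 2 * (v * (δ + v) / δ ^ 2)
      = σ ^ 2 * (1 + 1 / (((q + 1 : ℕ) : ℝ) * inr σs σ)) := by
    rw [← hδdef, hδp, hvdef, inr]; field_simp
  -- the total residual power is the sum over all the eigenvectors past the leading one
  have hnorm : ∀ N, ∫ ω, ‖projPerp (aHat N ω) a‖ ^ 2 ∂P
      = ((q + 1 : ℕ) : ℝ) * ∫ ω, ∑ m : Fin q with m.val < q,
        ‖inner ℂ u (uHat N ω m.succ)‖ ^ 2 ∂P := fun N => by
    rw [← integral_const_mul]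
    refine integral_congr_ae ?_
    filter_upwards [hperp N, hH N] with ω h1 ⟨l, _, H⟩
    rw [h1, H.norm_projPerp_sq, Finset.mul_sum]
    simp_rw [hinner]
    simp
  have htotal : Tendsto (fun N : ℕ => (N : ℝ) • ∫ ω, ‖projPerp (aHat N ω) a‖ ^ 2 ∂P) atTop
      (𝓝 (((q + 1 : ℕ) : ℝ) * (q * (v * (δ + v) / δ ^ 2)))) := by
    have h := (IsCircular.tendsto_mul_integral_sum hindep hcirc hδ hv hq huHat_meas hH hu hF
      le_rfl).const_mul ((q + 1 : ℕ) : ℝ)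
    refine h.congr fun N => ?_
    rw [hnorm, smul_eq_mul]; ring
  have hq' : (q : ℝ) ≠ 0 := by exact_mod_cast hq.ne'
  have hsub : (((q + 1 : ℕ) : ℝ) - 1) = q := by push_cast; ring
  refine ⟨fun m hm => ?_, fun N => ?_, fun N => ?_, ?_, fun N => ?_, fun N m n hmn => ?_,
    fun i j => ?_, ?_⟩
  · obtain ⟨m, rfl⟩ : ∃ m' : Fin q, m = m'.succ :=
      ⟨m.pred fun h => hm (by rw [h]; rfl), (Fin.succ_pred _ _).symm⟩
    have h := (IsCircular.tendsto_mul_integral_norm_inner_sq hindep hcirc hδ hv hq huHat_meas hH hu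
      hF m).const_mul ((q + 1 : ℕ) : ℝ)
    rw [hconst] at h
    refine isLittleO_one_div_of_tendsto (h.congr fun N => ?_) fun N hN => ?_
    · have e : ∫ ω, ‖proj (uHat N ω m.succ) a‖ ^ 2 ∂P
          = ((q + 1 : ℕ) : ℝ) * ∫ ω, ‖inner ℂ u (uHat N ω m.succ)‖ ^ 2 ∂P := by
        rw [← integral_const_mul]
        refine integral_congr_ae ?_
        filter_upwards [hH N] with ω ⟨l, _, H⟩
        rw [proj_apply_of_unit (H.orthonormal.1 _), norm_smul, H.orthonormal.1, mul_one,
          norm_inner_symm, hinner]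
      rw [e, smul_eq_mul]; ring
    · have hN' : (N : ℝ) ≠ 0 := by exact_mod_cast hN
      rw [smul_eq_mul]; field_simp
  · rw [inr, hvdef]; field_simp
  · refine integral_congr_ae ?_
    filter_upwards [hperp N] with ω h
    rw [h]
  · refine isLittleO_one_div_of_tendsto htotal fun N hN => ?_
    have hN' : (N : ℝ) ≠ 0 := by exact_mod_cast hN
    rw [hsub, smul_eq_mul]
    have e : ∀ K : ℝ, (N : ℝ) * (((q + 1 : ℕ) : ℝ) * q / N * K) = q * (((q + 1 : ℕ) : ℝ) * K) :=
      fun K => by field_simp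
    rw [e, ← hconst]; ring
  · filter_upwards [huHat N, haHat N] with ω h ⟨c, hc, h2⟩
    rw [span_image_eq_orthogonal h.1, h2, Submodule.span_singleton_smul_eq (IsUnit.mk0 c hc)]
  · refine integral_eq_zero_of_ae ?_
    filter_upwards [huHat N] with ω h
    rw [proj_apply_of_unit (h.1.1 _), proj_apply_of_unit (h.1.1 _), inner_smul_left,
      inner_smul_right, h.1.2 hmn]
    simp
  · have h := (IsCircular.tendsto_mul_integral_residual hindep hcirc hδ hv hq huHat_meas hH hu hF
      (EuclideanSpace.single i 1) (EuclideanSpace.single j 1)).const_mul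
      ((σs ^ 2 * s ^ 2 : ℝ) : ℂ)
    refine isLittleO_one_div_of_tendsto (h.congr fun N => ?_) fun N hN => ?_
    · have e : ∫ ω, projPerp (aHat N ω) a i * conj (projPerp (aHat N ω) a j) ∂P
          = ((s ^ 2 : ℝ) : ℂ) * ∫ ω, inner ℂ (EuclideanSpace.single i 1)
              (u - inner ℂ (uHat N ω 0) u • uHat N ω 0)
            * inner ℂ (u - inner ℂ (uHat N ω 0) u • uHat N ω 0) (EuclideanSpace.single j 1) ∂P := by
        rw [← integral_const_mul]
        refine integral_congr_ae ?_
        filter_upwards [hperp N, huHat N] with ω h1 h2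
        have e2 : projPerp (uHat N ω 0) a
            = (s : ℂ) • (u - inner ℂ (uHat N ω 0) u • uHat N ω 0) := by
          rw [hau, map_smul, projPerp_apply_of_unit (h2.1.1 0)]
        rw [h1, e2, EuclideanSpace.inner_single_left, EuclideanSpace.inner_single_right]
        simp only [PiLp.smul_apply, smul_eq_mul, map_mul, Complex.conj_ofReal, map_one, one_mul]
        push_cast; ring
      rw [residualCov, Matrix.of_apply, e, Complex.real_smul]
      push_cast; ring
    · have hproj : projPerp a = projPerp u := by rw [hau, projPerp_smul hsc]
      have hNc : (N : ℂ) ≠ 0 := by exact_mod_cast hN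
      rw [inner_toPerp_toPerp, EuclideanSpace.inner_single_left, map_one, one_mul, hproj,
        ← mul_assoc (((σs ^ 2 * s ^ 2 : ℝ)) : ℂ), ← Complex.ofReal_mul, hconst2, hvdef,
        Complex.real_smul]
      push_cast
      field_simp
  · have h := htotal.const_mul (σs ^ 2 / σ ^ 2 / q)
    refine isLittleO_one_div_of_tendsto (h.congr fun N => ?_) fun N hN => ?_
    · rw [residualINR, hsub, smul_eq_mul, smul_eq_mul]
      field_simp
    · have hN' : (N : ℝ) ≠ 0 := by exact_mod_cast hN
      rw [hδp, hvdef, inr, smul_eq_mul]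
      field_simp
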